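/- Let $C$ be an algebraically closed field with a multiplicative norm $|\cdot|$ (in particular $\mathbb C$ with the usual absolute value, or any algebraically closed field with an ultrametric norm). Let $q\in C$ with $|q|=1$, $q$ not a root of unity, and for every $n\ge 1$ fix $q^{1/n}\in C$ with $(q^{1/n})^n=q$. A power series is called convergent if its radius of convergence is positive. For $a\in C$, $p \in C^*$ put $(a;p)_n=\prod_{k=0}^{n-1}(1-p^ka)$, and assume that $\sum_{n\ge0} x^n/(q;q)_n$ is convergent. Let $C\{x\}\subset C[[x]]$ be the ring of convergent power series, $K=C(\{x\})$ its field of fractions and $\widehat K=C((x))$, both with the automorphism $\sigma_q\colon f(x)\mapsto f(qx)$. A $q$-difference module over $F\in\{K,\widehat K\}$ is a finite-dimensional $F$-vector space $M$ with an additive bijection $\Sigma\colon M\to M$ such that $\Sigma(fm)=\sigma_q(f)\Sigma(m)$; an isomorphism is an $F$-linear bijection commuting with the operators $\Sigma$. If $\mathcal M=(M,\Sigma)$ is a $q$-difference module over $K$, then $\mathcal M_{\widehat K}=(M\otimes_K\widehat K,\Sigma\otimes\sigma_q)$. Let $L=\sum_i a_i(x)\sigma_q^i\in C\{x\}[\sigma_q]$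 (skew polynomials, $\sigma_qf(x)=f(qx)\sigma_q$). The slopes of $L$ are the finite slopes of its Newton polygon, the convex hull in $\mathbb R^2$ of $\{(i,k): a_i\ne0,\ k\ge \operatorname{ord}_x a_i\}$. For an integral slope $\mu$ of an operator $\sum_i a_i(t)\sigma_p^i$, let $c=\min_i(\operatorname{ord}_t a_i-\mu i)$; the exponents $\lambda_1,\dots,\lambda_r$ of $\mu$ are the nonzero roots, with multiplicity, of the characteristic polynomial $\sum_i b_iT^i$, where $b_i\in C$ is the coefficient of $t^{c}$ in $p^{-\mu i(i-1)/2}t^{-\mu i}a_i(t)$. The integral slope $\mu$ is admissible if the series $$\sum_{n\ge0}\frac{x^n}{\prod_{a\in\Lambda}(a;p)_n}$$ is convergent, where $\Lambda$ is the family of all $\lambda_i\lambda_j^{-1}$ ($1\le i,j\le r$) that do not belong to $\{p^{-m}:m\ge0\}$. A slope $\mu\in\mathbb Q$ of $L$ is almost admissible if there is an $n\ge1$ with $n\mu\in\mathbb Z$ such that $n\mu$ is an admissible slope of the ramified operator $\sum_i a_i(t^n)\sigma_{p}^i$, $t=x^{1/n}$, $p=q^{1/n}$. The operator $L$ is almost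 admissible if all its slopes are almost admissible, and a $q$-difference module $\mathcal M$ over $K$ is almost admissible if it is isomorphic to $K[\sigma_q]/K[\sigma_q]L$ for some almost admissible $L\in C\{x\}[\sigma_q]$. Proposition. Let $\mathcal M$ and $\mathcal N$ be almost admissible $q$-difference modules over $K$. Then $\mathcal M$ and $\mathcal N$ are isomorphic over $K$ if and only if $\mathcal M_{\widehat K}$ and $\mathcal N_{\widehat K}$ are isomorphic over $\widehat K$. -/

import Mathlib

open scoped Polynomial PowerSeries LaurentSeries TensorProduct

universe u v w

noncomputable section

namespace QDiff

/-! ## Convergent power series and germs of meromorphic functions -/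

section Germs

variable {C : Type u} [NormedField C]

/-- A power series is convergent if its radius of convergence is positive. -/
def IsConvergent (f : C⟦X⟧) : Prop :=
  ∃ r : ℝ, 0 < r ∧ Summable fun n : ℕ => ‖PowerSeries.coeff n f‖ * r ^ n

/-- Cauchy's criterion: convergence means that the coefficients grow at most geometrically. -/
theorem isConvergent_iff (f : C⟦X⟧) :
    IsConvergent f ↔
      ∃ A B : ℝ, 0 < A ∧ 0 < B ∧ ∀ n : ℕ, ‖PowerSeries.coeff n f‖ ≤ A * B ^ n := by
  constructor
  · rintro ⟨r, hr, hs⟩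
    refine ⟨(∑' n, ‖PowerSeries.coeff n f‖ * r ^ n) + 1, r⁻¹, ?_, inv_pos.2 hr, fun n => ?_⟩
    · have : 0 ≤ ∑' n, ‖PowerSeries.coeff n f‖ * r ^ n := tsum_nonneg fun n => by positivity
      linarith
    · have h := hs.le_tsum n (fun j _ => by positivity)
      rw [inv_pow, ← div_eq_mul_inv, le_div_iff₀ (by positivity)]
      linarith
  · rintro ⟨A, B, hA, hB, h⟩
    refine ⟨(2 * B)⁻¹, by positivity, ?_⟩
    refine Summable.of_nonneg_of_le (fun n => by positivity) (fun n => ?_)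
      ((summable_geometric_of_lt_one (r := (1 / 2 : ℝ)) (by norm_num) (by norm_num)).mul_left A)
    calc ‖PowerSeries.coeff n f‖ * (2 * B)⁻¹ ^ n ≤ A * B ^ n * (2 * B)⁻¹ ^ n := by
          gcongr; exact h n
      _ = A * (1 / 2) ^ n := by
          rw [mul_assoc, ← mul_pow]
          congr 2
          field_simp

variable (C) in
/-- The ring `C{x}` of convergent power series. -/
def ConvSeries : Subring C⟦X⟧ where
  carrier := {f | IsConvergent f}
  zero_mem' := ⟨1, one_pos, by simp⟩
  one_mem' := by
    refine (isConvergent_iff _).2 ⟨1, 1, one_pos, one_pos, fun n => ?_⟩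
    rw [PowerSeries.coeff_one]
    split_ifs <;> simp
  add_mem' := by
    intro f g hf hg
    obtain ⟨A, B, hA, hB, h⟩ := (isConvergent_iff f).1 hf
    obtain ⟨A', B', hA', hB', h'⟩ := (isConvergent_iff g).1 hg
    refine (isConvergent_iff _).2 ⟨A + A', max B B', by positivity, by positivity, fun n => ?_⟩
    rw [map_add, add_mul]
    refine (norm_add_le _ _).trans (add_le_add ((h n).trans ?_) ((h' n).trans ?_))
    · gcongr; exact le_max_left _ _
    · gcongr; exact le_max_right _ _
  neg_mem' := by
    rintro f ⟨r, hr, h⟩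
    exact ⟨r, hr, by simpa using h⟩
  mul_mem' := by
    intro f g hf hg
    obtain ⟨A, B, hA, hB, h⟩ := (isConvergent_iff f).1 hf
    obtain ⟨A', B', hA', hB', h'⟩ := (isConvergent_iff g).1 hg
    refine (isConvergent_iff _).2
      ⟨A * A', 2 * max B B', by positivity, by positivity, fun n => ?_⟩
    rw [PowerSeries.coeff_mul]
    calc ‖∑ p ∈ Finset.HasAntidiagonal.antidiagonal n, PowerSeries.coeff p.1 f * PowerSeries.coeff p.2 g‖
        ≤ ∑ p ∈ Finset.HasAntidiagonal.antidiagonal n, A * A' * (max B B') ^ n := by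
          refine norm_sum_le_of_le _ fun p hp => ?_
          rw [Finset.HasAntidiagonal.mem_antidiagonal] at hp
          rw [norm_mul, ← hp, pow_add]
          calc _ ≤ (A * B ^ p.1) * (A' * B' ^ p.2) := by
                gcongr
                · exact h _
                · exact h' _
            _ ≤ (A * (max B B') ^ p.1) * (A' * (max B B') ^ p.2) := by
                gcongr
                · exact le_max_left _ _
                · exact le_max_right _ _
            _ = _ := by ring
      _ = (n + 1) * (A * A' * (max B B') ^ n) := by simp
      _ ≤ 2 ^ n * (A * A' * (max B B') ^ n) := by
          gcongr
          exact_mod_cast Nat.lt_two_pow_self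
      _ = _ := by rw [mul_pow]; ring

variable (C) in
/-- The field `K = C({x})` of germs of meromorphic functions at `0`: the field of fractions of
`C{x}`, realised inside the field `C((x))` of formal Laurent series. -/
def MeroGerm : Subfield C⸨X⸩ where
  carrier := {f | ∃ g ∈ ConvSeries C, ∃ h ∈ ConvSeries C, h ≠ 0 ∧
    f * (h : C⸨X⸩) = (g : C⸨X⸩)}
  zero_mem' := ⟨0, zero_mem _, 1, one_mem _, one_ne_zero, by simp⟩
  one_mem' := ⟨1, one_mem _, 1, one_mem _, one_ne_zero, by simp⟩
  add_mem' := by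
    rintro a b ⟨g, hg, h, hh, h0, e⟩ ⟨g', hg', h', hh', h0', e'⟩
    refine ⟨g * h' + g' * h, add_mem (mul_mem hg hh') (mul_mem hg' hh), h * h',
      mul_mem hh hh', mul_ne_zero h0 h0', ?_⟩
    simp only [map_mul, map_add, ← e, ← e']
    ring
  neg_mem' := by
    rintro a ⟨g, hg, h, hh, h0, e⟩
    exact ⟨-g, neg_mem hg, h, hh, h0, by simp [← e]⟩
  mul_mem' := by
    rintro a b ⟨g, hg, h, hh, h0, e⟩ ⟨g', hg', h', hh', h0', e'⟩
    refine ⟨g * g', mul_mem hg hg', h * h', mul_mem hh hh', mul_ne_zero h0 h0', ?_⟩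
    simp only [map_mul, ← e, ← e']
    ring
  inv_mem' := by
    rintro a ⟨g, hg, h, hh, h0, e⟩
    by_cases ha : a = 0
    · exact ⟨0, zero_mem _, 1, one_mem _, one_ne_zero, by simp [ha]⟩
    · refine ⟨h, hh, g, hg, ?_, ?_⟩
      · rintro rfl
        have hh0 : (h : C⸨X⸩) ≠ 0 := fun k =>
          h0 (HahnSeries.ofPowerSeries_injective (Γ := ℤ) (by simpa using k))
        exact mul_ne_zero ha hh0 (by simpa using e)
      · rw [← e, inv_mul_cancel_left₀ ha]

/-- The inclusion of `C{x}` into its field of fractions `C({x})`. -/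
def convToMero : ConvSeries C →+* MeroGerm C :=
  ((HahnSeries.ofPowerSeries ℤ C).comp (ConvSeries C).subtype).codRestrict (MeroGerm C)
    fun f => show ∃ g ∈ ConvSeries C, ∃ h ∈ ConvSeries C, h ≠ 0 ∧ _ from
      ⟨f.1, f.2, 1, one_mem _, one_ne_zero, by simp⟩

/-! ## The `q`-difference operator `f(x) ↦ f(qx)` -/

/-- `f(x) ↦ f(qx)` on formal Laurent series, on coefficients: `aₙ ↦ qⁿ aₙ`. -/
def qDilate (q : Cˣ) (f : C⸨X⸩) : C⸨X⸩ where
  coeff n := ((q ^ n : Cˣ) : C) * f.coeff n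
  isPWO_support' := f.isPWO_support.mono fun n hn => by
    simp only [Function.mem_support] at hn
    exact right_ne_zero_of_mul hn

theorem qDilate_support (q : Cˣ) (f : C⸨X⸩) : (qDilate q f).support = f.support := by
  ext n
  simp only [qDilate, HahnSeries.mem_support, ne_eq, Units.mul_right_eq_zero]

theorem qDilate_mul (q : Cˣ) (f g : C⸨X⸩) :
    qDilate q (f * g) = qDilate q f * qDilate q g := by
  ext n
  rw [HahnSeries.coeff_mul]
  change ((q ^ n : Cˣ) : C) * (f * g).coeff n = _
  rw [HahnSeries.coeff_mul, Finset.mul_sum]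
  refine Finset.sum_congr ?_ ?_
  · ext p
    simp only [Finset.mem_antidiagonal, qDilate_support]
  · intro p hp
    rw [Finset.mem_antidiagonal] at hp
    change _ = (((q ^ p.1 : Cˣ) : C) * f.coeff p.1) * (((q ^ p.2 : Cˣ) : C) * g.coeff p.2)
    rw [← hp.2.2, zpow_add, Units.val_mul]
    ring

/-- The automorphism `σ_q : f(x) ↦ f(qx)` of `C((x))`. -/
def sigmaHat (q : Cˣ) : C⸨X⸩ ≃+* C⸨X⸩ where
  toFun := qDilate q
  invFun := qDilate q⁻¹
  left_inv f := by
    ext n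
    simp only [qDilate, inv_zpow, Units.inv_mul_cancel_left]
  right_inv f := by
    ext n
    simp only [qDilate, inv_zpow, Units.mul_inv_cancel_left]
  map_mul' := qDilate_mul q
  map_add' f g := by
    ext n
    simp [qDilate, mul_add]

theorem sigmaHat_ofPowerSeries (q : Cˣ) (f : C⟦X⟧) :
    sigmaHat q (f : C⸨X⸩) = (PowerSeries.rescale (q : C) f : C⟦X⟧) := by
  ext n
  change ((q ^ n : Cˣ) : C) * _ = _
  rw [PowerSeries.coeff_coe, PowerSeries.coeff_coe]
  split_ifs with h
  · simp
  · rw [PowerSeries.coeff_rescale]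
    obtain ⟨m, rfl⟩ := Int.eq_ofNat_of_zero_le (not_lt.1 h)
    simp

theorem rescale_mem (q : Cˣ) {f : C⟦X⟧} (hf : f ∈ ConvSeries C) :
    PowerSeries.rescale (q : C) f ∈ ConvSeries C := by
  obtain ⟨A, B, hA, hB, h⟩ := (isConvergent_iff f).1 hf
  refine (isConvergent_iff _).2
    ⟨A, ‖(q : C)‖ * B, hA, mul_pos (norm_pos_iff.2 q.ne_zero) hB, fun n => ?_⟩
  rw [PowerSeries.coeff_rescale, norm_mul, norm_pow, mul_pow]
  calc _ ≤ ‖(q : C)‖ ^ n * (A * B ^ n) := by gcongr; exact h n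
    _ = _ := by ring

theorem sigmaHat_mem (q : Cˣ) {f : C⸨X⸩} (hf : f ∈ MeroGerm C) :
    sigmaHat q f ∈ MeroGerm C := by
  change ∃ g ∈ ConvSeries C, ∃ h ∈ ConvSeries C, h ≠ 0 ∧ f * (h : C⸨X⸩) = (g : C⸨X⸩) at hf
  change ∃ g ∈ ConvSeries C, ∃ h ∈ ConvSeries C, h ≠ 0 ∧
    sigmaHat q f * (h : C⸨X⸩) = (g : C⸨X⸩)
  obtain ⟨g, hg, h, hh, h0, e⟩ := hf
  refine ⟨_, rescale_mem q hg, _, rescale_mem q hh, ?_, ?_⟩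
  · intro k
    have h1 := sigmaHat_ofPowerSeries q h
    rw [k, map_zero, map_eq_zero_iff _ (sigmaHat q).injective] at h1
    exact h0 (HahnSeries.ofPowerSeries_injective (Γ := ℤ) (by simpa using h1))
  · rw [← sigmaHat_ofPowerSeries, ← sigmaHat_ofPowerSeries, ← map_mul, e]

/-- The automorphism `σ_q : f(x) ↦ f(qx)` of `C({x})`. -/
def sigma (q : Cˣ) : MeroGerm C ≃+* MeroGerm C where
  toFun f := ⟨sigmaHat q f, sigmaHat_mem q f.2⟩
  invFun f := ⟨sigmaHat q⁻¹ f, sigmaHat_mem q⁻¹ f.2⟩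
  left_inv f := Subtype.ext ((sigmaHat q).left_inv f.1)
  right_inv f := Subtype.ext ((sigmaHat q).right_inv f.1)
  map_mul' f g := Subtype.ext (map_mul (sigmaHat q) f.1 g.1)
  map_add' f g := Subtype.ext (map_add (sigmaHat q) f.1 g.1)

end Germs

/-! ## `q`-difference modules -/

/-- A `q`-difference module over a field `F` with an automorphism `σ` (the action of `σ_q`):
a finite dimensional `F`-vector space with a `σ`-linear bijection `Sig`. -/
structure QDiffModule (F : Type u) [Field F] (σ : F ≃+* F) where
  carrier : Type v
  [addCommGroup : AddCommGroup carrier]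
  [module : Module F carrier]
  [finite : FiniteDimensional F carrier]
  Sig : carrier →ₛₗ[(σ : F →+* F)] carrier
  bijective : Function.Bijective Sig

attribute [instance] QDiffModule.addCommGroup QDiffModule.module QDiffModule.finite

section Modules

variable {F : Type u} [Field F] {σ : F ≃+* F}

/-- Isomorphism of `q`-difference modules over `F`: an `F`-linear isomorphism commuting with
the `σ`-linear operators. -/
def QDiffModule.Isomorphic (M : QDiffModule.{u, v} F σ) (N : QDiffModule.{u, w} F σ) : Prop :=
  ∃ e : M.carrier ≃ₗ[F] N.carrier, ∀ m, e (M.Sig m) = N.Sig (e m)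

variable {G : Type w} [Field G] [Algebra F G]

/-- An automorphism `τ` of an extension field `G` of `F` extending `σ`, as a `σ`-linear map. -/
def extSemilinear (τ : G ≃+* G) (h : ∀ f : F, τ (algebraMap F G f) = algebraMap F G (σ f)) :
    G →ₛₗ[(σ : F →+* F)] G where
  toFun := τ
  map_add' := map_add τ
  map_smul' f g := by
    rw [Algebra.smul_def, Algebra.smul_def, map_mul, h]
    rfl

/-- The map `τ ⊗ Sig` on `G ⊗ M`, which is `τ`-linear. -/
def baseChangeSig (M : QDiffModule.{u, v} F σ) (τ : G ≃+* G)
    (h : ∀ f : F, τ (algebraMap F G f) = algebraMap F G (σ f)) :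
    G ⊗[F] M.carrier →ₛₗ[(τ : G →+* G)] G ⊗[F] M.carrier where
  toFun := TensorProduct.map (extSemilinear τ h) M.Sig
  map_add' := map_add _
  map_smul' g z := by
    induction z using TensorProduct.induction_on with
    | zero => simp
    | tmul a m => simp [TensorProduct.smul_tmul', extSemilinear]
    | add a b ha hb => rw [smul_add, map_add, ha, hb, map_add, smul_add]

/-- Extension of scalars `M_G = (G ⊗ M, τ ⊗ Sig)` of a `q`-difference module along an extension
`(G, τ)` of `(F, σ)`. -/
def QDiffModule.baseChange (M : QDiffModule.{u, v} F σ) (τ : G ≃+* G)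
    (h : ∀ f : F, τ (algebraMap F G f) = algebraMap F G (σ f)) : QDiffModule G τ where
  carrier := G ⊗[F] M.carrier
  Sig := baseChangeSig M τ h
  bijective := by
    have := RingHomInvPair.of_ringEquiv σ
    have := RingHomInvPair.of_ringEquiv_symm σ
    exact (TensorProduct.congr
      (LinearEquiv.ofBijective (extSemilinear τ h) τ.bijective)
      (LinearEquiv.ofBijective M.Sig M.bijective)).bijective

end Modules

/-! ## `q`-difference operators and the modules attached to them

An operator `∑ fᵢ σ_qⁱ` of `R[σ_q]` is written with its coefficients on the left and is stored as
the polynomial with the same coefficients; only the left module structure of `R[X]` is used. The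
commutation rule `σ_q f = σ(f) σ_q` enters through `sigmaMul`. -/

section Operators

variable {F : Type u} [Field F]

/-- Left multiplication by `σ_q` in the skew ring `F[σ_q]`:
`σ_q ∑ fᵢ σ_qⁱ = ∑ σ(fᵢ) σ_qⁱ⁺¹`. -/
def sigmaMul (σ : F ≃+* F) : F[X] →ₛₗ[(σ : F →+* F)] F[X] where
  toFun P := Polynomial.X * P.map (σ : F →+* F)
  map_add' P Q := by rw [Polynomial.map_add, mul_add]
  map_smul' f P := by
    ext n
    cases n <;> simp

/-- The left ideal `F[σ_q] L`, that is, the `F`-span of the operators `σ_qᵏ L`, `k ≥ 0`. -/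
def leftIdeal (σ : F ≃+* F) (L : F[X]) : Submodule F F[X] :=
  Submodule.span F (Set.range fun k : ℕ => (sigmaMul σ)^[k] L)

theorem leftIdeal_le_comap (σ : F ≃+* F) (L : F[X]) :
    leftIdeal σ L ≤ (leftIdeal σ L).comap (sigmaMul σ) := by
  refine Submodule.span_le.2 ?_
  rintro _ ⟨k, rfl⟩
  refine Submodule.subset_span ⟨k + 1, ?_⟩
  simp only [Function.iterate_succ_apply']

/-- Left multiplication by `σ_q` on `F[σ_q] / F[σ_q] L`. -/
def quotientSig (σ : F ≃+* F) (L : F[X]) :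
    (F[X] ⧸ leftIdeal σ L) →ₛₗ[(σ : F →+* F)] (F[X] ⧸ leftIdeal σ L) :=
  (leftIdeal σ L).mapQ (leftIdeal σ L) (sigmaMul σ) (leftIdeal_le_comap σ L)

/-- `M` is isomorphic to `F[σ_q] / F[σ_q] L`. -/
def QDiffModule.IsAssociated {σ : F ≃+* F} (M : QDiffModule.{u, v} F σ) (L : F[X]) : Prop :=
  ∃ e : M.carrier ≃ₗ[F] (F[X] ⧸ leftIdeal σ L), ∀ m, e (M.Sig m) = quotientSig σ L (e m)

end Operators

/-! ## Newton polygon, exponents, admissibility -/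

section Newton

variable {C : Type u}

/-- The Newton polygon of `L = ∑ aᵢ σ_qⁱ`: the convex hull in `ℝ²` of the points `(i, k)` with
`aᵢ ≠ 0` and `k ≥ ord aᵢ`. -/
def newtonPolygon [Semiring C] (L : (C⟦X⟧)[X]) : Set (ℝ × ℝ) :=
  convexHull ℝ {P | ∃ i : ℕ, L.coeff i ≠ 0 ∧ P.1 = i ∧
    ((L.coeff i).order.toNat : ℝ) ≤ P.2}

/-- `μ` is a finite slope of the Newton polygon: some non-vertical segment of slope `μ` joining
two points of the polygon lies on its lower boundary. -/
def IsSlope [Semiring C] (L : (C⟦X⟧)[X]) (μ : ℚ) : Prop :=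
  ∃ P ∈ newtonPolygon L, ∃ P' ∈ newtonPolygon L,
    P.1 < P'.1 ∧ P'.2 - P.2 = μ * (P'.1 - P.1) ∧
      ∀ Q ∈ newtonPolygon L, P.2 - μ * P.1 ≤ Q.2 - μ * Q.1

variable [Field C]

/-- The coefficient of `σ_pⁱ` in `θ^μ L θ^{-μ}`, where `θ(p t) = t θ(t)`: since
`θ(pⁱ t) = p^{i(i-1)/2} tⁱ θ(t)`, it is `p^{-μ i(i-1)/2} t^{-μ i} aᵢ(t)`. -/
def twistedCoeff (p : Cˣ) (L : (C⟦X⟧)[X]) (μ : ℤ) (i : ℕ) : C⸨X⸩ :=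
  HahnSeries.single (-(μ * i)) ((p ^ (-(μ * (i.choose 2 : ℕ))) : Cˣ) : C) *
    (L.coeff i : C⸨X⸩)

/-- The smallest order at `0` of the coefficients of `θ^μ L θ^{-μ}`; multiplying by `t` to the
opposite power yields coefficients without poles which do not all vanish at `0`. -/
def twistedOrder (p : Cˣ) (L : (C⟦X⟧)[X]) (μ : ℤ) : ℤ :=
  sInf {k : ℤ | ∃ i : ℕ, twistedCoeff p L μ i ≠ 0 ∧ k = (twistedCoeff p L μ i).order}

/-- The characteristic polynomial of the integral slope `μ` of `L ∈ C[[t]][σ_p]`: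
`∑ bᵢ(0) Tⁱ`, where `∑ bᵢ σ_pⁱ` is the normalised operator `t^c θ^μ L θ^{-μ}`. -/
def charPoly (p : Cˣ) (L : (C⟦X⟧)[X]) (μ : ℤ) : C[X] :=
  ∑ i ∈ Finset.range (L.natDegree + 1),
    Polynomial.monomial i ((twistedCoeff p L μ i).coeff (twistedOrder p L μ))

open Classical in
/-- The exponents of the integral slope `μ`: the nonzero roots, with multiplicities, of the
characteristic polynomial. -/
def exponents (p : Cˣ) (L : (C⟦X⟧)[X]) (μ : ℤ) : Multiset C :=
  (charPoly p L μ).roots.filter (· ≠ 0)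

/-- The `p`-Pochhammer symbol `(a; p)_n = (1 - a)(1 - p a) ⋯ (1 - p^{n-1} a)`. -/
def qPochhammer (a p : C) (n : ℕ) : C :=
  ∏ k ∈ Finset.range n, (1 - p ^ k * a)

/-- The series `φ_{(p; Λ)}(x) = ∑ xⁿ / ((a₁; p)_n ⋯ (a_m; p)_n)`, `Λ = (a₁, …, a_m)`. -/
def phi (p : C) (Λ : Multiset C) : C⟦X⟧ :=
  PowerSeries.mk fun n => ((Λ.map fun a => qPochhammer a p n).prod)⁻¹

open Classical in
/-- The quotients `λᵢ λⱼ⁻¹` of the members of `E` that do not lie in `p^{ℤ_{≤ 0}}`. -/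
def exponentRatios (p : C) (E : Multiset C) : Multiset C :=
  ((E ×ˢ E).map fun z => z.1 * z.2⁻¹).filter fun a => ¬ ∃ m : ℕ, a = (p ^ m)⁻¹

/-- The ramified operator `∑ aᵢ(tⁿ) σⁱ` obtained by `x = tⁿ`. -/
def ramify (n : ℕ) (hn : n ≠ 0) (L : (C⟦X⟧)[X]) : (C⟦X⟧)[X] :=
  L.map (PowerSeries.expand n hn : C⟦X⟧ →ₐ[C] C⟦X⟧).toRingHom

end Newton

section Admissible

variable {C : Type u} [NormedField C]

/-- The integral slope `μ` of `L ∈ C[[t]][σ_p]` is admissible. -/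
def IsAdmissibleSlope (p : Cˣ) (L : (C⟦X⟧)[X]) (μ : ℤ) : Prop :=
  IsConvergent (phi (p : C) (exponentRatios (p : C) (exponents p L μ)))

/-- The slope `μ` of `L` is almost admissible: for some `n ≥ 1` with `nμ` integral, the slope `nμ`
of the ramified operator in `C[[t]][σ_p]`, `t = x^{1/n}`, `p = q^{1/n}`, is admissible. Here
`root n` is the chosen `n`-th root `q^{1/n}` of `q`. -/
def IsAlmostAdmissibleSlope (root : ℕ → Cˣ) (L : (C⟦X⟧)[X]) (μ : ℚ) : Prop :=
  ∃ (n : ℕ) (hn : n ≠ 0) (m : ℤ), (m : ℚ) = n * μ ∧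
    IsAdmissibleSlope (root n) (ramify n hn L) m

/-- An operator is almost admissible if all its slopes are. -/
def IsAlmostAdmissibleOp (root : ℕ → Cˣ) (L : (C⟦X⟧)[X]) : Prop :=
  ∀ μ : ℚ, IsSlope L μ → IsAlmostAdmissibleSlope root L μ

/-- A `q`-difference module over `C({x})` is almost admissible if it is isomorphic to
`K[σ_q] / K[σ_q] L` for some almost admissible `L ∈ C{x}[σ_q]`. -/
def QDiffModule.IsAlmostAdmissible {q : Cˣ} (M : QDiffModule.{u, v} (MeroGerm C) (sigma q))
    (root : ℕ → Cˣ) : Prop :=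
  ∃ L : (ConvSeries C)[X], IsAlmostAdmissibleOp root (L.map (ConvSeries C).subtype) ∧
    M.IsAssociated (L.map convToMero)

/-- The formal completion `M ⊗ C((x))` of a `q`-difference module over `C({x})`. -/
def QDiffModule.formal {q : Cˣ} (M : QDiffModule.{u, v} (MeroGerm C) (sigma q)) :
    QDiffModule C⸨X⸩ (sigmaHat q) :=
  M.baseChange (sigmaHat q) fun _ => rfl

end Admissible

end QDiff

end

noncomputable section

namespace QDiff

/-! The implication from left to right is extension of scalars. For the converse, write M =
K[σ]/K[σ]L and N = K[σ]/K[σ]L'. A formal isomorphism sends the cyclic vector of M to the class of a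
formal operator U, and LU = WL' for some W. It suffices to make U convergent modulo left multiples
of L' (`exists_isConvOp_sub_skewMul`).

This is done by induction on deg L'. After a ramification x = t^d, the first edge of the Newton
polygon of L' and a root lam of its symbol give a nonzero formal solution y of L'y = 0, where σ acts
on C((t)) by f ↦ lam t^m f(pt). Computing coefficients of y means dividing by the values of the
symbol at lam p^k. Almost admissibility makes the products of these small divisors decrease at most
geometrically, so y converges (`mem_meroGerm_of_opAt_mem`). Let P be a convergent operator of least
degree killing y; then L' = L''P. Divide: U = U₁P + u with deg u < deg P. Applying LU − WL' to y
leaves L(uy), which is convergent, so uy converges by the small divisor estimate for L. By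
minimality of P, the coefficients of u solve a linear system over K with independent columns, so u
converges (`isConvOp_of_ramAct_mem`). Cancelling P leaves the same situation for U₁ and L'', of
smaller degree.

The estimate for L at lam requires lam to be, up to a power of p, an exponent of L as well. Here
invertibility of U modulo L' enters: Uy is a nonzero solution of L
(`symbCompatible_of_isAlmostAdmissibleOp`). Finally, almost admissibility speaks of some
ramification index n and the chosen q^{1/n}, whereas the induction uses the denominator d of the
slope; `symbGeom_of_isAlmostAdmissibleOp` compares the two. -/

/-! ## Skew polynomials acting on modules with a semilinear operator -/

section Skew

variable {F : Type*} [Field F] {σ : F ≃+* F} {V : Type*} [AddCommGroup V] [Module F V]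

/-- The value at `v` of the operators `∑ aᵢ Sⁱ`, as a linear map in the operator. -/
def opAt (S : V →ₛₗ[(σ : F →+* F)] V) (v : V) : F[X] →ₗ[F] V :=
  Polynomial.lsum fun i => LinearMap.toSpanSingleton F V (S^[i] v)

theorem opAt_apply (S : V →ₛₗ[(σ : F →+* F)] V) (v : V) (P : F[X]) :
    opAt S v P = P.sum fun i a => a • S^[i] v := rfl

@[simp]
theorem opAt_monomial (S : V →ₛₗ[(σ : F →+* F)] V) (v : V) (i : ℕ) (a : F) :
    opAt S v (Polynomial.monomial i a) = a • S^[i] v := by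
  rw [opAt_apply, Polynomial.sum_monomial_index]
  simp

theorem opAt_one (S : V →ₛₗ[(σ : F →+* F)] V) (v : V) : opAt S v 1 = v := by
  rw [← Polynomial.monomial_zero_one, opAt_monomial]
  simp

theorem opAt_C (S : V →ₛₗ[(σ : F →+* F)] V) (v : V) (a : F) :
    opAt S v (Polynomial.C a) = a • v := by
  rw [← Polynomial.monomial_zero_left, opAt_monomial]
  simp

theorem opAt_X_pow (S : V →ₛₗ[(σ : F →+* F)] V) (v : V) (i : ℕ) :
    opAt S v (Polynomial.X ^ i) = S^[i] v := by
  rw [← Polynomial.monomial_one_right_eq_X_pow, opAt_monomial, one_smul]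

theorem iterate_add_apply' (S : V →ₛₗ[(σ : F →+* F)] V) (i : ℕ) (v w : V) :
    S^[i] (v + w) = S^[i] v + S^[i] w := by
  induction i with
  | zero => rfl
  | succ i ih => rw [Function.iterate_succ_apply', ih, map_add, Function.iterate_succ_apply',
      Function.iterate_succ_apply']

theorem opAt_add (S : V →ₛₗ[(σ : F →+* F)] V) (v w : V) (P : F[X]) :
    opAt S (v + w) P = opAt S v P + opAt S w P := by
  induction P using Polynomial.induction_on' with
  | add P Q hP hQ => rw [map_add, hP, hQ, map_add, map_add]; abel
  | monomial i a => simp only [opAt_monomial, iterate_add_apply', smul_add]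

theorem opAt_zero (S : V →ₛₗ[(σ : F →+* F)] V) (P : F[X]) : opAt S 0 P = 0 := by
  have := opAt_add S 0 0 P
  simpa using this

theorem opAt_neg (S : V →ₛₗ[(σ : F →+* F)] V) (v : V) (P : F[X]) :
    opAt S (-v) P = -opAt S v P := by
  rw [eq_neg_iff_add_eq_zero, ← opAt_add, neg_add_cancel, opAt_zero]

theorem opAt_sub (S : V →ₛₗ[(σ : F →+* F)] V) (v w : V) (P : F[X]) :
    opAt S (v - w) P = opAt S v P - opAt S w P := by
  rw [sub_eq_add_neg, opAt_add, opAt_neg, sub_eq_add_neg]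

theorem sigmaMul_monomial (i : ℕ) (a : F) :
    sigmaMul σ (Polynomial.monomial i a) = Polynomial.monomial (i + 1) (σ a) := by
  change Polynomial.X * (Polynomial.monomial i a).map (σ : F →+* F) = _
  rw [Polynomial.map_monomial, Polynomial.X_mul_monomial]
  rfl

theorem opAt_sigmaMul (S : V →ₛₗ[(σ : F →+* F)] V) (v : V) (P : F[X]) :
    opAt S v (sigmaMul σ P) = S (opAt S v P) := by
  induction P using Polynomial.induction_on' with
  | add P Q hP hQ => simp only [map_add, hP, hQ]
  | monomial i a =>
    rw [sigmaMul_monomial, opAt_monomial, opAt_monomial, map_smulₛₗ,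
      Function.iterate_succ_apply']
    rfl

theorem opAt_iterate_sigmaMul (S : V →ₛₗ[(σ : F →+* F)] V) (v : V) (P : F[X]) (i : ℕ) :
    opAt S v ((sigmaMul σ)^[i] P) = S^[i] (opAt S v P) := by
  induction i with
  | zero => rfl
  | succ i ih => rw [Function.iterate_succ_apply', opAt_sigmaMul, ih,
      Function.iterate_succ_apply']

variable (σ) in
/-- The product of the skew polynomial ring `F[σ]`. -/
def skewMul (P Q : F[X]) : F[X] := opAt (sigmaMul σ) Q P

/-- This is the module axiom (PQ)v = P(Qv). Taking for V the operators themselves, with S left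
multiplication by σ, it becomes associativity of the skew product. -/
theorem opAt_skewMul (S : V →ₛₗ[(σ : F →+* F)] V) (v : V) (P Q : F[X]) :
    opAt S v (skewMul σ P Q) = opAt S (opAt S v Q) P := by
  unfold skewMul
  induction P using Polynomial.induction_on' with
  | add P P' hP hP' => simp only [map_add, hP, hP']
  | monomial i a => simp only [opAt_monomial, map_smul, opAt_iterate_sigmaMul]

theorem skewMul_assoc (P Q R : F[X]) :
    skewMul σ (skewMul σ P Q) R = skewMul σ P (skewMul σ Q R) :=
  opAt_skewMul _ _ _ _

theorem skewMul_add (P Q R : F[X]) : skewMul σ P (Q + R) = skewMul σ P Q + skewMul σ P R :=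
  opAt_add _ _ _ _

theorem add_skewMul (P Q R : F[X]) : skewMul σ (P + Q) R = skewMul σ P R + skewMul σ Q R :=
  map_add _ _ _

theorem sub_skewMul (P Q R : F[X]) : skewMul σ (P - Q) R = skewMul σ P R - skewMul σ Q R :=
  map_sub _ _ _

theorem zero_skewMul (P : F[X]) : skewMul σ 0 P = 0 := map_zero _

theorem coeff_iterate_sigmaMul (Q : F[X]) (i k : ℕ) :
    ((sigmaMul σ)^[i] Q).coeff k = if i ≤ k then σ^[i] (Q.coeff (k - i)) else 0 := by
  induction i generalizing k with
  | zero => simp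
  | succ i ih =>
    rw [Function.iterate_succ_apply']
    change (Polynomial.X * Polynomial.map (σ : F →+* F) _).coeff k = _
    cases k with
    | zero => simp
    | succ k =>
      rw [Polynomial.coeff_X_mul, Polynomial.coeff_map, ih, Function.iterate_succ_apply']
      simp only [add_le_add_iff_right, Nat.add_sub_add_right]
      split_ifs <;> simp

theorem coeff_skewMul (P Q : F[X]) (k : ℕ) :
    (skewMul σ P Q).coeff k =
      ∑ z ∈ Finset.HasAntidiagonal.antidiagonal k, P.coeff z.1 * σ^[z.1] (Q.coeff z.2) := by
  unfold skewMul
  induction P using Polynomial.induction_on' with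
  | add P P' hP hP' =>
    simp only [map_add, Polynomial.coeff_add, hP, hP', add_mul, Finset.sum_add_distrib]
  | monomial i a =>
    rw [opAt_monomial, Polynomial.coeff_smul, coeff_iterate_sigmaMul,
      Finset.Nat.sum_antidiagonal_eq_sum_range_succ_mk]
    simp only [Polynomial.coeff_monomial, ite_mul, zero_mul, smul_eq_mul, mul_ite, mul_zero]
    rw [Finset.sum_ite_eq]
    simp

theorem skewMul_coeff_zero (P Q : F[X]) :
    (skewMul σ P Q).coeff 0 = P.coeff 0 * Q.coeff 0 := by
  simp [coeff_skewMul]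

theorem iterate_eq_zero_iff (i : ℕ) (a : F) : σ^[i] a = 0 ↔ a = 0 := by
  constructor
  · intro h
    apply (σ.injective.iterate i)
    rw [h, iterate_map_zero]
  · rintro rfl
    exact iterate_map_zero _ _

theorem degree_skewMul (P Q : F[X]) : (skewMul σ P Q).degree = P.degree + Q.degree := by
  by_cases hP : P = 0
  · simp [hP, skewMul]
  by_cases hQ : Q = 0
  · simp [hQ, skewMul, opAt_zero]
  rw [Polynomial.degree_eq_natDegree hP, Polynomial.degree_eq_natDegree hQ, ← Nat.cast_add]
  refine le_antisymm ?_ ?_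
  · refine (Polynomial.degree_le_iff_coeff_zero _ _).2 fun k hk => ?_
    rw [coeff_skewMul]
    refine Finset.sum_eq_zero fun z hz => ?_
    rw [Finset.HasAntidiagonal.mem_antidiagonal] at hz
    have hk' : P.natDegree + Q.natDegree < k := by exact_mod_cast hk
    rcases lt_or_ge P.natDegree z.1 with h | h
    · rw [Polynomial.coeff_eq_zero_of_natDegree_lt h, zero_mul]
    · rw [Polynomial.coeff_eq_zero_of_natDegree_lt (p := Q) (by omega), iterate_map_zero, mul_zero]
  · refine Polynomial.le_degree_of_ne_zero ?_
    rw [coeff_skewMul, Finset.sum_eq_single (P.natDegree, Q.natDegree)]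
    · refine mul_ne_zero (by simpa using hP) ?_
      rw [Ne, iterate_eq_zero_iff]
      simpa using hQ
    · rintro ⟨i, j⟩ hz hne
      rw [Finset.HasAntidiagonal.mem_antidiagonal] at hz
      rcases lt_trichotomy P.natDegree i with h | h | h
      · simp [Polynomial.coeff_eq_zero_of_natDegree_lt h]
      · exact absurd (Prod.ext h.symm (by simp only at hz; omega)) hne
      · simp only at hz
        rw [Polynomial.coeff_eq_zero_of_natDegree_lt (p := Q) (by omega), iterate_map_zero,
          mul_zero]
    · intro h
      simp at h

theorem skewMul_ne_zero {P Q : F[X]} (hP : P ≠ 0) (hQ : Q ≠ 0) : skewMul σ P Q ≠ 0 := by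
  rw [← Polynomial.degree_ne_bot] at *
  rw [degree_skewMul]
  simp [*]

/-- Degrees add in the skew ring. This is the form that gives uniqueness of quotients in division
with remainder. -/
theorem eq_zero_of_degree_skewMul_lt {P Q : F[X]} (h : (skewMul σ P Q).degree < Q.degree) :
    P = 0 := by
  by_contra hP
  rw [degree_skewMul, Polynomial.degree_eq_natDegree hP] at h
  refine absurd h (not_lt.2 ?_)
  exact le_add_of_nonneg_left (by exact_mod_cast Nat.zero_le _)

/-- Applied to the inclusion of convergent into formal Laurent series and to the ramification x =
t^d. -/
theorem map_skewMul {G : Type*} [Field G] {τ : G ≃+* G} (j : F →+* G)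
    (hj : ∀ f, j (σ f) = τ (j f)) (P Q : F[X]) :
    (skewMul σ P Q).map j = skewMul τ (P.map j) (Q.map j) := by
  have h : ∀ (i : ℕ) (a : F), j (σ^[i] a) = τ^[i] (j a) := fun i a =>
    (Function.Semiconj.iterate_right (f := j) (ga := σ) (gb := τ) hj i) a
  ext k
  simp [coeff_skewMul, h]

theorem exists_skew_division (P : F[X]) (hP : P ≠ 0) (U : F[X]) :
    ∃ W R : F[X], U = skewMul σ W P + R ∧ R.degree < P.degree := by
  induction hn : U.degree using WellFoundedLT.induction generalizing U with
  | ind n ih =>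
    subst hn
    rcases lt_or_ge U.degree P.degree with h | h
    · exact ⟨0, U, by simp [zero_skewMul], h⟩
    · have hU : U ≠ 0 := by
        rintro rfl
        simp [hP] at h
      have hl : σ^[U.natDegree - P.natDegree] P.leadingCoeff ≠ 0 := by
        rw [Ne, iterate_eq_zero_iff]
        simpa using hP
      -- Moving σ^k past the leading coefficient of P applies σ^k to it; hence the twisted
      -- denominator, which makes T·P have the leading term of U.
      set T := Polynomial.monomial (U.natDegree - P.natDegree)
        (U.leadingCoeff / σ^[U.natDegree - P.natDegree] P.leadingCoeff) with hT
      have hle := Polynomial.natDegree_le_natDegree h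
      have hT0 : U.leadingCoeff / σ^[U.natDegree - P.natDegree] P.leadingCoeff ≠ 0 :=
        div_ne_zero (by simpa using hU) hl
      have hd : U.degree = (skewMul σ T P).degree := by
        rw [degree_skewMul, hT, Polynomial.degree_monomial _ hT0,
          Polynomial.degree_eq_natDegree hU, Polynomial.degree_eq_natDegree hP, ← Nat.cast_add,
          Nat.sub_add_cancel hle]
      have hc : U.leadingCoeff = (skewMul σ T P).leadingCoeff := by
        rw [Polynomial.leadingCoeff, Polynomial.leadingCoeff, ← Polynomial.natDegree_eq_of_degree_eq hd]
        unfold skewMul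
        rw [hT, opAt_monomial, Polynomial.coeff_smul, coeff_iterate_sigmaMul, if_pos (by omega),
          Nat.sub_sub_self hle, smul_eq_mul]
        exact (div_mul_cancel₀ _ hl).symm
      obtain ⟨W, R, e, hR⟩ := ih _ (Polynomial.degree_sub_lt_left hd hU hc) _ rfl
      refine ⟨W + T, R, ?_, hR⟩
      rw [add_skewMul, add_right_comm, ← e, sub_add_cancel]

theorem leftIdeal_eq_range (L : F[X]) :
    leftIdeal σ L = LinearMap.range (opAt (sigmaMul σ) L) := by
  refine le_antisymm (Submodule.span_le.2 ?_) ?_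
  · rintro _ ⟨k, rfl⟩
    exact ⟨Polynomial.X ^ k, opAt_X_pow _ _ _⟩
  · rintro _ ⟨P, rfl⟩
    induction P using Polynomial.induction_on' with
    | add P Q hP hQ => rw [map_add]; exact add_mem hP hQ
    | monomial i a =>
      rw [opAt_monomial]
      exact Submodule.smul_mem _ _ (Submodule.subset_span ⟨i, rfl⟩)

theorem mem_leftIdeal_iff (L P : F[X]) : P ∈ leftIdeal σ L ↔ ∃ W, P = skewMul σ W L := by
  rw [leftIdeal_eq_range]
  exact ⟨fun ⟨W, h⟩ => ⟨W, h.symm⟩, fun ⟨W, h⟩ => ⟨W, h.symm⟩⟩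

end Skew

/-! ## Products bounded below by a geometric sequence -/

section GeomBelow

/-- The partial products of `u` are bounded below by a geometric sequence. -/
def GeomBelow (u : ℕ → ℝ) : Prop :=
  ∃ A B : ℝ, 0 < A ∧ 0 < B ∧ ∀ N, A * B ^ N ≤ ∏ k ∈ Finset.range N, u k

variable {u v : ℕ → ℝ}

theorem GeomBelow.prod_pos (hu : GeomBelow u) (N : ℕ) : 0 < ∏ k ∈ Finset.range N, u k := by
  obtain ⟨A, B, hA, hB, h⟩ := hu
  exact (by positivity : 0 < A * B ^ N).trans_le (h N)

theorem GeomBelow.ne_zero (hu : GeomBelow u) (N : ℕ) : u N ≠ 0 := fun h => by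
  have := hu.prod_pos (N + 1)
  rw [Finset.prod_range_succ, h, mul_zero] at this
  exact this.false

theorem GeomBelow.mul (hu : GeomBelow u) (hv : GeomBelow v) : GeomBelow fun k => u k * v k := by
  have hu' := hu
  obtain ⟨A, B, hA, hB, h⟩ := hu
  obtain ⟨A', B', hA', hB', h'⟩ := hv
  refine ⟨A * A', B * B', by positivity, by positivity, fun N => ?_⟩
  rw [Finset.prod_mul_distrib]
  calc A * A' * (B * B') ^ N = (A * B ^ N) * (A' * B' ^ N) := by ring
    _ ≤ _ := mul_le_mul (h N) (h' N) (by positivity) (hu'.prod_pos N).le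

theorem geomBelow_of_le {c : ℝ} (hc : 0 < c) (h : ∀ k, c ≤ u k) : GeomBelow u := by
  refine ⟨1, c, one_pos, hc, fun N => ?_⟩
  rw [one_mul, ← Finset.card_range N, ← Finset.prod_const, Finset.card_range]
  exact Finset.prod_le_prod (fun _ _ => hc.le) fun k _ => h k

theorem GeomBelow.mono (hu : GeomBelow u) (hu0 : ∀ k, 0 ≤ u k) (h : ∀ k, u k ≤ v k) :
    GeomBelow v := by
  obtain ⟨A, B, hA, hB, h'⟩ := hu
  exact ⟨A, B, hA, hB, fun N => (h' N).trans
    (Finset.prod_le_prod (fun k _ => hu0 k) fun k _ => h k)⟩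

/-- A factor of a product, the other factor being bounded. -/
theorem GeomBelow.of_mul (huv : GeomBelow fun k => u k * v k) {S : ℝ}
    (hv0 : ∀ k, 0 ≤ v k) (hu0 : ∀ k, 0 ≤ u k) (hv : ∀ k, v k ≤ S) : GeomBelow u := by
  -- The maximum with 1 makes the bound invertible whatever the sign of S.
  have hS : 0 < max S 1 := lt_max_of_lt_right one_pos
  have := huv.mul (geomBelow_of_le (u := fun _ => (max S 1)⁻¹) (inv_pos.2 hS) fun _ => le_rfl)
  refine this.mono (fun k => ?_) fun k => ?_
  · have := hu0 k
    have := hv0 k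
    positivity
  · rw [mul_assoc]
    refine mul_le_of_le_one_right (hu0 k) ?_
    rw [← div_eq_mul_inv, div_le_one hS]
    exact (hv k).trans (le_max_left _ _)

/-- Subproducts along an injective sequence of indices of linear growth. -/
theorem GeomBelow.comp (hu : GeomBelow u) (hu0 : ∀ k, 0 ≤ u k) {S : ℝ} (hS : ∀ k, u k ≤ S)
    {φ : ℕ → ℕ} (hφ : StrictMono φ) {e r : ℕ} (hle : ∀ k, φ k ≤ e * k + r) :
    GeomBelow fun k => u (φ k) := by
  obtain ⟨A, B, hA, hB, h⟩ := hu
  have hS' : 0 < max S 1 := lt_max_of_lt_right one_pos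
  set T := max S 1 with hT
  have hT1 : 1 ≤ T := le_max_right _ _
  have hv0 : ∀ k, 0 ≤ u k / T := fun k => div_nonneg (hu0 k) hS'.le
  have hv1 : ∀ k, u k / T ≤ 1 := fun k => (div_le_one hS').2 ((hS k).trans (le_max_left _ _))
  have hm : min (B / T) 1 > 0 := lt_min (by positivity) one_pos
  set β := min (B / T) 1 with hβ
  -- All normalised factors lie in [0, 1], so the product over the N selected indices is at least
  -- the product over the full range containing them, whose length is linear in N.
  have key : ∀ N, min A 1 * β ^ (e * N + r) ≤ ∏ k ∈ Finset.range N, (u (φ k) / T) := by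
    intro N
    have hsub : (Finset.range N).map ⟨φ, hφ.injective⟩ ⊆ Finset.range (e * N + r) := by
      intro k hk
      simp only [Finset.mem_map, Finset.mem_range, Function.Embedding.coeFn_mk] at hk ⊢
      obtain ⟨j, hj, rfl⟩ := hk
      exact (hφ hj).trans_le (hle N)
    calc min A 1 * β ^ (e * N + r) ≤ A * (B / T) ^ (e * N + r) := by
          gcongr
          · exact min_le_left _ _
          · exact min_le_left _ _
      _ = A * B ^ (e * N + r) / T ^ (e * N + r) := by rw [div_pow, mul_div_assoc]
      _ ≤ (∏ k ∈ Finset.range (e * N + r), u k) / T ^ (e * N + r) := by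
          gcongr
          exact h _
      _ = ∏ k ∈ Finset.range (e * N + r), (u k / T) := by
          rw [Finset.prod_div_distrib]; simp
      _ ≤ ∏ k ∈ (Finset.range N).map ⟨φ, hφ.injective⟩, (u k / T) := by
          rw [← Finset.prod_sdiff hsub]
          exact mul_le_of_le_one_left (Finset.prod_nonneg fun k _ => hv0 k)
            (Finset.prod_le_one (fun k _ => hv0 k) fun k _ => hv1 k)
      _ = _ := by rw [Finset.prod_map]; rfl
  have : GeomBelow fun k => u (φ k) / T := by
    refine ⟨min A 1 * β ^ r, β ^ e, by positivity, by positivity, fun N => ?_⟩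
    refine le_trans (le_of_eq ?_) (key N)
    rw [pow_add, pow_mul]
    ring
  refine this.mono (fun k => hv0 _) fun k => div_le_self (hu0 _) hT1

/-- Geometric growth of a sequence subject to a linear recursion whose kernel decays
geometrically and whose diagonal has products bounded below geometrically. -/
theorem geometric_of_recursion {w : ℕ → ℝ} (hw : ∀ N, 0 ≤ w N) (hu : GeomBelow u)
    (hu0 : ∀ k, 0 ≤ u k) {S H D A B : ℝ} (hS : ∀ k, u k ≤ S) (hH : 0 < H) (hD : 0 < D)
    (hA : 0 < A) (hB : 0 < B)
    (hrec : ∀ N, u N * w N ≤ H * D ^ N + ∑ j ∈ Finset.range N, A * B ^ (N - j) * w j) :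
    ∃ E G : ℝ, 0 < E ∧ 0 < G ∧ ∀ N, w N ≤ E * G ^ N := by
  set T := max S 1 with hT
  have hT1 : 1 ≤ T := le_max_right _ _
  have hT0 : 0 < T := one_pos.trans_le hT1
  have hpos : ∀ k, 0 < u k := fun k => lt_of_le_of_ne (hu0 k) (hu.ne_zero k).symm
  have hv1 : ∀ k, u k / T ≤ 1 := fun k => (div_le_one hT0).2 ((hS k).trans (le_max_left _ _))
  have hv0 : ∀ k, 0 < u k / T := fun k => div_pos (hpos k) hT0
  set π : ℕ → ℝ := fun N => ∏ k ∈ Finset.range N, (u k / T) with hπ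
  have hπ0 : ∀ N, 0 < π N := fun N => Finset.prod_pos fun k _ => hv0 k
  have hπs : ∀ N, π (N + 1) = π N * (u N / T) := fun N => Finset.prod_range_succ _ _
  have hanti : Antitone π := antitone_nat_of_succ_le fun N => by
    rw [hπs]
    exact mul_le_of_le_one_right (hπ0 N).le (hv1 N)
  have hπ1 : ∀ N, π N ≤ 1 := fun N => by simpa [hπ] using hanti (Nat.zero_le N)
  -- Weighting by the decreasing products π removes the small divisors: π N * u N is T * π (N + 1),
  -- and π N ≤ π (j + 1) for j < N absorbs the weights of the earlier terms.
  set z : ℕ → ℝ := fun N => π (N + 1) * w N with hz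
  have hz0 : ∀ N, 0 ≤ z N := fun N => mul_nonneg (hπ0 _).le (hw N)
  have hzrec : ∀ N, z N ≤ H * D ^ N + ∑ j ∈ Finset.range N, A * B ^ (N - j) * z j := by
    intro N
    have h1 : z N = π N * (u N * w N) / T := by
      simp only [hz, hπs]
      ring
    rw [h1]
    refine (div_le_self (mul_nonneg (hπ0 N).le (mul_nonneg (hu0 N) (hw N))) hT1).trans ?_
    refine (mul_le_mul_of_nonneg_left (hrec N) (hπ0 N).le).trans ?_
    rw [mul_add, Finset.mul_sum]
    refine add_le_add (mul_le_of_le_one_left (by positivity) (hπ1 N)) ?_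
    refine Finset.sum_le_sum fun j hj => ?_
    have hj' : j + 1 ≤ N := Finset.mem_range.1 hj
    have := hanti hj'
    have := hw j
    calc π N * (A * B ^ (N - j) * w j) ≤ π (j + 1) * (A * B ^ (N - j) * w j) := by gcongr
      _ = _ := by simp only [hz]; ring
  -- Chosen so that H G^M B^(N-M) + A B^(N-M) · 2 H G^M ≤ H G^(M+1) B^(N-M-1), which is the
  -- induction step for the partial sums below.
  set G := max D (B * (1 + 2 * A)) with hG
  have hG0 : 0 < G := lt_max_of_lt_left hD
  have hzb : ∀ N, z N ≤ 2 * H * G ^ N := by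
    intro N
    induction N using Nat.strong_induction_on with
    | _ N ih =>
      refine (hzrec N).trans ?_
      have h1 : H * D ^ N ≤ H * G ^ N := by
        gcongr
        exact le_max_left _ _
      have h2 : ∑ j ∈ Finset.range N, A * B ^ (N - j) * z j ≤ H * G ^ N := by
        have h3 : ∀ M, M ≤ N → ∑ j ∈ Finset.range M, A * B ^ (N - j) * z j ≤
            H * G ^ M * B ^ (N - M) := by
          intro M
          induction M with
          | zero => intro _; simp; positivity
          | succ M ihM =>
            intro hM
            rw [Finset.sum_range_succ]
            have e1 := ihM (by omega)
            have e2 := ih M (by omega)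
            have e3 : N - M = (N - (M + 1)) + 1 := by omega
            have e4 : B * (1 + 2 * A) ≤ G := le_max_right _ _
            calc _ ≤ H * G ^ M * B ^ (N - M) + A * B ^ (N - M) * (2 * H * G ^ M) := by gcongr
              _ = H * G ^ M * (B * (1 + 2 * A)) * B ^ (N - (M + 1)) := by rw [e3]; ring
              _ ≤ H * G ^ M * G * B ^ (N - (M + 1)) := by gcongr
              _ = _ := by ring
        simpa using h3 N le_rfl
      linarith
  obtain ⟨A', B', hA', hB', h'⟩ := hu
  have hπb : ∀ N, A' * (B' / T) ^ N ≤ π N := by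
    intro N
    simp only [hπ, Finset.prod_div_distrib, Finset.prod_const, Finset.card_range, div_pow]
    rw [← mul_div_assoc]
    gcongr
    exact h' N
  refine ⟨2 * H * (A' * (B' / T))⁻¹, G * (B' / T)⁻¹, by positivity, by positivity, fun N => ?_⟩
  have h1 : A' * (B' / T) ^ (N + 1) * w N ≤ 2 * H * G ^ N :=
    (mul_le_mul_of_nonneg_right (hπb (N + 1)) (hw N)).trans (hzb N)
  have hb : 0 < B' / T := by positivity
  have h2 : w N ≤ 2 * H * G ^ N / (A' * (B' / T) ^ (N + 1)) := by
    rw [le_div_iff₀ (by positivity)]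
    linarith
  refine h2.trans (le_of_eq ?_)
  rw [mul_pow, inv_pow, pow_succ]
  field_simp

end GeomBelow

/-! ## Coefficients of Laurent series -/

section Laurent

section Field

variable {C : Type*} [Field C]

theorem exists_forall_lt_coeff_eq_zero (f : C⸨X⸩) : ∃ a : ℤ, ∀ j < a, f.coeff j = 0 :=
  ⟨f.order, fun _ h => HahnSeries.coeff_eq_zero_of_lt_order h⟩

/-- The power series whose coefficients are those of `f` from `a` on. -/
def tailSeries (a : ℤ) (f : C⸨X⸩) : C⟦X⟧ := PowerSeries.mk fun n => f.coeff (a + n)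

theorem coeff_single_mul_ofPowerSeries (a : ℤ) (F : C⟦X⟧) (n : ℕ) :
    (HahnSeries.single a (1 : C) * (F : C⸨X⸩)).coeff (a + n) = PowerSeries.coeff n F := by
  rw [add_comm a, HahnSeries.coeff_single_mul_add, one_mul, PowerSeries.coeff_coe,
    if_neg (by simp)]
  simp

theorem eq_single_mul_tailSeries {a : ℤ} {f : C⸨X⸩} (h : ∀ j < a, f.coeff j = 0) :
    f = HahnSeries.single a (1 : C) * (tailSeries a f : C⸨X⸩) := by
  ext k
  obtain ⟨k, rfl⟩ : ∃ l, k = l + a := ⟨k - a, by ring⟩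
  rw [HahnSeries.coeff_single_mul_add, one_mul, PowerSeries.coeff_coe]
  split_ifs with hk
  · exact h _ (by omega)
  · obtain ⟨n, rfl⟩ := Int.eq_ofNat_of_zero_le (not_lt.1 hk)
    simp [tailSeries, add_comm]

/-- Multiplication by f is thus a lower triangular system in the coefficients of g, with constant
diagonal `f.coeff a`. -/
theorem coeff_mul_eq_sum {a b : ℤ} {f g : C⸨X⸩} (hf : ∀ j < a, f.coeff j = 0)
    (hg : ∀ j < b, g.coeff j = 0) (N : ℕ) :
    (f * g).coeff (a + b + N) =
      ∑ j ∈ Finset.range (N + 1), f.coeff (a + (N - j : ℕ)) * g.coeff (b + j) := by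
  rw [eq_single_mul_tailSeries hf, eq_single_mul_tailSeries hg, mul_mul_mul_comm,
    HahnSeries.single_mul_single, one_mul, ← map_mul, coeff_single_mul_ofPowerSeries,
    mul_comm (tailSeries a f), PowerSeries.coeff_mul,
    Finset.Nat.sum_antidiagonal_eq_sum_range_succ_mk]
  refine Finset.sum_congr rfl fun j _ => ?_
  rw [coeff_single_mul_ofPowerSeries, coeff_single_mul_ofPowerSeries, mul_comm]

theorem coeff_mul_eq_zero {a b : ℤ} {f g : C⸨X⸩} (hf : ∀ j < a, f.coeff j = 0)
    (hg : ∀ j < b, g.coeff j = 0) {k : ℤ} (hk : k < a + b) : (f * g).coeff k = 0 := by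
  rw [eq_single_mul_tailSeries hf, eq_single_mul_tailSeries hg, mul_mul_mul_comm,
    HahnSeries.single_mul_single, one_mul, ← map_mul]
  obtain ⟨k, rfl⟩ : ∃ l, k = l + (a + b) := ⟨k - (a + b), by ring⟩
  rw [HahnSeries.coeff_single_mul_add, one_mul, PowerSeries.coeff_coe, if_pos (by omega)]

@[simp]
theorem coeff_sigmaHat {C : Type*} [NormedField C] (q : Cˣ) (f : C⸨X⸩) (n : ℤ) :
    (sigmaHat q f).coeff n = ((q ^ n : Cˣ) : C) * f.coeff n := rfl

theorem coeff_iterate_sigmaHat {C : Type*} [NormedField C] (q : Cˣ) (f : C⸨X⸩) (i : ℕ) (n : ℤ) :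
    ((sigmaHat q)^[i] f).coeff n = ((q ^ (i * n) : Cˣ) : C) * f.coeff n := by
  induction i with
  | zero => simp
  | succ i ih =>
    rw [Function.iterate_succ_apply', coeff_sigmaHat, ih, ← mul_assoc, ← Units.val_mul, ← zpow_add]
    congr 3
    push_cast
    ring

/-! ### Ramification -/

theorem mulLeft_injective_int {d : ℕ} (hd : d ≠ 0) :
    Function.Injective (AddMonoidHom.mulLeft (d : ℤ)) :=
  mul_right_injective₀ (by exact_mod_cast hd)

/-- The substitution `f(x) ↦ f(t^d)`. -/
def ramHom (d : ℕ) (hd : d ≠ 0) : C⸨X⸩ →+* C⸨X⸩ :=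
  HahnSeries.embDomainRingHom (AddMonoidHom.mulLeft (d : ℤ)) (mulLeft_injective_int hd)
    fun g g' => by
      have : (0 : ℤ) < d := by exact_mod_cast Nat.pos_of_ne_zero hd
      exact mul_le_mul_iff_right₀ this

theorem coeff_ramHom_mul {d : ℕ} (hd : d ≠ 0) (f : C⸨X⸩) (j : ℤ) :
    (ramHom d hd f).coeff (d * j) = f.coeff j :=
  HahnSeries.embDomain_coeff (a := j)

theorem coeff_ramHom_of_not_dvd {d : ℕ} (hd : d ≠ 0) (f : C⸨X⸩) {k : ℤ} (hk : ¬ (d : ℤ) ∣ k) :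
    (ramHom d hd f).coeff k = 0 := by
  refine HahnSeries.embDomain_of_notMem_range ?_
  rintro ⟨j, rfl⟩
  exact hk ⟨j, rfl⟩

theorem coeff_ramHom {d : ℕ} (hd : d ≠ 0) (f : C⸨X⸩) (k : ℤ) :
    (ramHom d hd f).coeff k = if (d : ℤ) ∣ k then f.coeff (k / d) else 0 := by
  split_ifs with h
  · obtain ⟨j, rfl⟩ := h
    rw [coeff_ramHom_mul, Int.mul_ediv_cancel_left _ (by exact_mod_cast hd)]
  · exact coeff_ramHom_of_not_dvd hd f h

theorem ramHom_injective {d : ℕ} (hd : d ≠ 0) : Function.Injective (ramHom (C := C) d hd) :=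
  RingHom.injective _

theorem ramHom_sigmaHat {C : Type*} [NormedField C] {d : ℕ} (hd : d ≠ 0) {p q : Cˣ}
    (hp : p ^ d = q) (f : C⸨X⸩) :
    ramHom d hd (sigmaHat q f) = sigmaHat p (ramHom d hd f) := by
  ext k
  by_cases h : (d : ℤ) ∣ k
  · obtain ⟨j, rfl⟩ := h
    rw [coeff_sigmaHat, coeff_ramHom_mul, coeff_ramHom_mul, coeff_sigmaHat, ← hp, zpow_mul,
      zpow_natCast]
  · rw [coeff_sigmaHat, coeff_ramHom_of_not_dvd hd _ h, coeff_ramHom_of_not_dvd hd _ h, mul_zero]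

theorem ramHom_ofPowerSeries {d : ℕ} (hd : d ≠ 0) (F : C⟦X⟧) :
    ramHom d hd (F : C⸨X⸩) = (PowerSeries.expand d hd F : C⟦X⟧) := by
  ext k
  have hd0 : (0 : ℤ) < d := by exact_mod_cast Nat.pos_of_ne_zero hd
  rw [coeff_ramHom, PowerSeries.coeff_coe, PowerSeries.coeff_coe, PowerSeries.coeff_expand]
  rcases lt_or_ge k 0 with hk | hk
  · rw [if_pos hk]
    split_ifs with h1 h2
    · rfl
    · exact absurd (Int.ediv_neg_of_neg_of_pos hk hd0) h2
    · rfl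
  · obtain ⟨n, rfl⟩ := Int.eq_ofNat_of_zero_le hk
    rw [if_neg (not_lt.2 hk), if_neg (not_lt.2 (Int.ediv_nonneg hk hd0.le))]
    simp only [Int.natCast_dvd_natCast, Int.natAbs_natCast]
    norm_cast

/-- The Laurent series with coefficients `f_{dj+s}`. -/
def ramComp (d : ℕ) (hd : d ≠ 0) (s : ℕ) : C⸨X⸩ →+ C⸨X⸩ where
  toFun f := HahnSeries.ofSuppBddBelow (fun j : ℤ => f.coeff (d * j + s)) <| by
    obtain ⟨a, ha⟩ := exists_forall_lt_coeff_eq_zero f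
    refine ⟨-(|a| + s), fun j hj => ?_⟩
    by_contra! hlt
    refine hj (ha _ ?_)
    have hd0 : (1 : ℤ) ≤ d := by exact_mod_cast Nat.pos_of_ne_zero hd
    have := neg_abs_le a
    nlinarith [abs_nonneg a]
  map_zero' := by ext; simp
  map_add' f g := by ext; simp

@[simp]
theorem coeff_ramComp {d : ℕ} (hd : d ≠ 0) (s : ℕ) (f : C⸨X⸩) (j : ℤ) :
    (ramComp d hd s f).coeff j = f.coeff (d * j + s) := rfl

/-- C((t)) is free over C((t^d)) with basis 1, t, …, t^(d-1), and the `ramComp d hd s` are the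
coordinates. They turn one equation in C((t)) into d equations in C((x)). -/
theorem eq_sum_ramComp {d : ℕ} (hd : d ≠ 0) (f : C⸨X⸩) :
    f = ∑ s ∈ Finset.range d,
      HahnSeries.single (s : ℤ) (1 : C) * ramHom d hd (ramComp d hd s f) := by
  have hd0 : (0 : ℤ) < d := by exact_mod_cast Nat.pos_of_ne_zero hd
  ext k
  have h1 := Int.emod_nonneg k hd0.ne'
  have h2 := Int.emod_lt_of_pos k hd0
  have h3 := Int.mul_ediv_add_emod k d
  rw [HahnSeries.coeff_sum, Finset.sum_eq_single (k % d).toNat]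
  · rw [HahnSeries.coeff_single_mul, one_mul, Int.toNat_of_nonneg h1,
      show k - k % d = d * (k / d) by linarith, coeff_ramHom_mul, coeff_ramComp,
      Int.toNat_of_nonneg h1, h3]
  · intro s hs hne
    rw [HahnSeries.coeff_single_mul, one_mul, coeff_ramHom_of_not_dvd]
    intro h
    have hs' : (s : ℤ) < d := by exact_mod_cast Finset.mem_range.1 hs
    have := Int.emod_emod_of_dvd k (dvd_refl (d : ℤ))
    have h4 : k % d = s := by
      rw [← Int.emod_eq_of_lt (by positivity) hs']
      exact Int.emod_eq_emod_iff_emod_sub_eq_zero.2 (Int.emod_eq_zero_of_dvd h)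
    exact hne (by omega)
  · intro h
    exact absurd (Finset.mem_range.2 (by omega)) h

theorem ramComp_single_mul_ramHom {d : ℕ} (hd : d ≠ 0) {s s' : ℕ} (hs : s < d) (hs' : s' < d)
    (g : C⸨X⸩) :
    ramComp d hd s (HahnSeries.single (s' : ℤ) (1 : C) * ramHom d hd g) =
      if s = s' then g else 0 := by
  ext j
  rw [coeff_ramComp, HahnSeries.coeff_single_mul, one_mul]
  split_ifs with h
  · subst h
    rw [add_sub_cancel_right, coeff_ramHom_mul]
  · rw [coeff_ramHom_of_not_dvd, HahnSeries.coeff_zero]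
    intro h'
    rw [add_sub_assoc, dvd_add_right (dvd_mul_right _ _)] at h'
    have := Int.eq_zero_of_abs_lt_dvd h' (by rw [abs_lt]; constructor <;> omega)
    omega

theorem ramComp_ramHom_mul {d : ℕ} (hd : d ≠ 0) {s : ℕ} (hs : s < d) (u f : C⸨X⸩) :
    ramComp d hd s (ramHom d hd u * f) = u * ramComp d hd s f := by
  conv_lhs => rw [eq_sum_ramComp hd f, Finset.mul_sum, map_sum]
  rw [Finset.sum_eq_single_of_mem s (Finset.mem_range.2 hs)]
  · rw [mul_left_comm, ← map_mul, ramComp_single_mul_ramHom hd hs hs, if_pos rfl]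
  · intro s' hs' hne
    rw [mul_left_comm, ← map_mul, ramComp_single_mul_ramHom hd hs (Finset.mem_range.1 hs'),
      if_neg hne.symm]

theorem eq_zero_of_ramComp {d : ℕ} (hd : d ≠ 0) {f : C⸨X⸩}
    (h : ∀ s < d, ramComp d hd s f = 0) : f = 0 := by
  rw [eq_sum_ramComp hd f]
  refine Finset.sum_eq_zero fun s hs => ?_
  rw [h s (Finset.mem_range.1 hs), map_zero, mul_zero]

end Field

/-! ### Germs of meromorphic functions and growth of coefficients -/

variable {C : Type*} [NormedField C]

/-- Isolating the diagonal term of a lower triangular system gives the recursion of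
`geometric_of_recursion`. It serves both for quotients of convergent series and for solutions of
difference equations. -/
theorem geometric_of_linear_system {κ : ℕ → ℕ → C} {Y : ℕ → C} {A B H D : ℝ} (hA : 0 < A)
    (hB : 0 < B) (hH : 0 < H) (hD : 0 < D)
    (hκ : ∀ N j, j ≤ N → ‖κ N j‖ ≤ A * B ^ (N - j))
    (hrhs : ∀ N, ‖∑ j ∈ Finset.range (N + 1), κ N j * Y j‖ ≤ H * D ^ N)
    (hdiag : GeomBelow fun N => ‖κ N N‖) :
    ∃ E G : ℝ, 0 < E ∧ 0 < G ∧ ∀ N, ‖Y N‖ ≤ E * G ^ N := by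
  refine geometric_of_recursion (fun N => norm_nonneg _) hdiag (fun N => norm_nonneg _)
    (S := A) (fun N => by simpa using hκ N N le_rfl) hH hD hA hB fun N => ?_
  rw [← norm_mul]
  have h1 := hrhs N
  rw [Finset.sum_range_succ] at h1
  have h2 : ‖∑ j ∈ Finset.range N, κ N j * Y j‖ ≤
      ∑ j ∈ Finset.range N, A * B ^ (N - j) * ‖Y j‖ := by
    refine norm_sum_le_of_le _ fun j hj => ?_
    rw [norm_mul]
    exact mul_le_mul_of_nonneg_right (hκ N j (Finset.mem_range.1 hj).le) (norm_nonneg _)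
  calc ‖κ N N * Y N‖ = ‖(∑ j ∈ Finset.range N, κ N j * Y j + κ N N * Y N) -
        ∑ j ∈ Finset.range N, κ N j * Y j‖ := by rw [add_sub_cancel_left]
    _ ≤ _ := norm_sub_le _ _
    _ ≤ _ := add_le_add h1 h2

/-- The coefficients of `f` grow at most geometrically. -/
def IsGeom (f : C⸨X⸩) : Prop :=
  ∃ A B : ℝ, 0 < A ∧ 0 < B ∧ ∀ j : ℤ, ‖f.coeff j‖ ≤ A * B ^ j

theorem IsGeom.of_nat {f : C⸨X⸩} {a : ℤ} (hf : ∀ j < a, f.coeff j = 0) {A B : ℝ} (hA : 0 < A)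
    (hB : 0 < B) (h : ∀ n : ℕ, ‖f.coeff (a + n)‖ ≤ A * B ^ n) : IsGeom f := by
  refine ⟨A * B ^ (-a), B, by positivity, hB, fun j => ?_⟩
  rcases lt_or_ge j a with hj | hj
  · rw [hf j hj, norm_zero]
    positivity
  · obtain ⟨n, rfl⟩ : ∃ n : ℕ, j = a + n := ⟨(j - a).toNat, by omega⟩
    refine (h n).trans (le_of_eq ?_)
    rw [mul_assoc, ← zpow_add₀ hB.ne', neg_add_cancel_left, zpow_natCast]

theorem IsGeom.nat {f : C⸨X⸩} (hf : IsGeom f) (a : ℤ) :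
    ∃ A B : ℝ, 0 < A ∧ 0 < B ∧ ∀ n : ℕ, ‖f.coeff (a + n)‖ ≤ A * B ^ n := by
  obtain ⟨A, B, hA, hB, h⟩ := hf
  refine ⟨A * B ^ a, B, by positivity, hB, fun n => (h _).trans (le_of_eq ?_)⟩
  rw [zpow_add₀ hB.ne', zpow_natCast, mul_assoc]

theorem isGeom_ofPowerSeries {F : C⟦X⟧} (hF : F ∈ ConvSeries C) : IsGeom (F : C⸨X⸩) := by
  obtain ⟨A, B, hA, hB, h⟩ := (isConvergent_iff F).1 hF
  refine IsGeom.of_nat (a := 0) (fun j hj => ?_) hA hB fun n => ?_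
  · rw [PowerSeries.coeff_coe, if_pos hj]
  · rw [PowerSeries.coeff_coe, if_neg (by simp)]
    simpa using h n

theorem tailSeries_mem {f : C⸨X⸩} (hf : IsGeom f) (a : ℤ) : tailSeries a f ∈ ConvSeries C := by
  obtain ⟨A, B, hA, hB, h⟩ := hf.nat a
  exact (isConvergent_iff _).2 ⟨A, B, hA, hB, fun n => by simpa [tailSeries] using h n⟩

theorem ofPowerSeries_mem {F : C⟦X⟧} (hF : F ∈ ConvSeries C) : (F : C⸨X⸩) ∈ MeroGerm C :=
  (convToMero ⟨F, hF⟩).2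

theorem single_mem (n : ℤ) (a : C) : HahnSeries.single n a ∈ MeroGerm C := by
  have hX : ∀ (k : ℕ) (a : C), HahnSeries.single (k : ℤ) a ∈ MeroGerm C := by
    intro k a
    have h1 : (PowerSeries.monomial k a : C⟦X⟧) ∈ ConvSeries C := by
      refine ⟨1, one_pos, summable_of_ne_finset_zero (s := {k}) fun n hn => ?_⟩
      rw [PowerSeries.coeff_monomial, if_neg (by simpa using hn)]
      simp
    convert ofPowerSeries_mem h1 using 1
    ext j
    rw [PowerSeries.coeff_coe, HahnSeries.coeff_single, PowerSeries.coeff_monomial]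
    split_ifs <;> first | rfl | omega
  obtain ⟨k, rfl | rfl⟩ := n.eq_nat_or_neg
  · exact hX k a
  · have h2 : HahnSeries.single (-(k : ℤ)) a =
        HahnSeries.single ((0 : ℕ) : ℤ) a * (HahnSeries.single (k : ℤ) (1 : C))⁻¹ := by
      rw [HahnSeries.inv_single, HahnSeries.single_mul_single]
      simp
    rw [h2]
    exact mul_mem (hX 0 a) (inv_mem (hX k 1))

/-- If fh = g, the coefficients of f solve a triangular system whose diagonal is constantly the
lowest coefficient of h, so no small divisors occur. Conversely, a power of x times the tail series
displays f as a germ. -/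
theorem mem_meroGerm_iff {f : C⸨X⸩} : f ∈ MeroGerm C ↔ IsGeom f := by
  constructor
  · intro hf
    change ∃ g ∈ ConvSeries C, ∃ h ∈ ConvSeries C, h ≠ 0 ∧ f * (h : C⸨X⸩) = (g : C⸨X⸩) at hf
    obtain ⟨g, hg, h, hh, h0, e⟩ := hf
    have h0' : (h : C⸨X⸩) ≠ 0 := fun k =>
      h0 (HahnSeries.ofPowerSeries_injective (Γ := ℤ) (by simpa using k))
    obtain ⟨a, ha⟩ := exists_forall_lt_coeff_eq_zero f
    set b := (h : C⸨X⸩).order with hb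
    have hb0 : ∀ j < b, (h : C⸨X⸩).coeff j = 0 := fun j hj =>
      HahnSeries.coeff_eq_zero_of_lt_order hj
    obtain ⟨A, B, hA, hB, hAB⟩ := (isGeom_ofPowerSeries hh).nat b
    obtain ⟨H, D, hH, hD, hHD⟩ := (isGeom_ofPowerSeries hg).nat (b + a)
    have hc : (h : C⸨X⸩).coeff b ≠ 0 := fun k =>
      h0' (HahnSeries.coeff_order_eq_zero.1 k)
    obtain ⟨E, G, hE, hG, hEG⟩ := geometric_of_linear_system
      (κ := fun N j => (h : C⸨X⸩).coeff (b + (N - j : ℕ))) (Y := fun n => f.coeff (a + n))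
      hA hB hH hD (fun N j _ => hAB _)
      (fun N => by
        rw [← coeff_mul_eq_sum hb0 ha, mul_comm, e]
        exact hHD N)
      (geomBelow_of_le (c := ‖(h : C⸨X⸩).coeff b‖) (norm_pos_iff.2 hc) fun N => by simp)
    exact IsGeom.of_nat ha hE hG hEG
  · intro hf
    obtain ⟨a, ha⟩ := exists_forall_lt_coeff_eq_zero f
    rw [eq_single_mul_tailSeries ha]
    exact mul_mem (single_mem a 1) (ofPowerSeries_mem (tailSeries_mem hf a))

theorem ramComp_mem {d : ℕ} (hd : d ≠ 0) (s : ℕ) {f : C⸨X⸩} (hf : f ∈ MeroGerm C) :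
    ramComp d hd s f ∈ MeroGerm C := by
  rw [mem_meroGerm_iff] at *
  obtain ⟨A, B, hA, hB, h⟩ := hf
  refine ⟨A * B ^ s, B ^ d, by positivity, by positivity, fun j => (h _).trans (le_of_eq ?_)⟩
  rw [zpow_add₀ hB.ne', zpow_mul, zpow_natCast, zpow_natCast]
  ring

theorem ramHom_mem {d : ℕ} (hd : d ≠ 0) {f : C⸨X⸩} (hf : f ∈ MeroGerm C) :
    ramHom d hd f ∈ MeroGerm C := by
  rw [mem_meroGerm_iff] at *
  obtain ⟨A, B, hA, hB, h⟩ := hf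
  refine ⟨A, B ^ ((d : ℝ)⁻¹), hA, by positivity, fun k => ?_⟩
  by_cases hk : (d : ℤ) ∣ k
  · obtain ⟨j, rfl⟩ := hk
    rw [coeff_ramHom_mul, zpow_mul, zpow_natCast, Real.rpow_inv_natCast_pow hB.le hd]
    exact h j
  · rw [coeff_ramHom_of_not_dvd hd f hk, norm_zero]
    positivity

end Laurent

/-! ## Rank one modules and symbols of operators -/

section Symbol

variable {C : Type*} [NormedField C]

theorem sigmaHat_single (p : Cˣ) (n : ℤ) (a : C) :
    sigmaHat p (HahnSeries.single n a) = HahnSeries.single n (((p ^ n : Cˣ) : C) * a) := by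
  ext k
  rw [coeff_sigmaHat, HahnSeries.coeff_single, HahnSeries.coeff_single]
  split_ifs with h
  · rw [h]
  · rw [mul_zero]

/-- The operator `f ↦ lam t^m f(pt)` on `C((t))`. -/
def twSig (p : Cˣ) (m : ℤ) (lam : Cˣ) :
    C⸨X⸩ →ₛₗ[(sigmaHat p : C⸨X⸩ →+* C⸨X⸩)] C⸨X⸩ where
  toFun f := HahnSeries.single m (lam : C) * sigmaHat p f
  map_add' f g := by rw [map_add, mul_add]
  map_smul' a f := by
    rw [smul_eq_mul, map_mul, mul_left_comm]
    rfl

theorem twSig_apply (p : Cˣ) (m : ℤ) (lam : Cˣ) (f : C⸨X⸩) :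
    twSig p m lam f = HahnSeries.single m (lam : C) * sigmaHat p f := rfl

/-- Each further application of σ_p to t^(mj) produces a factor p^(mj); their product over j < i
gives the exponent m·i(i-1)/2. -/
theorem iterate_twSig (p : Cˣ) (m : ℤ) (lam : Cˣ) (i : ℕ) (f : C⸨X⸩) :
    (twSig p m lam)^[i] f =
      HahnSeries.single (m * i) ((lam ^ i * p ^ (m * (i.choose 2 : ℕ)) : Cˣ) : C) *
        (sigmaHat p)^[i] f := by
  induction i with
  | zero => simp
  | succ i ih =>
    rw [Function.iterate_succ_apply', ih, twSig_apply, map_mul, sigmaHat_single, ← mul_assoc,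
      HahnSeries.single_mul_single, Function.iterate_succ_apply']
    have h1 : m + m * i = m * ((i + 1 : ℕ) : ℤ) := by
      push_cast
      ring
    have h2 : m * ((i + 1).choose 2 : ℕ) = m * i + m * (i.choose 2 : ℕ) := by
      rw [Nat.choose_succ_succ, Nat.choose_one_right, Nat.cast_add, mul_add]
    rw [h1, h2, ← Units.val_mul, ← Units.val_mul, pow_succ, zpow_add]
    congr 3
    ac_rfl

/-- The coefficients of the operator on `C((t))` obtained by letting `L` act through
`twSig p m 1`. -/
def twCoeff (p : Cˣ) (m : ℤ) (L : C⸨X⸩[X]) (i : ℕ) : C⸨X⸩ :=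
  HahnSeries.single (m * i) ((p ^ (m * (i.choose 2 : ℕ)) : Cˣ) : C) * L.coeff i

theorem twCoeff_ne_zero {p : Cˣ} {m : ℤ} {L : C⸨X⸩[X]} {i : ℕ} (h : L.coeff i ≠ 0) :
    twCoeff p m L i ≠ 0 :=
  mul_ne_zero (HahnSeries.single_ne_zero (Units.ne_zero _)) h

theorem twCoeff_eq_zero {p : Cˣ} {m : ℤ} {L : C⸨X⸩[X]} {i : ℕ} (h : L.coeff i = 0) :
    twCoeff p m L i = 0 := by
  rw [twCoeff, h, mul_zero]

theorem opAt_twSig (p : Cˣ) (m : ℤ) (lam : Cˣ) (f : C⸨X⸩) (L : C⸨X⸩[X]) :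
    opAt (twSig p m lam) f L =
      ∑ i ∈ L.support, HahnSeries.single 0 ((lam ^ i : Cˣ) : C) *
        (twCoeff p m L i * (sigmaHat p)^[i] f) := by
  rw [opAt_apply, Polynomial.sum_def]
  refine Finset.sum_congr rfl fun i _ => ?_
  rw [iterate_twSig, smul_eq_mul, twCoeff, Units.val_mul, ← zero_add (m * i),
    ← HahnSeries.single_mul_single, zero_add]
  ring

/-- `c` is the smallest order of the coefficients `twCoeff p m L i`. -/
structure IsLead (p : Cˣ) (m : ℤ) (L : C⸨X⸩[X]) (c : ℤ) : Prop where
  coeff_eq_zero : ∀ i, ∀ j < c, (twCoeff p m L i).coeff j = 0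
  exists_ne_zero : ∃ i, (twCoeff p m L i).coeff c ≠ 0

theorem exists_isLead (p : Cˣ) (m : ℤ) {L : C⸨X⸩[X]} (hL : L ≠ 0) : ∃ c, IsLead p m L c := by
  obtain ⟨i, hi, hmin⟩ := Finset.exists_min_image L.support (fun i => (twCoeff p m L i).order)
    (Polynomial.support_nonempty.2 hL)
  refine ⟨(twCoeff p m L i).order, fun j k hk => ?_, i, fun h => ?_⟩
  · by_cases hj : L.coeff j = 0
    · rw [twCoeff_eq_zero hj, HahnSeries.coeff_zero]
    · exact HahnSeries.coeff_eq_zero_of_lt_order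
        (hk.trans_le (hmin j (Polynomial.mem_support_iff.2 hj)))
  · exact twCoeff_ne_zero (Polynomial.mem_support_iff.1 hi) (HahnSeries.coeff_order_eq_zero.1 h)

/-- The polynomial formed by the coefficients of `t^c` in the operator `L` acting through
`twSig p m 1`. -/
def symb (p : Cˣ) (m : ℤ) (L : C⸨X⸩[X]) (c : ℤ) : C[X] :=
  ∑ i ∈ L.support, Polynomial.monomial i ((twCoeff p m L i).coeff c)

theorem coeff_symb (p : Cˣ) (m : ℤ) (L : C⸨X⸩[X]) (c : ℤ) (i : ℕ) :
    (symb p m L c).coeff i = (twCoeff p m L i).coeff c := by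
  simp only [symb, Polynomial.finsetSum_coeff, Polynomial.coeff_monomial, Finset.sum_ite_eq']
  split_ifs with h
  · rfl
  · rw [twCoeff_eq_zero (Polynomial.notMem_support_iff.1 h), HahnSeries.coeff_zero]

theorem IsLead.symb_ne_zero {p : Cˣ} {m : ℤ} {L : C⸨X⸩[X]} {c : ℤ} (h : IsLead p m L c) :
    symb p m L c ≠ 0 := fun h0 => by
  obtain ⟨i, hi⟩ := h.exists_ne_zero
  rw [← coeff_symb, h0, Polynomial.coeff_zero] at hi
  exact hi rfl

theorem eval_symb (p : Cˣ) (m : ℤ) (L : C⸨X⸩[X]) (c : ℤ) (x : C) :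
    (symb p m L c).eval x = ∑ i ∈ L.support, (twCoeff p m L i).coeff c * x ^ i := by
  simp [symb, Polynomial.eval_finsetSum]

/-- The matrix entries of `L` acting through `twSig p m lam`. -/
def opKernel (p : Cˣ) (m : ℤ) (lam : Cˣ) (L : C⸨X⸩[X]) (c k : ℤ) (N j : ℕ) : C :=
  ∑ i ∈ L.support, ((lam ^ i : Cˣ) : C) *
    ((twCoeff p m L i).coeff (c + (N - j : ℕ)) * ((p ^ (i * (k + j)) : Cˣ) : C))

theorem coeff_opAt {p : Cˣ} {m : ℤ} {L : C⸨X⸩[X]} {c : ℤ} (hc : IsLead p m L c) (lam : Cˣ)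
    {f : C⸨X⸩} {k : ℤ} (hf : ∀ j < k, f.coeff j = 0) (N : ℕ) :
    (opAt (twSig p m lam) f L).coeff (c + k + N) =
      ∑ j ∈ Finset.range (N + 1), opKernel p m lam L c k N j * f.coeff (k + j) := by
  rw [opAt_twSig, HahnSeries.coeff_sum]
  simp only [opKernel, Finset.sum_mul]
  rw [Finset.sum_comm]
  refine Finset.sum_congr rfl fun i _ => ?_
  have hf' : ∀ j < k, ((sigmaHat p)^[i] f).coeff j = 0 := fun j hj => by
    rw [coeff_iterate_sigmaHat, hf j hj, mul_zero]
  rw [HahnSeries.coeff_single_zero_mul, coeff_mul_eq_sum (hc.coeff_eq_zero i) hf',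
    Finset.mul_sum]
  refine Finset.sum_congr rfl fun j _ => ?_
  rw [coeff_iterate_sigmaHat]
  ring

theorem coeff_opAt_eq_zero {p : Cˣ} {m : ℤ} {L : C⸨X⸩[X]} {c : ℤ} (hc : IsLead p m L c)
    (lam : Cˣ) {f : C⸨X⸩} {k : ℤ} (hf : ∀ j < k, f.coeff j = 0) {l : ℤ} (hl : l < c + k) :
    (opAt (twSig p m lam) f L).coeff l = 0 := by
  rw [opAt_twSig, HahnSeries.coeff_sum]
  refine Finset.sum_eq_zero fun i _ => ?_
  rw [HahnSeries.coeff_single_zero_mul, coeff_mul_eq_zero (hc.coeff_eq_zero i)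
    (fun j hj => by rw [coeff_iterate_sigmaHat, hf j hj, mul_zero]) hl, mul_zero]

/-- The diagonal entries, which are the small divisors, are values of the symbol along the orbit lam
p^ℤ. -/
theorem opKernel_self (p : Cˣ) (m : ℤ) (lam : Cˣ) (L : C⸨X⸩[X]) (c k : ℤ) (N : ℕ) :
    opKernel p m lam L c k N N = (symb p m L c).eval ((lam * p ^ (k + N) : Cˣ) : C) := by
  rw [opKernel, eval_symb]
  refine Finset.sum_congr rfl fun i _ => ?_
  rw [Nat.sub_self, Nat.cast_zero, add_zero, mul_left_comm, ← Units.val_mul, ← Units.val_pow_eq_pow_val,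
    mul_pow, ← zpow_natCast (p ^ _), ← zpow_mul, mul_comm (i : ℤ)]

theorem coeff_opAt_lead {p : Cˣ} {m : ℤ} {L : C⸨X⸩[X]} {c : ℤ} (hc : IsLead p m L c) (lam : Cˣ)
    {f : C⸨X⸩} {k : ℤ} (hf : ∀ j < k, f.coeff j = 0) :
    (opAt (twSig p m lam) f L).coeff (c + k) =
      (symb p m L c).eval ((lam * p ^ k : Cˣ) : C) * f.coeff k := by
  have := coeff_opAt hc lam hf 0
  simpa [opKernel_self] using this

/-- The points lam p^k are pairwise distinct because p is not a root of unity. -/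
theorem finite_symb_root {p : Cˣ} (hp : ∀ n : ℕ, 0 < n → p ^ n ≠ 1) (lam : Cˣ) {Q : C[X]}
    (hQ : Q ≠ 0) : {k : ℤ | Q.eval ((lam * p ^ k : Cˣ) : C) = 0}.Finite := by
  have hinj : Function.Injective fun k : ℤ => ((lam * p ^ k : Cˣ) : C) := by
    intro k l h
    have h1 : p ^ k = p ^ l := mul_left_cancel (Units.ext h)
    refine injective_zpow_iff_not_isOfFinOrder.2 ?_ h1
    rw [isOfFinOrder_iff_pow_eq_one]
    rintro ⟨n, hn, h⟩
    exact hp n hn h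
  refine Set.Finite.of_finite_image (f := fun k : ℤ => ((lam * p ^ k : Cˣ) : C))
    ((Q.rootSet_finite C).subset ?_) hinj.injOn
  rintro _ ⟨k, hk, rfl⟩
  rw [Polynomial.mem_rootSet]
  exact ⟨hQ, by simpa using hk⟩

/-! ### Formal solutions in rank one modules. -/

theorem exists_root_of_opAt_eq_zero {p : Cˣ} {m : ℤ} {L : C⸨X⸩[X]} {c : ℤ} (hc : IsLead p m L c)
    {lam : Cˣ} {y : C⸨X⸩} (hy : y ≠ 0) (h : opAt (twSig p m lam) y L = 0) :
    ∃ k : ℤ, (symb p m L c).eval ((lam * p ^ k : Cˣ) : C) = 0 := by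
  refine ⟨y.order, ?_⟩
  have h1 := coeff_opAt_lead hc lam (f := y) (k := y.order)
    fun j hj => HahnSeries.coeff_eq_zero_of_lt_order hj
  rw [h, HahnSeries.coeff_zero] at h1
  exact (mul_eq_zero.1 h1.symm).resolve_right fun h2 => hy (HahnSeries.coeff_order_eq_zero.1 h2)

theorem exists_triangular_solution (κ : ℕ → ℕ → C) (hκ : ∀ N, 0 < N → κ N N ≠ 0) :
    ∃ Y : ℕ → C, Y 0 = 1 ∧
      ∀ N, 0 < N → ∑ j ∈ Finset.range (N + 1), κ N j * Y j = 0 := by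
  let Y : ℕ → C := fun N => Nat.strongRec (motive := fun _ => C) (fun N ih =>
    if N = 0 then 1 else
      -(∑ j : Fin N, κ N j * ih j j.2) / κ N N) N
  have hY : ∀ N, Y N = if N = 0 then 1 else -(∑ j : Fin N, κ N j * Y j) / κ N N := by
    intro N
    simp only [Y]
    rw [Nat.strongRec]
  refine ⟨Y, by rw [hY]; simp, fun N hN => ?_⟩
  rw [Finset.sum_range_succ, hY N, if_neg hN.ne', mul_div_cancel₀ _ (hκ N hN),
    Finset.sum_range, add_neg_cancel]

/-- Frobenius' method: a series starting at the largest k for which lam p^k is a root of the symbol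
meets no further vanishing diagonal entry. -/
theorem exists_solution {p : Cˣ} (hp : ∀ n : ℕ, 0 < n → p ^ n ≠ 1) {m : ℤ} {L : C⸨X⸩[X]} {c : ℤ}
    (hc : IsLead p m L c) {lam : Cˣ}
    (h : ∃ k : ℤ, (symb p m L c).eval ((lam * p ^ k : Cˣ) : C) = 0) :
    ∃ y : C⸨X⸩, y ≠ 0 ∧ opAt (twSig p m lam) y L = 0 := by
  obtain ⟨k, hk, hmax⟩ := Set.exists_max_image _ id (finite_symb_root hp lam hc.symb_ne_zero) h
  obtain ⟨Y, hY0, hY⟩ := exists_triangular_solution (opKernel p m lam L c k) fun N hN h0 => by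
    rw [opKernel_self] at h0
    have := hmax _ h0
    simp only [id] at this
    omega
  set y : C⸨X⸩ := HahnSeries.single k (1 : C) * (PowerSeries.mk Y : C⟦X⟧) with hy
  have hyc : ∀ n : ℕ, y.coeff (k + n) = Y n := fun n => by
    rw [hy, coeff_single_mul_ofPowerSeries, PowerSeries.coeff_mk]
  have hyl : ∀ j < k, y.coeff j = 0 := fun j hj => by
    rw [hy, HahnSeries.coeff_single_mul, PowerSeries.coeff_coe, if_pos (by omega), mul_zero]
  refine ⟨y, fun h0 => ?_, ?_⟩
  · have := hyc 0
    rw [h0, hY0, HahnSeries.coeff_zero] at this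
    exact zero_ne_one this
  · ext l
    rw [HahnSeries.coeff_zero]
    rcases lt_or_ge l (c + k) with hl | hl
    · exact coeff_opAt_eq_zero hc lam hyl hl
    · obtain ⟨N, rfl⟩ : ∃ N : ℕ, l = c + k + N := ⟨(l - (c + k)).toNat, by omega⟩
      rw [coeff_opAt hc lam hyl]
      simp only [hyc]
      rcases Nat.eq_zero_or_pos N with rfl | hN
      · rw [zero_add, Finset.sum_range_one, opKernel_self, Nat.cast_zero, add_zero]
        rw [show (symb p m L c).eval ((lam * p ^ k : Cˣ) : C) = 0 from hk, zero_mul]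
      · exact hY N hN

/-- The symbol of a product of operators. -/
theorem symb_skewMul {p : Cˣ} (hp : ∀ n : ℕ, 0 < n → p ^ n ≠ 1) {m : ℤ} {L P : C⸨X⸩[X]}
    {c cL cP : ℤ} (hc : IsLead p m (skewMul (sigmaHat p) L P) c) (hL : IsLead p m L cL)
    (hP : IsLead p m P cP) (lam : Cˣ) (k : ℤ) :
    (symb p m (skewMul (sigmaHat p) L P) c).eval ((lam * p ^ k : Cˣ) : C) =
      (symb p m L cL).eval ((lam * p ^ (cP + k) : Cˣ) : C) *
        (symb p m P cP).eval ((lam * p ^ k : Cˣ) : C) := by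
  -- Both sides are read off from the lowest term of the product applied to the monomial t^k.
  have hs : ∀ k : ℤ, ∀ j < k, (HahnSeries.single k (1 : C)).coeff j = 0 := fun k j hj =>
    HahnSeries.coeff_single_of_ne hj.ne
  have e1 : ∀ k : ℤ, (opAt (twSig p m lam) (HahnSeries.single k (1 : C))
      (skewMul (sigmaHat p) L P)).coeff (cL + (cP + k)) =
      (symb p m L cL).eval ((lam * p ^ (cP + k) : Cˣ) : C) *
        (symb p m P cP).eval ((lam * p ^ k : Cˣ) : C) := by
    intro k
    rw [opAt_skewMul, coeff_opAt_lead hL lam fun j hj => coeff_opAt_eq_zero hP lam (hs k) hj,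
      coeff_opAt_lead hP lam (hs k), HahnSeries.coeff_single_same, mul_one]
  have e2 : ∀ k : ℤ, ∀ l < cL + (cP + k), (opAt (twSig p m lam) (HahnSeries.single k (1 : C))
      (skewMul (sigmaHat p) L P)).coeff l = 0 := by
    intro k l hl
    rw [opAt_skewMul]
    exact coeff_opAt_eq_zero hL lam (fun j hj => coeff_opAt_eq_zero hP lam (hs k) hj) hl
  have e3 : ∀ k : ℤ, (opAt (twSig p m lam) (HahnSeries.single k (1 : C))
      (skewMul (sigmaHat p) L P)).coeff (c + k) =
      (symb p m (skewMul (sigmaHat p) L P) c).eval ((lam * p ^ k : Cˣ) : C) := by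
    intro k
    rw [coeff_opAt_lead hc lam (hs k), HahnSeries.coeff_single_same, mul_one]
  -- For k outside finitely many values no symbol involved vanishes, and the two descriptions of the
  -- order of the image of t^k must agree.
  have hcc : c = cL + cP := by
    have hfin := ((finite_symb_root hp lam hc.symb_ne_zero).union
      (finite_symb_root hp lam hP.symb_ne_zero)).union
      (((finite_symb_root hp lam hL.symb_ne_zero)).preimage
        (f := fun k => cP + k) (add_right_injective cP).injOn)
    obtain ⟨k, hk⟩ := hfin.exists_notMem
    simp only [Set.mem_union, Set.mem_ofPred_eq, Set.mem_preimage, not_or] at hk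
    obtain ⟨⟨h1, h2⟩, h3⟩ := hk
    rcases lt_trichotomy c (cL + cP) with h | h | h
    · exact absurd ((e3 k).symm.trans (e2 k _ (by omega))) h1
    · exact h
    · refine absurd ((e1 k).symm.trans (coeff_opAt_eq_zero hc lam (hs k) (by omega))) ?_
      exact mul_ne_zero h3 h2
  rw [← e3, ← e1, hcc, add_assoc]

/-! ### Convergence of formal solutions -/

/-- The values of `Q` at `lam * p ^ k` for large `k` have products bounded below by a geometric
sequence. -/
def SymbGeom (p lam : Cˣ) (Q : C[X]) : Prop :=
  ∃ k : ℤ, GeomBelow fun N : ℕ => ‖Q.eval ((lam * p ^ (k + N) : Cˣ) : C)‖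

theorem norm_val_zpow {p : Cˣ} (hp : ‖(p : C)‖ = 1) (k : ℤ) : ‖((p ^ k : Cˣ) : C)‖ = 1 := by
  rw [Units.val_zpow_eq_zpow_val, norm_zpow, hp, one_zpow]

theorem exists_bound_eval {p : Cˣ} (hp : ‖(p : C)‖ = 1) (lam : Cˣ) (Q : C[X]) :
    ∃ S : ℝ, ∀ k : ℤ, ‖Q.eval ((lam * p ^ k : Cˣ) : C)‖ ≤ S := by
  refine ⟨∑ i ∈ Finset.range (Q.natDegree + 1), ‖Q.coeff i‖ * ‖(lam : C)‖ ^ i, fun k => ?_⟩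
  rw [Polynomial.eval_eq_sum_range]
  refine norm_sum_le_of_le _ fun i _ => ?_
  rw [norm_mul, norm_pow, Units.val_mul, norm_mul, norm_val_zpow hp, mul_one]

theorem exists_geom_bound_sum {ι : Type*} (s : Finset ι) (u : ι → ℕ → ℝ)
    (h : ∀ i ∈ s, ∃ A B : ℝ, 0 < A ∧ 0 < B ∧ ∀ n, u i n ≤ A * B ^ n) :
    ∃ A B : ℝ, 0 < A ∧ 0 < B ∧ ∀ n, ∑ i ∈ s, u i n ≤ A * B ^ n := by
  classical
  induction s using Finset.induction_on with
  | empty => exact ⟨1, 1, one_pos, one_pos, fun n => by simp⟩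
  | insert a s ha ih =>
    obtain ⟨A, B, hA, hB, h1⟩ := ih fun i hi => h i (Finset.mem_insert_of_mem hi)
    obtain ⟨A', B', hA', hB', h2⟩ := h a (Finset.mem_insert_self a s)
    refine ⟨A' + A, max B' B, by positivity, by positivity, fun n => ?_⟩
    rw [Finset.sum_insert ha, add_mul]
    refine add_le_add ((h2 n).trans ?_) ((h1 n).trans ?_)
    · gcongr
      exact le_max_left _ _
    · gcongr
      exact le_max_right _ _

theorem mem_meroGerm_of_coeff_eq_zero {f : C⸨X⸩} {b : ℤ} (h : ∀ j ≥ b, f.coeff j = 0) :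
    f ∈ MeroGerm C := by
  obtain ⟨a, ha⟩ := exists_forall_lt_coeff_eq_zero f
  rw [eq_single_mul_tailSeries ha]
  refine mul_mem (single_mem _ _) (ofPowerSeries_mem ⟨1, one_pos, ?_⟩)
  refine summable_of_ne_finset_zero (s := Finset.range (b - a).toNat) fun n hn => ?_
  rw [Finset.mem_range, not_lt] at hn
  simp [tailSeries, h (a + n) (by omega)]

theorem iterate_sigmaHat_mem (p : Cˣ) (i : ℕ) {f : C⸨X⸩} (hf : f ∈ MeroGerm C) :
    (sigmaHat p)^[i] f ∈ MeroGerm C := by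
  induction i with
  | zero => exact hf
  | succ i ih =>
    rw [Function.iterate_succ_apply']
    exact sigmaHat_mem p ih

theorem twCoeff_mem {p : Cˣ} {m : ℤ} {L : C⸨X⸩[X]} (hL : ∀ i, L.coeff i ∈ MeroGerm C) (i : ℕ) :
    twCoeff p m L i ∈ MeroGerm C :=
  mul_mem (single_mem _ _) (hL i)

theorem opAt_twSig_mem {p : Cˣ} {m : ℤ} {L : C⸨X⸩[X]} (hL : ∀ i, L.coeff i ∈ MeroGerm C)
    (lam : Cˣ) {f : C⸨X⸩} (hf : f ∈ MeroGerm C) : opAt (twSig p m lam) f L ∈ MeroGerm C := by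
  rw [opAt_twSig]
  exact sum_mem fun i _ => mul_mem (single_mem _ _)
    (mul_mem (twCoeff_mem hL i) (iterate_sigmaHat_mem p i hf))

/-- Finitely many terms of y do not matter, so y may be cut off below the index k from which the
small divisors are controlled. The rest solves a triangular system with these divisors on the
diagonal. -/
theorem mem_meroGerm_of_opAt_mem {p : Cˣ} (hp : ‖(p : C)‖ = 1) {m : ℤ} {L : C⸨X⸩[X]}
    (hL : ∀ i, L.coeff i ∈ MeroGerm C) {c : ℤ} (hc : IsLead p m L c) {lam : Cˣ}
    (hs : SymbGeom p lam (symb p m L c)) {y : C⸨X⸩}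
    (hy : opAt (twSig p m lam) y L ∈ MeroGerm C) : y ∈ MeroGerm C := by
  obtain ⟨k, hk⟩ := hs
  set z : C⸨X⸩ := HahnSeries.single k (1 : C) * (tailSeries k y : C⟦X⟧) with hz
  have hzl : ∀ j < k, z.coeff j = 0 := fun j hj => by
    rw [hz, HahnSeries.coeff_single_mul, PowerSeries.coeff_coe, if_pos (by omega), mul_zero]
  have hyz : y - z ∈ MeroGerm C := by
    refine mem_meroGerm_of_coeff_eq_zero (b := k) fun j hj => ?_
    obtain ⟨n, rfl⟩ : ∃ n : ℕ, j = k + n := ⟨(j - k).toNat, by omega⟩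
    rw [HahnSeries.coeff_sub, hz, coeff_single_mul_ofPowerSeries, tailSeries,
      PowerSeries.coeff_mk, sub_self]
  have hLz : opAt (twSig p m lam) z L ∈ MeroGerm C := by
    have h1 := sub_mem hy (opAt_twSig_mem (p := p) (m := m) hL lam hyz)
    rwa [← opAt_sub, sub_sub_cancel] at h1
  suffices hz' : z ∈ MeroGerm C by
    have := add_mem hyz hz'
    rwa [sub_add_cancel] at this
  obtain ⟨A, B, hA, hB, hAB⟩ := exists_geom_bound_sum L.support
    (fun i n => ‖((lam ^ i : Cˣ) : C)‖ * ‖(twCoeff p m L i).coeff (c + n)‖) fun i _ => by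
      obtain ⟨A, B, hA, hB, h⟩ := (mem_meroGerm_iff.1 (twCoeff_mem (p := p) (m := m) hL i)).nat c
      refine ⟨‖((lam ^ i : Cˣ) : C)‖ * A, B,
        mul_pos (norm_pos_iff.2 (Units.ne_zero _)) hA, hB, fun n => ?_⟩
      rw [mul_assoc]
      exact mul_le_mul_of_nonneg_left (h n) (norm_nonneg _)
  obtain ⟨H, D, hH, hD, hHD⟩ := (mem_meroGerm_iff.1 hLz).nat (c + k)
  obtain ⟨E, G, hE, hG, hEG⟩ := geometric_of_linear_system (κ := opKernel p m lam L c k)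
    -- Since |p| = 1, the powers of p in the kernel do not affect its size, and the bound depends on
    -- N - j alone.
    (Y := fun n => z.coeff (k + n)) hA hB hH hD (fun N j _ => by
      refine le_trans (norm_sum_le_of_le _ fun i _ => ?_) (hAB (N - j))
      rw [norm_mul, norm_mul, norm_val_zpow hp, mul_one])
    (fun N => by rw [← coeff_opAt hc lam hzl]; exact hHD N)
    (by simpa only [opKernel_self] using hk)
  exact mem_meroGerm_iff.2 (IsGeom.of_nat hzl hE hG hEG)

end Symbol

/-! ## Formal homomorphisms are convergent -/

section Core

variable {C : Type*} [NormedField C]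

/-- The operators with coefficients in `C({x})`. -/
def IsConvOp (P : C⸨X⸩[X]) : Prop := ∀ i, P.coeff i ∈ MeroGerm C

theorem isConvOp_iff {P : C⸨X⸩[X]} :
    IsConvOp P ↔ ∃ P₀ : (MeroGerm C)[X], P₀.map (MeroGerm C).subtype = P := by
  constructor
  · intro h
    have : P ∈ Polynomial.lifts (MeroGerm C).subtype := by
      rw [Polynomial.lifts_iff_coeff_lifts]
      exact fun n => ⟨⟨_, h n⟩, rfl⟩
    obtain ⟨P₀, h⟩ := this
    exact ⟨P₀, h⟩
  · rintro ⟨P₀, rfl⟩ i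
    rw [Polynomial.coeff_map]
    exact (P₀.coeff i).2

theorem IsConvOp.add {P Q : C⸨X⸩[X]} (hP : IsConvOp P) (hQ : IsConvOp Q) : IsConvOp (P + Q) :=
  fun i => by rw [Polynomial.coeff_add]; exact add_mem (hP i) (hQ i)

theorem IsConvOp.sub {P Q : C⸨X⸩[X]} (hP : IsConvOp P) (hQ : IsConvOp Q) : IsConvOp (P - Q) :=
  fun i => by rw [Polynomial.coeff_sub]; exact sub_mem (hP i) (hQ i)

theorem map_subtype_skewMul (q : Cˣ) (P Q : (MeroGerm C)[X]) :
    (skewMul (sigma q) P Q).map (MeroGerm C).subtype =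
      skewMul (sigmaHat q) (P.map (MeroGerm C).subtype) (Q.map (MeroGerm C).subtype) :=
  map_skewMul _ (fun _ => rfl) P Q

theorem IsConvOp.skewMul (q : Cˣ) {P Q : C⸨X⸩[X]} (hP : IsConvOp P) (hQ : IsConvOp Q) :
    IsConvOp (skewMul (sigmaHat q) P Q) := by
  obtain ⟨P, rfl⟩ := isConvOp_iff.1 hP
  obtain ⟨Q, rfl⟩ := isConvOp_iff.1 hQ
  exact isConvOp_iff.2 ⟨_, map_subtype_skewMul q P Q⟩

theorem IsConvOp.map_ramHom {P : C⸨X⸩[X]} (hP : IsConvOp P) {d : ℕ} (hd : d ≠ 0) :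
    IsConvOp (P.map (ramHom d hd)) := fun i => by
  rw [Polynomial.coeff_map]
  exact ramHom_mem hd (hP i)

/-- A left factor of a convergent operator, the right factor being convergent. -/
theorem IsConvOp.of_skewMul (q : Cˣ) {P Q : C⸨X⸩[X]} (hQ : IsConvOp Q) (hQ0 : Q ≠ 0)
    (h : IsConvOp (QDiff.skewMul (sigmaHat q) P Q)) : IsConvOp P := by
  obtain ⟨Q₀, rfl⟩ := isConvOp_iff.1 hQ
  obtain ⟨H, hH⟩ := isConvOp_iff.1 h
  -- Division over C({x}) is also a division over C((x)), where quotients are unique; so its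
  -- quotient is P.
  obtain ⟨W, R, e, hR⟩ := exists_skew_division (σ := sigma q) Q₀
    (fun h0 => hQ0 (by rw [h0, Polynomial.map_zero])) H
  have h1 : QDiff.skewMul (sigmaHat q) (P - W.map (MeroGerm C).subtype)
      (Q₀.map (MeroGerm C).subtype) = R.map (MeroGerm C).subtype := by
    rw [sub_skewMul, ← hH, e, Polynomial.map_add, map_subtype_skewMul, add_sub_cancel_left]
  have h2 := eq_zero_of_degree_skewMul_lt (P := P - W.map (MeroGerm C).subtype)
    (Q := Q₀.map (MeroGerm C).subtype) (σ := sigmaHat q) (by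
      rw [h1, Polynomial.degree_map, Polynomial.degree_map]; exact hR)
  rw [sub_eq_zero.1 h2]
  exact isConvOp_iff.2 ⟨W, rfl⟩

/-- The action of an operator in `C((x))[σ_q]` on `C((t))`, `t^d = x`, through `twSig p m lam`. -/
def ramAct (p : Cˣ) (m : ℤ) (lam : Cˣ) {d : ℕ} (hd : d ≠ 0) (y : C⸨X⸩) (P : C⸨X⸩[X]) : C⸨X⸩ :=
  opAt (twSig p m lam) y (P.map (ramHom d hd))

/-! ### Operators acting on ramified Laurent series. -/

section Act

variable {p q : Cˣ} {m : ℤ} {lam : Cˣ} {d : ℕ} {hd : d ≠ 0}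

theorem map_ramHom_skewMul (hp : p ^ d = q) (P Q : C⸨X⸩[X]) :
    (skewMul (sigmaHat q) P Q).map (ramHom d hd) =
      skewMul (sigmaHat p) (P.map (ramHom d hd)) (Q.map (ramHom d hd)) :=
  map_skewMul _ (ramHom_sigmaHat hd hp) P Q

theorem ramAct_skewMul (hp : p ^ d = q) (y : C⸨X⸩) (P Q : C⸨X⸩[X]) :
    ramAct p m lam hd y (skewMul (sigmaHat q) P Q) =
      ramAct p m lam hd (ramAct p m lam hd y Q) P := by
  rw [ramAct, map_ramHom_skewMul hp, opAt_skewMul]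
  rfl

theorem ramAct_add (y : C⸨X⸩) (P Q : C⸨X⸩[X]) :
    ramAct p m lam hd y (P + Q) = ramAct p m lam hd y P + ramAct p m lam hd y Q := by
  rw [ramAct, Polynomial.map_add, map_add]
  rfl

theorem ramAct_sub (y : C⸨X⸩) (P Q : C⸨X⸩[X]) :
    ramAct p m lam hd y (P - Q) = ramAct p m lam hd y P - ramAct p m lam hd y Q := by
  rw [ramAct, Polynomial.map_sub, map_sub]
  rfl

theorem ramAct_zero (P : C⸨X⸩[X]) : ramAct p m lam hd 0 P = 0 := opAt_zero _ _

theorem ramAct_mem {y : C⸨X⸩} (hy : y ∈ MeroGerm C) {P : C⸨X⸩[X]} (hP : IsConvOp P) :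
    ramAct p m lam hd y P ∈ MeroGerm C :=
  opAt_twSig_mem (hP.map_ramHom hd) lam hy

theorem ramAct_eq_sum (y : C⸨X⸩) (P : C⸨X⸩[X]) {n : ℕ} (hn : P.natDegree < n) :
    ramAct p m lam hd y P =
      ∑ i ∈ Finset.range n, ramHom d hd (P.coeff i) * (twSig p m lam)^[i] y := by
  rw [ramAct, opAt_apply, Polynomial.sum_over_range' _ (by simp) n
    ((Polynomial.natDegree_map_le).trans_lt hn)]
  simp only [Polynomial.coeff_map, smul_eq_mul]

theorem iterate_twSig_mem {y : C⸨X⸩} (hy : y ∈ MeroGerm C) (i : ℕ) :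
    (twSig p m lam)^[i] y ∈ MeroGerm C := by
  rw [iterate_twSig]
  exact mul_mem (single_mem _ _) (iterate_sigmaHat_mem p i hy)

/-- A linear system over a subfield with independent columns has its solutions in the subfield. -/
theorem mem_of_mulVec_mem {E : Type*} [Field E] {K : Subfield E} {d n : ℕ}
    (T : Matrix (Fin d) (Fin n) K) (hT : LinearMap.ker T.mulVecLin = ⊥) {x : Fin n → E}
    (h : ∀ s, ∑ i, (T s i : E) * x i ∈ K) (i : Fin n) : x i ∈ K := by
  -- A left inverse with entries in K remains one over E and recovers x from a vector with entries
  -- in K.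
  obtain ⟨g, hg⟩ := LinearMap.exists_leftInverse_of_injective T.mulVecLin hT
  have hS : LinearMap.toMatrix' g * T = 1 := by
    have := congrArg LinearMap.toMatrix' hg
    rwa [LinearMap.toMatrix'_comp, ← Matrix.toLin'_apply', LinearMap.toMatrix'_toLin',
      LinearMap.toMatrix'_id] at this
  have hS' : (LinearMap.toMatrix' g).map K.subtype * T.map K.subtype = 1 := by
    rw [← Matrix.map_mul, hS]
    exact Matrix.map_one _ (map_zero _) (map_one _)
  have hx : x = ((LinearMap.toMatrix' g).map K.subtype).mulVec
      ((T.map K.subtype).mulVec x) := by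
    rw [Matrix.mulVec_mulVec, hS', Matrix.one_mulVec]
  rw [hx]
  change ∑ s, ((LinearMap.toMatrix' g i s : K) : E) * ∑ j, (T s j : E) * x j ∈ K
  exact sum_mem fun s _ => mul_mem (LinearMap.toMatrix' g i s).2 (h s)

/-- An operator of degree smaller than that of all convergent operators annihilating `y` is
convergent if its value at `y` is. -/
theorem isConvOp_of_ramAct_mem {y : C⸨X⸩} (hy : y ∈ MeroGerm C) {n : ℕ}
    (hmin : ∀ R : (MeroGerm C)[X], R.natDegree < n →
      ramAct p m lam hd y (R.map (MeroGerm C).subtype) = 0 → R = 0)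
    {u : C⸨X⸩[X]} (hu : u.natDegree < n) (h : ramAct p m lam hd y u ∈ MeroGerm C) :
    IsConvOp u := by
  -- The d components of the value of an operator at y are linear in its coefficients; T is the
  -- matrix of this map.
  let T : Matrix (Fin d) (Fin n) (MeroGerm C) := fun s i =>
    ⟨ramComp d hd s ((twSig p m lam)^[i] y), ramComp_mem hd s (iterate_twSig_mem hy i)⟩
  have hcomp : ∀ (P : C⸨X⸩[X]), P.natDegree < n → ∀ s : Fin d,
      ramComp d hd s (ramAct p m lam hd y P) = ∑ i : Fin n, (T s i : C⸨X⸩) * P.coeff i := by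
    intro P hP s
    rw [ramAct_eq_sum y P hP, map_sum, Finset.sum_range]
    refine Finset.sum_congr rfl fun i _ => ?_
    rw [ramComp_ramHom_mul hd s.2, mul_comm]
  -- A relation over C({x}) between the columns is a convergent operator of degree less than n
  -- killing y, hence zero.
  have hker : LinearMap.ker T.mulVecLin = ⊥ := by
    rw [LinearMap.ker_eq_bot']
    intro x hx
    let R : (MeroGerm C)[X] := ∑ i : Fin n, Polynomial.monomial (i : ℕ) (x i)
    have hRc : ∀ i : Fin n, R.coeff i = x i := fun i => by
      simp [R, Polynomial.finsetSum_coeff, Polynomial.coeff_monomial, Fin.val_inj]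
    by_cases hn : n = 0
    · subst hn
      exact Subsingleton.elim _ _
    have hRd : R.natDegree < n := by
      refine Nat.lt_of_le_of_lt (Polynomial.natDegree_sum_le_of_forall_le (n := n - 1) _ _
        fun i _ => ?_) (by omega)
      exact (Polynomial.natDegree_monomial_le _).trans (by omega)
    have hR0 : R = 0 := by
      refine hmin R hRd (eq_zero_of_ramComp hd fun s hs => ?_)
      rw [hcomp _ (Polynomial.natDegree_map_le.trans_lt hRd) ⟨s, hs⟩]
      have := congrArg (fun z => ((z ⟨s, hs⟩ : MeroGerm C) : C⸨X⸩)) hx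
      simp only [Matrix.mulVecLin_apply, Matrix.mulVec, dotProduct, Pi.zero_apply,
        ZeroMemClass.coe_zero, AddSubmonoidClass.coe_finsetSum, MulMemClass.coe_mul] at this
      rw [← this]
      refine Finset.sum_congr rfl fun i _ => ?_
      rw [Polynomial.coeff_map, hRc]
      rfl
    funext i
    rw [← hRc, hR0, Polynomial.coeff_zero, Pi.zero_apply]
  refine fun i => (lt_or_ge i n).elim (fun hi => ?_) fun hi => ?_
  · refine mem_of_mulVec_mem T hker (x := fun i : Fin n => u.coeff i) (fun s => ?_) ⟨i, hi⟩
    have h1 := hcomp u hu s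
    have h2 := ramComp_mem hd s h
    rw [h1] at h2
    exact h2
  · rw [Polynomial.coeff_eq_zero_of_natDegree_lt (hu.trans_le hi)]
    exact zero_mem _

end Act

/-- Every root `lam` of the symbols of `L'` satisfies the diophantine condition with respect to
the operators `L` and `L'`. -/
def SymbCompatible (root : ℕ → Cˣ) (L L' : C⸨X⸩[X]) : Prop :=
  ∀ (d : ℕ) (hd : d ≠ 0) (m : ℤ) (lam : Cˣ) (c c' : ℤ), IsCoprime m (d : ℤ) →
    IsLead (root d) m (L.map (ramHom d hd)) c → IsLead (root d) m (L'.map (ramHom d hd)) c' →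
    (∃ k : ℤ, (symb (root d) m (L'.map (ramHom d hd)) c').eval
      ((lam * root d ^ k : Cˣ) : C) = 0) →
    SymbGeom (root d) lam (symb (root d) m (L.map (ramHom d hd)) c) ∧
      SymbGeom (root d) lam (symb (root d) m (L'.map (ramHom d hd)) c')

/-- The values of Q₂ on lam p^ℤ are bounded because |p| = 1, so small products must come from Q₁;
the index is shifted by a. -/
theorem SymbGeom.of_mul {p lam : Cˣ} (hp : ‖(p : C)‖ = 1) {Q Q₁ Q₂ : C[X]} {a : ℤ}
    (h : ∀ k : ℤ, Q.eval ((lam * p ^ k : Cˣ) : C) =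
      Q₁.eval ((lam * p ^ (a + k) : Cˣ) : C) * Q₂.eval ((lam * p ^ k : Cˣ) : C))
    (hQ : SymbGeom p lam Q) : SymbGeom p lam Q₁ := by
  obtain ⟨k, hk⟩ := hQ
  obtain ⟨S, hS⟩ := exists_bound_eval hp lam Q₂
  refine ⟨a + k, GeomBelow.of_mul (v := fun N : ℕ => ‖Q₂.eval ((lam * p ^ (k + N) : Cˣ) : C)‖)
    (S := S) ?_ (fun _ => norm_nonneg _) (fun _ => norm_nonneg _) fun _ => hS _⟩
  simpa only [h, norm_mul, add_assoc] using hk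

/-- A slope of the Newton polygon, and a corresponding exponent. -/
theorem exists_slope_root [IsAlgClosed C] (p : ℕ → Cˣ) {L : C⸨X⸩[X]} (h0 : L.coeff 0 ≠ 0)
    (hdeg : 0 < L.natDegree) :
    ∃ (d : ℕ) (hd : d ≠ 0) (m : ℤ) (lam : Cˣ) (c : ℤ), IsCoprime m (d : ℤ) ∧
      IsLead (p d) m (L.map (ramHom d hd)) c ∧
      (symb (p d) m (L.map (ramHom d hd)) c).eval (lam : C) = 0 := by
  have hL : L ≠ 0 := fun h => h0 (by rw [h, Polynomial.coeff_zero])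
  -- The maximum r is minus the slope of the edge of the Newton polygon issuing from (0, ord a₀).
  -- The ramification index d and the twist m are its denominator and numerator.
  obtain ⟨i, hi, hmax⟩ := Finset.exists_max_image (L.support.erase 0)
    (fun i => (((L.coeff 0).order - (L.coeff i).order : ℤ) : ℚ) / (i : ℚ))
    ⟨L.natDegree, Finset.mem_erase.2 ⟨hdeg.ne', Polynomial.natDegree_mem_support_of_nonzero hL⟩⟩
  obtain ⟨hi0, hi⟩ := Finset.mem_erase.1 hi
  set r : ℚ := (((L.coeff 0).order - (L.coeff i).order : ℤ) : ℚ) / (i : ℚ) with hr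
  have hden : (0 : ℚ) < r.den := by exact_mod_cast r.pos
  have hrd : r = r.num / r.den := (Rat.num_div_den r).symm
  have hle : ∀ j ∈ L.support,
      (r.den : ℤ) * (L.coeff 0).order ≤ r.den * (L.coeff j).order + r.num * j := by
    intro j hj
    rcases Nat.eq_zero_or_pos j with rfl | hj0
    · simp
    · have h1 := hmax j (Finset.mem_erase.2 ⟨hj0.ne', hj⟩)
      have hj' : (0 : ℚ) < j := by exact_mod_cast hj0
      rw [hrd, div_le_div_iff₀ hj' hden] at h1
      have h2 : ((L.coeff 0).order - (L.coeff j).order) * (r.den : ℤ) ≤ r.num * j := by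
        exact_mod_cast h1
      linarith
  have heq : (r.den : ℤ) * (L.coeff 0).order = r.den * (L.coeff i).order + r.num * i := by
    have hi' : (i : ℚ) ≠ 0 := by exact_mod_cast hi0
    have h1 : (((L.coeff 0).order - (L.coeff i).order : ℤ) : ℚ) * r.den = r.num * i := by
      have := hrd
      rw [hr] at this
      rw [div_eq_iff hi', ← hr] at this
      rw [this]
      field_simp
    have h2 : ((L.coeff 0).order - (L.coeff i).order) * (r.den : ℤ) = r.num * i := by
      exact_mod_cast h1
    linarith
  have hd : r.den ≠ 0 := r.den_ne_zero
  have hc : ∀ (j : ℕ) (k : ℤ), (twCoeff (p r.den) r.num (L.map (ramHom r.den hd)) j).coeff k =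
      ((p r.den ^ (r.num * (j.choose 2 : ℕ)) : Cˣ) : C) *
        (ramHom r.den hd (L.coeff j)).coeff (k - r.num * j) := fun j k => by
    rw [twCoeff, HahnSeries.coeff_single_mul, Polynomial.coeff_map]
  have hne : ∀ j ∈ L.support, (r.den : ℤ) * (L.coeff 0).order =
      r.den * (L.coeff j).order + r.num * j →
      (twCoeff (p r.den) r.num (L.map (ramHom r.den hd)) j).coeff
        (r.den * (L.coeff 0).order) ≠ 0 := by
    intro j hj e
    rw [hc, e, add_sub_cancel_right, coeff_ramHom_mul]
    exact mul_ne_zero (Units.ne_zero _) fun h =>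
      Polynomial.mem_support_iff.1 hj (HahnSeries.coeff_order_eq_zero.1 h)
  have hlead : IsLead (p r.den) r.num (L.map (ramHom r.den hd)) (r.den * (L.coeff 0).order) := by
    refine ⟨fun j k hk => ?_, 0, hne 0 (Polynomial.mem_support_iff.2 h0) (by simp)⟩
    rw [hc, coeff_ramHom]
    split_ifs with hdvd
    · by_cases hj : j ∈ L.support
      · rw [HahnSeries.coeff_eq_zero_of_lt_order, mul_zero]
        have hpos : (0 : ℤ) < r.den := by exact_mod_cast r.pos
        refine Int.ediv_lt_of_lt_mul hpos ?_
        have := hle j hj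
        linarith
      · rw [Polynomial.notMem_support_iff.1 hj, HahnSeries.coeff_zero, mul_zero]
    · rw [mul_zero]
  have hs0 : (symb (p r.den) r.num (L.map (ramHom r.den hd))
      (r.den * (L.coeff 0).order)).coeff 0 ≠ 0 := by
    rw [coeff_symb]
    exact hne 0 (Polynomial.mem_support_iff.2 h0) (by simp)
  have hsi : (symb (p r.den) r.num (L.map (ramHom r.den hd))
      (r.den * (L.coeff 0).order)).coeff i ≠ 0 := by
    rw [coeff_symb]
    exact hne i hi heq
  -- The symbol has nonzero coefficients in degrees 0 and i > 0, one at each of two points of the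
  -- edge, so it has a root and every root is nonzero.
  obtain ⟨x, hx⟩ := IsAlgClosed.exists_root (symb (p r.den) r.num (L.map (ramHom r.den hd))
      (r.den * (L.coeff 0).order)) (by
    have := Polynomial.le_degree_of_ne_zero hsi
    intro h
    rw [h] at this
    exact hi0 (by simpa using this))
  have hx0 : x ≠ 0 := by
    rintro rfl
    rw [Polynomial.IsRoot, ← Polynomial.coeff_zero_eq_eval_zero] at hx
    exact hs0 hx
  refine ⟨r.den, hd, r.num, Units.mk0 x hx0, _, ?_, hlead, hx⟩
  rw [Int.isCoprime_iff_gcd_eq_one]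
  exact r.reduced

/-! ### Convergence of formal homomorphisms by induction on the degree. -/

section

variable {q : Cˣ} (hq_norm : ‖(q : C)‖ = 1) (hq_root : ∀ n : ℕ, 0 < n → q ^ n ≠ 1)
  {root : ℕ → Cˣ} (h_root : ∀ n : ℕ, 0 < n → root n ^ n = q)

include hq_norm h_root in
theorem norm_root {d : ℕ} (hd : d ≠ 0) : ‖(root d : C)‖ = 1 := by
  have h1 := h_root d (Nat.pos_of_ne_zero hd)
  rw [← pow_eq_one_iff_of_nonneg (norm_nonneg _) hd, ← norm_pow, ← Units.val_pow_eq_pow_val, h1,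
    hq_norm]

include hq_root h_root in
theorem root_pow_ne_one {d : ℕ} (hd : d ≠ 0) (n : ℕ) (hn : 0 < n) : root d ^ n ≠ 1 := by
  intro h
  refine hq_root n hn ?_
  rw [← h_root d (Nat.pos_of_ne_zero hd), ← pow_mul, mul_comm, pow_mul, h, one_pow]

-- The symbol of L'P is the product of the symbol of P with a shift of the symbol of L'. Hence roots
-- of the latter are, up to powers of p, roots of the former, and estimates pass to the factor.
include hq_norm hq_root h_root in
theorem SymbCompatible.of_skewMul {L L' P : C⸨X⸩[X]}
    (h : SymbCompatible root L (skewMul (sigmaHat q) L' P)) (hL' : L' ≠ 0) (hP : P ≠ 0) :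
    SymbCompatible root L L' := by
  intro d hd m lam c c' hcop hc hc' hk
  have hinj : ∀ {Q : C⸨X⸩[X]}, Q ≠ 0 → Q.map (ramHom d hd) ≠ 0 := fun hQ =>
    (Polynomial.map_ne_zero_iff (ramHom_injective hd)).2 hQ
  obtain ⟨cP, hcP⟩ := exists_isLead (root d) m (hinj hP)
  obtain ⟨cQ, hcQ⟩ := exists_isLead (root d) m (hinj (skewMul_ne_zero (σ := sigmaHat q) hL' hP))
  have hpd := h_root d (Nat.pos_of_ne_zero hd)
  have hmul : ∀ k : ℤ, (symb (root d) m ((skewMul (sigmaHat q) L' P).map (ramHom d hd)) cQ).eval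
      ((lam * root d ^ k : Cˣ) : C) = (symb (root d) m (L'.map (ramHom d hd)) c').eval
        ((lam * root d ^ (cP + k) : Cˣ) : C) * (symb (root d) m (P.map (ramHom d hd)) cP).eval
        ((lam * root d ^ k : Cˣ) : C) := by
    have hcQ' := hcQ
    rw [map_ramHom_skewMul hpd] at hcQ' ⊢
    exact fun k => symb_skewMul (root_pow_ne_one hq_root h_root hd) hcQ' hc' hcP lam k
  obtain ⟨k, hk⟩ := hk
  -- P raises orders by cP, so the symbol of L' is evaluated cP steps further along the orbit.
  obtain ⟨h1, h2⟩ := h d hd m lam c cQ hcop hc hcQ ⟨k - cP, by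
    rw [hmul, add_sub_cancel, hk, zero_mul]⟩
  exact ⟨h1, h2.of_mul (norm_root hq_norm h_root hd) hmul⟩

theorem natDegree_lt_of_degree_lt {F : Type*} [Field F] {A B : F[X]} (h0 : 0 < B.natDegree)
    (h : A.degree < B.degree) : A.natDegree < B.natDegree := by
  by_cases hA : A = 0
  · rwa [hA, Polynomial.natDegree_zero]
  · exact Polynomial.natDegree_lt_natDegree hA h

-- The heart of the proof. The difference LU - WL' is only required to be convergent, not zero,
-- because removing the convergent remainder of U at each step spoils an exact equality.
include hq_norm hq_root h_root in
theorem exists_isConvOp_sub_skewMul [IsAlgClosed C] {L : C⸨X⸩[X]} (hL0 : L ≠ 0) (hL : IsConvOp L)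
    (n : ℕ) : ∀ L' : C⸨X⸩[X], L'.natDegree = n → IsConvOp L' → L'.coeff 0 ≠ 0 →
      SymbCompatible root L L' → ∀ U W : C⸨X⸩[X],
      IsConvOp (skewMul (sigmaHat q) L U - skewMul (sigmaHat q) W L') →
      ∃ W₁ : C⸨X⸩[X], IsConvOp (U - skewMul (sigmaHat q) W₁ L') := by
  induction n using Nat.strong_induction_on with
  | _ n ih =>
  intro L' hn hL' h0 hcomp U W hU
  have hL'0 : L' ≠ 0 := fun h => h0 (by rw [h, Polynomial.coeff_zero])
  rcases Nat.eq_zero_or_pos L'.natDegree with hdeg | hdeg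
  -- In degree 0 the operator L' is a unit and U is an exact multiple of it.
  · obtain ⟨X, R, e, hR⟩ := exists_skew_division (σ := sigmaHat q) L' hL'0 U
    refine ⟨X, ?_⟩
    rw [e, add_sub_cancel_left]
    rw [Polynomial.degree_eq_natDegree hL'0, hdeg, Nat.cast_zero, Nat.WithBot.lt_zero_iff,
      Polynomial.degree_eq_bot] at hR
    intro i
    rw [hR, Polynomial.coeff_zero]
    exact zero_mem _
  obtain ⟨d, hd, m, lam, c', hcop, hc', hroot⟩ := exists_slope_root root h0 hdeg
  have hpd := h_root d (Nat.pos_of_ne_zero hd)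
  have hpn := norm_root hq_norm h_root hd
  have hp1 := root_pow_ne_one hq_root h_root hd
  have hroot' : ∃ k : ℤ, (symb (root d) m (L'.map (ramHom d hd)) c').eval
      ((lam * root d ^ k : Cˣ) : C) = 0 := ⟨0, by rw [zpow_zero, mul_one]; exact hroot⟩
  obtain ⟨c, hc⟩ := exists_isLead (root d) m
    ((Polynomial.map_ne_zero_iff (ramHom_injective hd)).2 hL0)
  obtain ⟨hgL, hgL'⟩ := hcomp d hd m lam c c' hcop hc hc' hroot'
  obtain ⟨y, hy0, hy⟩ := exists_solution hp1 hc' hroot'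
  have hyK : y ∈ MeroGerm C := by
    refine mem_meroGerm_of_opAt_mem hpn (hL'.map_ramHom hd) hc' hgL' (y := y) ?_
    rw [hy]
    exact zero_mem _
  have hyL' : ramAct (root d) m lam hd y L' = 0 := hy
  obtain ⟨L'₀, rfl⟩ := isConvOp_iff.1 hL'
  classical
  -- P is minimal among convergent operators killing y. Minimality over C({x}) is what gives a right
  -- factor of L' over C({x}) and independent columns.
  have hex : ∃ k : ℕ, ∃ P : (MeroGerm C)[X], P ≠ 0 ∧ P.natDegree = k ∧
      ramAct (root d) m lam hd y (P.map (MeroGerm C).subtype) = 0 :=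
    ⟨_, L'₀, fun h => hL'0 (by rw [h, Polynomial.map_zero]), rfl, hyL'⟩
  obtain ⟨P, hP0, hPdeg, hPy⟩ := Nat.find_spec hex
  have hmin : ∀ R : (MeroGerm C)[X], R.natDegree < P.natDegree →
      ramAct (root d) m lam hd y (R.map (MeroGerm C).subtype) = 0 → R = 0 := by
    intro R hR hRy
    by_contra hR0
    rw [hPdeg] at hR
    exact Nat.find_min hex hR ⟨R, hR0, rfl, hRy⟩
  have hPpos : 0 < P.natDegree := by
    by_contra hP
    rw [Polynomial.eq_C_of_natDegree_eq_zero (by omega : P.natDegree = 0)] at hPy hP0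
    rw [ramAct, Polynomial.map_C, Polynomial.map_C, opAt_C, smul_eq_mul, mul_eq_zero] at hPy
    refine hPy.elim (fun h => hP0 ?_) hy0
    rw [map_eq_zero, map_eq_zero] at h
    rw [h, Polynomial.C_0]
  obtain ⟨L₂, R, e, hR⟩ := exists_skew_division (σ := sigma q) P hP0 L'₀
  have hR0 : R = 0 := by
    refine hmin R (natDegree_lt_of_degree_lt hPpos hR) ?_
    have h1 := hyL'
    rw [e, Polynomial.map_add, map_subtype_skewMul, ramAct_add, ramAct_skewMul hpd, hPy,
      ramAct_zero, zero_add] at h1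
    exact h1
  rw [hR0, add_zero] at e
  set P' := P.map (MeroGerm C).subtype with hP'
  set L'' := L₂.map (MeroGerm C).subtype with hL''
  have hP'c : IsConvOp P' := isConvOp_iff.2 ⟨P, rfl⟩
  have hL''c : IsConvOp L'' := isConvOp_iff.2 ⟨L₂, rfl⟩
  have e' : L'₀.map (MeroGerm C).subtype = skewMul (sigmaHat q) L'' P' := by
    rw [e, map_subtype_skewMul]
  have hP'deg : P'.natDegree = P.natDegree := Polynomial.natDegree_map _
  rw [e'] at hn hU h0 hcomp hL'0 ⊢
  have hL''0 : L''.coeff 0 ≠ 0 := fun h => h0 (by rw [skewMul_coeff_zero, h, zero_mul])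
  have hL''ne : L'' ≠ 0 := fun h => hL''0 (by rw [h, Polynomial.coeff_zero])
  have hP'ne : P' ≠ 0 := Polynomial.ne_zero_of_natDegree_gt (hP'deg ▸ hPpos)
  have hdegL'' : L''.natDegree < n := by
    have h1 := degree_skewMul (σ := sigmaHat q) L'' P'
    rw [Polynomial.degree_eq_natDegree hL'0, Polynomial.degree_eq_natDegree hL''ne,
      Polynomial.degree_eq_natDegree hP'ne, hn, hP'deg] at h1
    have h2 : n = L''.natDegree + P.natDegree := by exact_mod_cast h1
    omega
  obtain ⟨U₁, u, eU, hu⟩ := exists_skew_division (σ := sigmaHat q) P' hP'ne U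
  -- Evaluating LU - WL' at y kills the multiples of P and leaves L(uy). The estimate for L gives
  -- convergence of uy, and minimality of P that of u.
  have huc : IsConvOp u := by
    refine isConvOp_of_ramAct_mem hyK hmin (hP'deg ▸ natDegree_lt_of_degree_lt (hP'deg ▸ hPpos) hu) ?_
    refine mem_meroGerm_of_opAt_mem hpn (hL.map_ramHom hd) hc hgL ?_
    have h1 := ramAct_mem (p := root d) (m := m) (lam := lam) (hd := hd) hyK hU
    rwa [ramAct_sub, ramAct_skewMul hpd, ramAct_skewMul hpd, ramAct_skewMul hpd, hPy, ramAct_zero,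
      ramAct_zero, sub_zero, eU, ramAct_add, ramAct_skewMul hpd, hPy, ramAct_zero, zero_add] at h1
  -- Subtracting Lu leaves (LU₁ - WL'')P, from which the convergent factor P is cancelled.
  have hU₁ : IsConvOp (skewMul (sigmaHat q) L U₁ - skewMul (sigmaHat q) W L'') := by
    refine IsConvOp.of_skewMul q hP'c hP'ne ?_
    have h1 := hU.sub (hL.skewMul q huc)
    rwa [eU, skewMul_add, ← skewMul_assoc, ← skewMul_assoc, add_sub_right_comm,
      add_sub_cancel_right, ← sub_skewMul] at h1
  obtain ⟨W₁, hW₁⟩ := ih _ hdegL'' L'' rfl hL''c hL''0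
    (hcomp.of_skewMul hq_norm hq_root h_root hL''ne hP'ne) U₁ W hU₁
  refine ⟨W₁, ?_⟩
  have h1 := (hW₁.skewMul q hP'c).add huc
  rwa [sub_skewMul, skewMul_assoc, sub_add_eq_add_sub, ← eU] at h1

end

end Core

/-! ## The diophantine condition for almost admissible operators -/

section Admissibility

/-- All the sequences obtained from `u` by deleting enough initial terms have products bounded
below by a geometric sequence. -/
def EvGeomBelow (u : ℕ → ℝ) : Prop :=
  ∃ J, ∀ J' ≥ J, GeomBelow fun N => u (J' + N)

theorem EvGeomBelow.mul {u v : ℕ → ℝ} (hu : EvGeomBelow u) (hv : EvGeomBelow v) :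
    EvGeomBelow fun k => u k * v k := by
  obtain ⟨J, h⟩ := hu
  obtain ⟨J', h'⟩ := hv
  exact ⟨max J J', fun K hK =>
    (h K ((le_max_left _ _).trans hK)).mul (h' K ((le_max_right _ _).trans hK))⟩

theorem evGeomBelow_const {c : ℝ} (hc : 0 < c) : EvGeomBelow fun _ => c :=
  ⟨0, fun _ _ => geomBelow_of_le hc fun _ => le_rfl⟩

theorem EvGeomBelow.multiset_prod {ι : Type*} (s : Multiset ι) (u : ι → ℕ → ℝ)
    (h : ∀ i ∈ s, EvGeomBelow (u i)) : EvGeomBelow fun k => (s.map fun i => u i k).prod := by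
  induction s using Multiset.induction_on with
  | empty => simpa using evGeomBelow_const one_pos
  | cons a s ih =>
    simp only [Multiset.map_cons, Multiset.prod_cons]
    exact (h a (Multiset.mem_cons_self a s)).mul
      (ih fun i hi => h i (Multiset.mem_cons_of_mem hi))

variable {C : Type*} [NormedField C]

theorem norm_one_sub_le {p : C} (hp : ‖p‖ = 1) (a : C) (k : ℕ) :
    ‖1 - p ^ k * a‖ ≤ 1 + ‖a‖ := by
  refine (norm_sub_le _ _).trans ?_
  rw [norm_one, norm_mul, norm_pow, hp, one_pow, one_mul]

theorem multiset_prod_qPochhammer (p : C) (Λ : Multiset C) (N : ℕ) :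
    (Λ.map fun a => qPochhammer a p N).prod =
      ∏ k ∈ Finset.range N, (Λ.map fun a => 1 - p ^ k * a).prod := by
  unfold qPochhammer
  exact (Multiset.prod_map_prod)

/-- The coefficients of `phi` are inverses of the products in question. The condition on Λ excludes
zero products, whose inverse would be 0 by convention and bound nothing. -/
theorem geomBelow_of_phi {p : C} {Λ : Multiset C} (hΛ : ∀ a ∈ Λ, ¬ ∃ m : ℕ, a = (p ^ m)⁻¹)
    (h : IsConvergent (phi p Λ)) :
    GeomBelow fun k => ‖(Λ.map fun a => 1 - p ^ k * a).prod‖ := by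
  obtain ⟨A, B, hA, hB, h⟩ := (isConvergent_iff _).1 h
  refine ⟨A⁻¹, B⁻¹, by positivity, by positivity, fun N => ?_⟩
  have h1 := h N
  rw [phi, PowerSeries.coeff_mk, multiset_prod_qPochhammer, norm_inv, norm_prod] at h1
  have hpos : 0 < ∏ k ∈ Finset.range N, ‖(Λ.map fun a => 1 - p ^ k * a).prod‖ := by
    refine Finset.prod_pos fun k _ => norm_pos_iff.2 ?_
    rw [Ne, Multiset.prod_eq_zero_iff, Multiset.mem_map]
    rintro ⟨a, ha, h0⟩
    exact hΛ a ha ⟨k, eq_inv_of_mul_eq_one_right (sub_eq_zero.1 h0).symm⟩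
  rw [inv_pow, ← mul_inv]
  exact inv_le_of_inv_le₀ hpos h1

/-- The factors belonging to the other members of Λ are bounded, since |p| = 1. -/
theorem geomBelow_of_mem {p : C} (hp : ‖p‖ = 1) {Λ : Multiset C}
    (hΛ : ∀ a ∈ Λ, ¬ ∃ m : ℕ, a = (p ^ m)⁻¹) (h : IsConvergent (phi p Λ)) {a : C} (ha : a ∈ Λ) :
    GeomBelow fun k => ‖1 - p ^ k * a‖ := by
  obtain ⟨Λ', rfl⟩ := Multiset.exists_cons_of_mem ha
  have h1 := geomBelow_of_phi hΛ h
  simp only [Multiset.map_cons, Multiset.prod_cons, norm_mul] at h1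
  refine h1.of_mul (S := (Λ'.map fun b => 1 + ‖b‖).prod) (fun _ => norm_nonneg _)
    (fun _ => norm_nonneg _) fun k => ?_
  rw [← coe_nnnorm, ← nnnormHom_apply, map_multiset_prod, Multiset.map_map]
  have h2 : ((Λ'.map fun b => 1 + ‖b‖).prod : ℝ) = ((Λ'.map fun b => 1 + ‖b‖₊).prod : NNReal) := by
    rw [← NNReal.coe_toRealHom, map_multiset_prod, Multiset.map_map]
    rfl
  rw [h2, NNReal.coe_le_coe]
  exact Multiset.prod_map_le_prod_map _ _ fun b _ => norm_one_sub_le hp b k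

/-- With q = p^n, 1 - q^(k+1) is 1 - p^(k+1) times a sum of n elements of norm 1, so |1 - p^(k+1)| ≥
|1 - q^(k+1)|/n. -/
theorem geomBelow_pochhammer_self {p q : C} (hp : ‖p‖ = 1) (hq : ∀ n : ℕ, 0 < n → q ^ n ≠ 1)
    (hconv : IsConvergent (phi q {q})) {n : ℕ} (hn : n ≠ 0) (hpq : p ^ n = q) :
    GeomBelow fun k => ‖1 - p ^ (k + 1)‖ := by
  have hq1 : ‖q‖ = 1 := by rw [← hpq, norm_pow, hp, one_pow]
  have hq0 : q ≠ 0 := norm_ne_zero_iff.1 (by rw [hq1]; exact one_ne_zero)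
  have h1 : GeomBelow fun k => ‖1 - q ^ k * q‖ := by
    refine geomBelow_of_mem hq1 (Λ := {q}) ?_ hconv (Multiset.mem_singleton_self q)
    rintro a ha ⟨m, hm⟩
    rw [Multiset.mem_singleton.1 ha] at hm
    refine hq (m + 1) m.succ_pos ?_
    calc q ^ (m + 1) = q ^ m * q := pow_succ q m
      _ = q ^ m * (q ^ m)⁻¹ := congrArg (q ^ m * ·) hm
      _ = 1 := mul_inv_cancel₀ (pow_ne_zero _ hq0)
  have hn0 : (0 : ℝ) < (n : ℝ)⁻¹ := inv_pos.2 (by exact_mod_cast Nat.pos_of_ne_zero hn)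
  refine (h1.mul (geomBelow_of_le (u := fun _ => (n : ℝ)⁻¹) hn0 fun _ => le_rfl)).mono
    (fun k => by positivity) fun k => ?_
  rw [← div_eq_mul_inv, div_le_iff₀ (by exact_mod_cast Nat.pos_of_ne_zero hn), ← pow_succ, ← hpq,
    ← pow_mul, mul_comm n, pow_mul, ← mul_neg_geom_sum, norm_mul]
  refine mul_le_mul_of_nonneg_left ?_ (norm_nonneg _)
  refine (norm_sum_le _ _).trans ?_
  simp [hp]

-- Factor Q over its roots r. The factor of r = 0 has constant norm. If ρ/r is not in p^(-ℕ), it is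
-- one of the ratios in the admissibility condition. If ρ/r = p^(-M), the factor is, up to a
-- constant, 1 - p^(eN-M), controlled by the hypothesis `hpp`.
open Classical in
theorem evGeomBelow_eval_of_root [IsAlgClosed C] {p : Cˣ} (hp : ‖(p : C)‖ = 1)
    (hpp : GeomBelow fun k => ‖1 - (p : C) ^ (k + 1)‖) {Q : C[X]} (hQ : Q ≠ 0)
    (hconv : IsConvergent (phi (p : C) (exponentRatios (p : C) (Q.roots.filter (· ≠ 0)))))
    {ρ : C} (hρ0 : ρ ≠ 0) (hρ : Q.eval ρ = 0) {e : ℕ} (he : 0 < e) :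
    EvGeomBelow fun N => ‖Q.eval (ρ * (p : C) ^ (e * N))‖ := by
  have hev : ∀ x : C, ‖Q.eval x‖ = ‖Q.leadingCoeff‖ * (Q.roots.map fun r => ‖x - r‖).prod := by
    intro x
    conv_lhs => rw [(IsAlgClosed.splits Q).eq_prod_roots]
    rw [Polynomial.eval_mul, Polynomial.eval_C, norm_mul, Polynomial.eval_multiset_prod,
      Multiset.map_map]
    congr 1
    change (normHom : C →*₀ ℝ) _ = _
    rw [map_multiset_prod, Multiset.map_map]
    congr 1
    refine Multiset.map_congr rfl fun r _ => ?_
    simp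
  simp only [hev]
  refine (evGeomBelow_const (norm_pos_iff.2 (Polynomial.leadingCoeff_ne_zero.2 hQ))).mul
    (EvGeomBelow.multiset_prod _ _ fun r hr => ?_)
  by_cases hr0 : r = 0
  · have : (fun k => ‖ρ * (p : C) ^ (e * k) - r‖) = fun _ => ‖ρ‖ := by
      funext k
      rw [hr0, sub_zero, norm_mul, norm_pow, hp, one_pow, mul_one]
    rw [this]
    exact evGeomBelow_const (norm_pos_iff.2 hρ0)
  have hfac : (fun k => ‖ρ * (p : C) ^ (e * k) - r‖) =
      fun k => ‖r‖ * ‖1 - (p : C) ^ (e * k) * (ρ * r⁻¹)‖ := by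
    funext k
    rw [← norm_mul, mul_sub, mul_one, ← norm_neg]
    congr 1
    field_simp
    ring
  rw [hfac]
  refine (evGeomBelow_const (norm_pos_iff.2 hr0)).mul ?_
  by_cases hM : ∃ M : ℕ, ρ * r⁻¹ = ((p : C) ^ M)⁻¹
  · obtain ⟨M, hM⟩ := hM
    -- The factor may vanish at eN = M; from N = M + 1 on, the exponent eN - M is positive.
    refine ⟨M + 1, fun J hJ => ?_⟩
    have hJe : M + 1 ≤ e * J := hJ.trans (Nat.le_mul_of_pos_left J he)
    have h1 := hpp.comp (fun _ => norm_nonneg _) (S := 1 + ‖(p : C)‖)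
      (fun k => by simpa [pow_succ] using norm_one_sub_le hp (p : C) k)
      (φ := fun N => e * N + (e * J - (M + 1))) (fun a b hab => by
        have := Nat.mul_lt_mul_of_pos_left hab he
        simp only
        omega) (fun k => le_rfl)
    refine h1.mono (fun _ => norm_nonneg _) fun N => le_of_eq ?_
    rw [hM]
    congr 2
    have h2 : e * (J + N) = (e * N + (e * J - (M + 1)) + 1) + M := by
      rw [mul_add]
      omega
    rw [h2, pow_add _ _ M, mul_inv_cancel_right₀ (pow_ne_zero _ p.ne_zero)]
  · have hmem : ρ * r⁻¹ ∈ exponentRatios (p : C) (Q.roots.filter (· ≠ 0)) := by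
      refine Multiset.mem_filter.2 ⟨Multiset.mem_map.2 ⟨(ρ, r), Multiset.mem_product.2 ⟨?_, ?_⟩,
        rfl⟩, hM⟩
      · exact Multiset.mem_filter.2 ⟨(Polynomial.mem_roots hQ).2 hρ, hρ0⟩
      · exact Multiset.mem_filter.2 ⟨hr, hr0⟩
    have h1 := geomBelow_of_mem hp (fun a ha => (Multiset.mem_filter.1 ha).2) hconv hmem
    refine ⟨0, fun J _ => ?_⟩
    refine h1.comp (fun _ => norm_nonneg _) (norm_one_sub_le hp _) (φ := fun N => e * (J + N))
      (e := e) (r := e * J) (fun a b hab => ?_) fun k => ?_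
    · exact Nat.mul_lt_mul_of_pos_left (by omega) he
    · rw [mul_add, add_comm]

/-! ### Changing the root of `q` -/

theorem two_mul_choose_two (i : ℕ) : 2 * ((i.choose 2 : ℕ) : ℤ) = i * i - i := by
  induction i with
  | zero => simp
  | succ i ih =>
    rw [Nat.choose_succ_succ, Nat.choose_one_right]
    push_cast
    linarith

/-- For i = i₀ + dk the exponent i² - i of θ is affine in i up to d times an even integer, and even
powers of θ^d are trivial. The square root θ serves to clear the denominator of i(i-1)/2. -/
theorem exists_pow_choose_two {G : Type*} [CommGroup G] (θ : G) (d : ℕ) (h : (θ ^ 2) ^ d = 1)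
    (i₀ : ℕ) : ∃ κ s : G, ∀ i : ℕ, (d : ℤ) ∣ i - i₀ → (θ ^ 2) ^ (i.choose 2) = κ * s ^ i := by
  have hε : ∀ n : ℤ, Even n → (θ ^ d) ^ n = 1 := by
    rintro n ⟨k, rfl⟩
    rw [← two_mul, zpow_mul, zpow_ofNat, ← pow_mul, mul_comm d, pow_mul, h, one_zpow]
  refine ⟨θ ^ ((i₀ : ℤ) * i₀) * (θ ^ d) ^ (-(i₀ : ℤ)), θ ^ d * θ⁻¹, fun i hi => ?_⟩
  obtain ⟨k, hk⟩ := hi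
  have h1 : (θ ^ 2) ^ (i.choose 2) = θ ^ ((i : ℤ) * i - i) := by
    rw [← two_mul_choose_two, zpow_mul, zpow_natCast, zpow_ofNat]
  have h2 : (θ ^ d) ^ (2 * (i₀ : ℤ) * k + d * (k * (k - 1))) = 1 := by
    refine hε _ (Even.add ?_ ?_)
    · exact ⟨i₀ * k, by ring⟩
    · exact (Int.even_mul_pred_self k).mul_left _
  rw [h1, mul_pow, inv_pow, ← zpow_natCast (θ ^ d), ← zpow_natCast θ i, ← zpow_neg]
  simp only [← zpow_natCast θ d, ← zpow_mul] at h2 ⊢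
  rw [← mul_one (θ ^ ((i : ℤ) * i - i)), ← inv_one, ← h2, ← zpow_neg]
  simp only [← zpow_add]
  congr 1
  have hk' : (i : ℤ) = i₀ + d * k := by linarith
  rw [hk']
  ring

/-! ### Comparison with the characteristic polynomials -/

theorem coeff_twCoeff (p : Cˣ) (m : ℤ) (L : C⸨X⸩[X]) (i : ℕ) (k : ℤ) :
    (twCoeff p m L i).coeff k =
      ((p ^ (m * (i.choose 2 : ℕ)) : Cˣ) : C) * (L.coeff i).coeff (k - m * i) := by
  rw [twCoeff, HahnSeries.coeff_single_mul]

theorem coeff_ramHom_mul_mul {d e : ℕ} (hd : d ≠ 0) (he : e ≠ 0) (hde : d * e ≠ 0) (f : C⸨X⸩)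
    (l : ℤ) : (ramHom (d * e) hde f).coeff (e * l) = (ramHom d hd f).coeff l := by
  have he' : (e : ℤ) ≠ 0 := by exact_mod_cast he
  by_cases h : (d : ℤ) ∣ l
  · obtain ⟨j, rfl⟩ := h
    rw [coeff_ramHom_mul, ← mul_assoc, mul_comm (e : ℤ), ← Nat.cast_mul, coeff_ramHom_mul]
  · rw [coeff_ramHom_of_not_dvd hd f h, coeff_ramHom_of_not_dvd]
    rw [Nat.cast_mul, mul_comm (d : ℤ)]
    exact fun h' => h (Int.dvd_of_mul_dvd_mul_left he' h')

theorem coeff_twCoeff_mul {d e : ℕ} (hd : d ≠ 0) (he : e ≠ 0) (hde : d * e ≠ 0) (p : Cˣ) (m : ℤ)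
    (L : C⸨X⸩[X]) (i : ℕ) (k : ℤ) :
    (twCoeff p (e * m) (L.map (ramHom (d * e) hde)) i).coeff (e * k) =
      (((p ^ e) ^ (m * (i.choose 2 : ℕ)) : Cˣ) : C) *
        (ramHom d hd (L.coeff i)).coeff (k - m * i) := by
  rw [coeff_twCoeff, Polynomial.coeff_map, mul_assoc, zpow_mul, zpow_natCast, mul_assoc,
    ← mul_sub, coeff_ramHom_mul_mul hd he]

/-- The root of q only multiplies coefficients by units and does not affect orders; hence p' is
arbitrary. -/
theorem IsLead.mul_ramification {d e : ℕ} {hd : d ≠ 0} (he : e ≠ 0) (hde : d * e ≠ 0) {p : Cˣ}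
    (p' : Cˣ) {m : ℤ} {L : C⸨X⸩[X]} {c : ℤ} (h : IsLead p m (L.map (ramHom d hd)) c) :
    IsLead p' (e * m) (L.map (ramHom (d * e) hde)) (e * c) := by
  have key : ∀ i k, (twCoeff p m (L.map (ramHom d hd)) i).coeff k = 0 ↔
      (twCoeff p' (e * m) (L.map (ramHom (d * e) hde)) i).coeff (e * k) = 0 := by
    intro i k
    rw [coeff_twCoeff_mul hd he hde, coeff_twCoeff, Polynomial.coeff_map, Units.mul_right_eq_zero,
      Units.mul_right_eq_zero]
  have he' : (0 : ℤ) < e := by exact_mod_cast Nat.pos_of_ne_zero he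
  refine ⟨fun i j hj => ?_, ?_⟩
  · by_cases hdvd : (e : ℤ) ∣ j
    · obtain ⟨k, rfl⟩ := hdvd
      exact (key i k).1 (h.coeff_eq_zero i k (lt_of_mul_lt_mul_left hj he'.le))
    · rw [coeff_twCoeff, Polynomial.coeff_map, coeff_ramHom_of_not_dvd, mul_zero]
      intro h'
      refine hdvd ?_
      have h1 : (e : ℤ) ∣ j - e * m * i := (Dvd.intro_left (d : ℤ) (by push_cast; rfl)).trans h'
      rw [mul_assoc] at h1
      exact (dvd_sub_left (dvd_mul_right _ _)).1 h1
  · obtain ⟨i, hi⟩ := h.exists_ne_zero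
    exact ⟨i, fun h' => hi ((key i c).2 h')⟩

/-- Conjugation by θ^μ amounts to replacing σ by t^(-μ)σ; so the slope μ corresponds to the twist m
= -μ. -/
theorem twistedCoeff_ramify (p : Cˣ) (L : (C⟦X⟧)[X]) (μ : ℤ) (n : ℕ) (hn : n ≠ 0) (i : ℕ) :
    twistedCoeff p (ramify n hn L) μ i =
      twCoeff p (-μ) ((L.map (HahnSeries.ofPowerSeries ℤ C)).map (ramHom n hn)) i := by
  rw [twistedCoeff, twCoeff, Polynomial.coeff_map, Polynomial.coeff_map, ramHom_ofPowerSeries,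
    ramify, Polynomial.coeff_map, neg_mul, neg_mul]
  rfl

theorem charPoly_ramify {p : Cˣ} {L : (C⟦X⟧)[X]} {μ : ℤ} {n : ℕ} {hn : n ≠ 0} {c : ℤ}
    (hc : IsLead p (-μ) ((L.map (HahnSeries.ofPowerSeries ℤ C)).map (ramHom n hn)) c) :
    charPoly p (ramify n hn L) μ =
      symb p (-μ) ((L.map (HahnSeries.ofPowerSeries ℤ C)).map (ramHom n hn)) c := by
  have horder : twistedOrder p (ramify n hn L) μ = c := by
    refine IsLeast.csInf_eq ⟨?_, ?_⟩
    · obtain ⟨i, hi⟩ := hc.exists_ne_zero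
      refine ⟨i, ?_, ?_⟩
      · rw [twistedCoeff_ramify]
        rintro h
        rw [h, HahnSeries.coeff_zero] at hi
        exact hi rfl
      · rw [twistedCoeff_ramify]
        refine le_antisymm (not_lt.1 fun h => ?_) (HahnSeries.order_le_of_coeff_ne_zero hi)
        have := hc.coeff_eq_zero i _ h
        rw [HahnSeries.coeff_order_eq_zero] at this
        rw [this, HahnSeries.coeff_zero] at hi
        exact hi rfl
    · rintro k ⟨i, hi, rfl⟩
      rw [twistedCoeff_ramify] at hi ⊢
      refine not_lt.1 fun h => hi ?_
      exact HahnSeries.coeff_order_eq_zero.1 (hc.coeff_eq_zero i _ h)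
  ext i
  rw [coeff_symb, charPoly, Polynomial.finsetSum_coeff, horder]
  simp only [Polynomial.coeff_monomial, Finset.sum_ite_eq', Finset.mem_range, twistedCoeff_ramify]
  split_ifs with h
  · rfl
  · rw [← twistedCoeff_ramify, twistedCoeff, Polynomial.coeff_eq_zero_of_natDegree_lt (by omega),
      map_zero, mul_zero, HahnSeries.coeff_zero]

/-- A nonzero monomial vanishes only at 0. For a symbol, two nonzero coefficients are two points on
one supporting line of the Newton polygon. -/
theorem exists_two_coeff_ne_zero {Q : C[X]} {x : C} (hQ : Q ≠ 0) (hx : x ≠ 0)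
    (h : Q.eval x = 0) : ∃ i j : ℕ, i < j ∧ Q.coeff i ≠ 0 ∧ Q.coeff j ≠ 0 := by
  by_contra! hne
  obtain ⟨i, hi⟩ := Polynomial.support_nonempty.2 hQ
  have hQi : Q = Polynomial.monomial i (Q.coeff i) := by
    ext j
    rw [Polynomial.coeff_monomial]
    split_ifs with hij
    · rw [hij]
    · by_contra hj
      rcases lt_or_gt_of_ne hij with hlt | hlt
      · exact hj (hne i j hlt (Polynomial.mem_support_iff.1 hi))
      · exact Polynomial.mem_support_iff.1 hi (hne j i hlt hj)
  rw [hQi, Polynomial.eval_monomial] at h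
  exact mul_ne_zero (Polynomial.mem_support_iff.1 hi) (pow_ne_zero _ hx) h

/-- The condition `IsLead` places the polygon above the line k = (c - m i)/d, and the indices i < j
give two of its points on this line. -/
theorem isSlope_of_isLead {p : Cˣ} {L : (C⟦X⟧)[X]} {d : ℕ} {hd : d ≠ 0} {m c : ℤ}
    (hc : IsLead p m ((L.map (HahnSeries.ofPowerSeries ℤ C)).map (ramHom d hd)) c) {i j : ℕ}
    (hij : i < j)
    (hi : (twCoeff p m ((L.map (HahnSeries.ofPowerSeries ℤ C)).map (ramHom d hd)) i).coeff c ≠ 0)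
    (hj : (twCoeff p m ((L.map (HahnSeries.ofPowerSeries ℤ C)).map (ramHom d hd)) j).coeff c ≠ 0) :
    IsSlope L (-m / d : ℚ) := by
  have hd0 : (0 : ℝ) < d := by exact_mod_cast Nat.pos_of_ne_zero hd
  have hpt : ∀ i : ℕ, (twCoeff p m ((L.map (HahnSeries.ofPowerSeries ℤ C)).map
      (ramHom d hd)) i).coeff c ≠ 0 → ((i : ℝ), ((c - m * i) / d : ℝ)) ∈ newtonPolygon L := by
    intro i hi
    rw [coeff_twCoeff, Polynomial.coeff_map, Polynomial.coeff_map] at hi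
    have hi' := right_ne_zero_of_mul hi
    have hdvd : (d : ℤ) ∣ c - m * i := by
      by_contra h
      exact hi' (coeff_ramHom_of_not_dvd hd _ h)
    obtain ⟨k, hk⟩ := hdvd
    rw [hk, coeff_ramHom_mul, PowerSeries.coeff_coe] at hi'
    have hk0 : ¬ k < 0 := fun h => hi' (if_pos h)
    obtain ⟨k, rfl⟩ := Int.eq_ofNat_of_zero_le (not_lt.1 hk0)
    rw [if_neg hk0, Int.natAbs_natCast] at hi'
    refine subset_convexHull ℝ _ ⟨i, fun h => ?_, rfl, ?_⟩
    · rw [h, map_zero] at hi'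
      exact hi' rfl
    · have h1 : ((c - m * i) / d : ℝ) = (k : ℝ) := by
        rw [div_eq_iff hd0.ne', mul_comm (k : ℝ)]
        exact_mod_cast hk
      simp only [h1]
      have h4 := PowerSeries.order_le _ hi'
      have h5 := ENat.toNat_le_toNat h4 (ENat.natCast_ne_top _)
      exact_mod_cast h5
  refine ⟨_, hpt i hi, _, hpt j hj, (Nat.cast_lt.2 hij : (i : ℝ) < j), ?_, ?_⟩
  · push_cast
    field_simp
    ring
  · intro Q hQ
    have hsub : newtonPolygon L ⊆ {Q : ℝ × ℝ | (c / d : ℝ) ≤ Q.2 - ((-m / d : ℚ) : ℝ) * Q.1} := by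
      refine convexHull_min ?_ (convex_halfSpace_ge ⟨fun x y => ?_, fun r x => ?_⟩ _)
      · rintro ⟨x, y⟩ ⟨k, hk, hx, hy⟩
        simp only at hx hy
        rw [Set.mem_ofPred_eq]
        simp only
        rw [hx]
        set o := (L.coeff k).order.toNat with ho
        have h1 : PowerSeries.coeff o (L.coeff k) ≠ 0 := PowerSeries.coeff_order hk
        have h2 : c ≤ d * o + m * k := by
          refine not_lt.1 fun h => ?_
          have h3 := hc.coeff_eq_zero k _ h
          rw [coeff_twCoeff, Polynomial.coeff_map, Polynomial.coeff_map, add_sub_cancel_right,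
            coeff_ramHom_mul, PowerSeries.coeff_coe, if_neg (by omega)] at h3
          exact h1 (by simpa using (mul_eq_zero.1 h3).resolve_left (Units.ne_zero _))
        have h3 : (c : ℝ) ≤ d * o + m * k := by exact_mod_cast h2
        have h4 : (c / d : ℝ) ≤ o + m / d * k := by
          rw [div_le_iff₀ hd0]
          calc (c : ℝ) ≤ d * o + m * k := h3
            _ = _ := by field_simp
        push_cast
        rw [neg_div]
        linarith
      · simp only [Prod.fst_add, Prod.snd_add]
        ring
      · simp only [Prod.smul_fst, Prod.smul_snd, smul_eq_mul]
        ring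
    refine le_trans (le_of_eq ?_) (hsub hQ)
    push_cast
    field_simp
    ring

/-- Almost admissibility supplies a ramification index n, necessarily a multiple n = de. The
elements `root d` and `root (d * e) ^ e` may differ by ζ with ζ^d = 1. As the symbol only involves
degrees in one class modulo d, this changes it by a constant and a rescaling of the variable,
neither of which affects the estimate. -/
theorem symbGeom_of_isAlmostAdmissibleOp [IsAlgClosed C] {q : Cˣ} (hq_norm : ‖(q : C)‖ = 1)
    (hq_root : ∀ n : ℕ, 0 < n → q ^ n ≠ 1) (hq_conv : IsConvergent (phi (q : C) {(q : C)}))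
    {root : ℕ → Cˣ} (h_root : ∀ n : ℕ, 0 < n → root n ^ n = q) {L : (C⟦X⟧)[X]}
    (hL : IsAlmostAdmissibleOp root L) {d : ℕ} {hd : d ≠ 0} {m : ℤ} (hcop : IsCoprime m (d : ℤ))
    {lam : Cˣ} {c : ℤ}
    (hc : IsLead (root d) m ((L.map (HahnSeries.ofPowerSeries ℤ C)).map (ramHom d hd)) c)
    (hk : ∃ k : ℤ, (symb (root d) m ((L.map (HahnSeries.ofPowerSeries ℤ C)).map
      (ramHom d hd)) c).eval ((lam * root d ^ k : Cˣ) : C) = 0) :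
    SymbGeom (root d) lam
      (symb (root d) m ((L.map (HahnSeries.ofPowerSeries ℤ C)).map (ramHom d hd)) c) := by
  obtain ⟨k, hk⟩ := hk
  set L' := L.map (HahnSeries.ofPowerSeries ℤ C) with hL'
  set Q := symb (root d) m (L'.map (ramHom d hd)) c with hQ
  have hd0 : 0 < d := Nat.pos_of_ne_zero hd
  obtain ⟨i₀, j₀, hij, hi₀, hj₀⟩ := exists_two_coeff_ne_zero hc.symb_ne_zero (Units.ne_zero _) hk
  obtain ⟨n, hn, m₀, hm₀, hadm⟩ := hL _ (isSlope_of_isLead hc hij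
    (by rwa [coeff_symb] at hi₀) (by rwa [coeff_symb] at hj₀))
  have hdm : (d : ℤ) * m₀ = -(n * m) := by
    have hd' : (d : ℚ) ≠ 0 := by exact_mod_cast hd
    have : (d : ℚ) * m₀ = -(n * m) := by
      rw [hm₀]
      field_simp
    exact_mod_cast this
  obtain ⟨e, rfl⟩ : d ∣ n := by
    have h1 : (d : ℤ) ∣ n * m := ⟨-m₀, by linarith⟩
    exact Int.natCast_dvd_natCast.1 (hcop.symm.dvd_of_dvd_mul_right h1)
  have he : e ≠ 0 := right_ne_zero_of_mul hn
  obtain rfl : m₀ = -(e * m) := by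
    have hd' : (d : ℤ) ≠ 0 := by exact_mod_cast hd
    refine mul_left_cancel₀ hd' ?_
    rw [hdm]
    push_cast
    ring
  have hc₀ : IsLead (root (d * e)) (-(-(e * m))) (L'.map (ramHom (d * e) hn)) (e * c) := by
    rw [neg_neg]
    exact hc.mul_ramification he hn _
  rw [IsAdmissibleSlope, exponents, charPoly_ramify hc₀] at hadm
  set Q₀ := symb (root (d * e)) (-(-(e * m))) (L'.map (ramHom (d * e) hn)) (e * c) with hQ₀
  have hcoeff : ∀ i, Q.coeff i = ((root d ^ (m * (i.choose 2 : ℕ)) : Cˣ) : C) *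
      (ramHom d hd (L'.coeff i)).coeff (c - m * i) := fun i => by
    rw [hQ, coeff_symb, coeff_twCoeff, Polynomial.coeff_map]
  have hcoeff₀ : ∀ i, Q₀.coeff i = (((root (d * e) ^ e) ^ (m * (i.choose 2 : ℕ)) : Cˣ) : C) *
      (ramHom d hd (L'.coeff i)).coeff (c - m * i) := fun i => by
    rw [hQ₀, neg_neg, coeff_symb, coeff_twCoeff_mul hd he]
  have hzero : ∀ i, Q.coeff i = 0 ↔ Q₀.coeff i = 0 := fun i => by
    rw [hcoeff, hcoeff₀, Units.mul_right_eq_zero, Units.mul_right_eq_zero]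
  -- The ramified coefficients are series in t^d, so d divides c - mi, and m is invertible modulo d.
  have hdvd : ∀ i, Q.coeff i ≠ 0 → (d : ℤ) ∣ i - i₀ := by
    have h1 : ∀ i, Q.coeff i ≠ 0 → (d : ℤ) ∣ c - m * i := fun i hi => by
      by_contra h
      rw [hcoeff, coeff_ramHom_of_not_dvd hd _ h, mul_zero] at hi
      exact hi rfl
    intro i hi
    have h2 : (d : ℤ) ∣ m * (i - i₀) := by
      have := dvd_sub (h1 i₀ hi₀) (h1 i hi)
      rwa [show c - m * i₀ - (c - m * i) = m * (i - i₀ : ℤ) by ring] at this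
    exact hcop.symm.dvd_of_dvd_mul_left h2
  obtain ⟨ζ, hζ⟩ : ∃ ζ : Cˣ, ζ = root d * (root (d * e) ^ e)⁻¹ := ⟨_, rfl⟩
  have hζd : ζ ^ d = 1 := by
    rw [hζ, mul_pow, h_root d hd0, inv_pow, ← pow_mul, mul_comm e,
      h_root (d * e) (Nat.pos_of_ne_zero hn), mul_inv_cancel]
  have hp : root d = ζ * root (d * e) ^ e := by rw [hζ, inv_mul_cancel_right]
  have hpn := norm_root hq_norm h_root hd
  have hp₀n := norm_root hq_norm h_root hn
  have hζn : ‖(ζ : C)‖ = 1 := by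
    rw [← pow_eq_one_iff_of_nonneg (norm_nonneg _) hd, ← norm_pow, ← Units.val_pow_eq_pow_val,
      hζd, Units.val_one, norm_one]
  obtain ⟨x, hx⟩ := IsAlgClosed.exists_pow_nat_eq (ζ : C) (n := 2) two_pos
  have hx0 : x ≠ 0 := by
    rintro rfl
    exact ζ.ne_zero (by rw [← hx]; simp)
  obtain ⟨θ, rfl⟩ : ∃ θ : Cˣ, θ ^ 2 = ζ := ⟨Units.mk0 x hx0, Units.ext (by simpa using hx)⟩
  obtain ⟨κ, s, hκ⟩ := exists_pow_choose_two θ d hζd i₀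
  have hQQ₀ : ∀ i, Q.coeff i = ((κ ^ m : Cˣ) : C) * ((s ^ m : Cˣ) : C) ^ i * Q₀.coeff i := by
    intro i
    by_cases hi : Q.coeff i = 0
    · rw [hi, (hzero i).1 hi, mul_zero]
    · rw [hcoeff, hcoeff₀, ← mul_assoc]
      congr 1
      rw [← Units.val_pow_eq_pow_val, ← Units.val_mul, ← Units.val_mul]
      congr 1
      rw [hp, mul_zpow]
      congr 1
      rw [mul_comm m, zpow_mul, zpow_natCast, hκ i (hdvd i hi), mul_zpow, ← zpow_natCast s,
        ← zpow_natCast (s ^ m), ← zpow_mul, ← zpow_mul, mul_comm m]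
  have heval : ∀ x : C, Q.eval x = ((κ ^ m : Cˣ) : C) * Q₀.eval (((s ^ m : Cˣ) : C) * x) := by
    intro x
    have h1 : Q = Polynomial.C ((κ ^ m : Cˣ) : C) *
        Q₀.comp (Polynomial.C ((s ^ m : Cˣ) : C) * Polynomial.X) := by
      ext i
      rw [Polynomial.coeff_C_mul, Polynomial.comp_C_mul_X_coeff, hQQ₀]
      ring
    conv_lhs => rw [h1]
    simp
  -- This disposes of the powers ζ^N by which the two orbits differ.
  have hrot : ∀ (y : Cˣ) (x : C), y ^ d = 1 →
      Q₀.eval (y * x) = ((y ^ i₀ : Cˣ) : C) * Q₀.eval x := by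
    intro y x hy
    have h1 : Q₀.comp (Polynomial.C (y : C) * Polynomial.X) =
        Polynomial.C ((y ^ i₀ : Cˣ) : C) * Q₀ := by
      ext i
      rw [Polynomial.coeff_C_mul, Polynomial.comp_C_mul_X_coeff]
      by_cases hi : Q.coeff i = 0
      · rw [(hzero i).1 hi, zero_mul, mul_zero]
      · rw [mul_comm, ← Units.val_pow_eq_pow_val]
        congr 2
        obtain ⟨l, hl⟩ := hdvd i hi
        rw [← zpow_natCast, ← zpow_natCast, show (i : ℤ) = i₀ + d * l by linarith, zpow_add,
          zpow_mul, zpow_natCast y d, hy, one_zpow, mul_one]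
    have h2 := congrArg (Polynomial.eval x) h1
    simpa using h2
  set ρ : Cˣ := s ^ m * (lam * root d ^ k) with hρ
  have hρ0 : Q₀.eval (ρ : C) = 0 := by
    have h1 := heval ((lam * root d ^ k : Cˣ) : C)
    rw [hk, ← Units.val_mul] at h1
    exact (mul_eq_zero.1 h1.symm).resolve_left (Units.ne_zero _)
  have hnorm : ∀ N : ℕ, ‖Q.eval ((lam * root d ^ (k + N) : Cˣ) : C)‖ =
      ‖((κ ^ m : Cˣ) : C)‖ * ‖Q₀.eval ((ρ : C) * (root (d * e) : C) ^ (e * N))‖ := by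
    intro N
    rw [heval, norm_mul, ← Units.val_mul]
    congr 1
    have h1 : s ^ m * (lam * root d ^ (k + N)) = (θ ^ 2) ^ N * (ρ * root (d * e) ^ (e * N)) := by
      have h2 : root d ^ (N : ℤ) = (θ ^ 2) ^ N * root (d * e) ^ (e * N) := by
        rw [zpow_natCast, hp, mul_pow, ← pow_mul (root (d * e))]
      rw [zpow_add, h2, hρ]
      generalize root d ^ k = a, (θ ^ 2) ^ N = b, root (d * e) ^ (e * N) = b', s ^ m = a'
      ac_rfl
    rw [h1, Units.val_mul, hrot _ _ (by rw [← pow_mul, mul_comm N, pow_mul, hζd, one_pow]),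
      norm_mul, Units.val_mul, Units.val_pow_eq_pow_val (root (d * e))]
    simp only [Units.val_pow_eq_pow_val, norm_pow] at hζn ⊢
    rw [hζn, one_pow, one_pow, one_mul]
  have hq_root' : ∀ n : ℕ, 0 < n → (q : C) ^ n ≠ 1 := fun n hn h =>
    hq_root n hn (Units.ext (by simpa using h))
  obtain ⟨J, hJ⟩ := (evGeomBelow_const (norm_pos_iff.2 (κ ^ m).ne_zero)).mul
    (evGeomBelow_eval_of_root hp₀n (geomBelow_pochhammer_self hp₀n hq_root' hq_conv hn
      (by rw [← Units.val_pow_eq_pow_val, h_root _ (Nat.pos_of_ne_zero hn)]))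
      hc₀.symb_ne_zero hadm ρ.ne_zero hρ0 (Nat.pos_of_ne_zero he))
  refine ⟨k + J, ?_⟩
  have h1 := hJ J le_rfl
  refine h1.mono (fun N => by positivity) fun N => le_of_eq ?_
  refine (hnorm (J + N)).symm.trans ?_
  push_cast
  rw [add_assoc]

end Admissibility

/-! ## Cyclic vectors and extension of scalars -/

section Cyclic

variable {F : Type u} [Field F] {σ : F ≃+* F}

theorem map_opAt {V V' : Type*} [AddCommGroup V] [Module F V] [AddCommGroup V'] [Module F V']
    {S : V →ₛₗ[(σ : F →+* F)] V} {S' : V' →ₛₗ[(σ : F →+* F)] V'} (f : V →ₗ[F] V')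
    (hf : ∀ v, f (S v) = S' (f v)) (v : V) (P : F[X]) :
    f (opAt S v P) = opAt S' (f v) P := by
  have h : ∀ i, f (S^[i] v) = S'^[i] (f v) := fun i =>
    (Function.Semiconj.iterate_right (f := f) (ga := S) (gb := S') hf i) v
  induction P using Polynomial.induction_on' with
  | add P Q hP hQ => rw [map_add, map_add, hP, hQ, map_add]
  | monomial i a => rw [opAt_monomial, map_smul, h, opAt_monomial]

theorem skewMul_one (P : F[X]) : skewMul σ P 1 = P := by
  ext k
  rw [coeff_skewMul, Finset.sum_eq_single (k, 0)]
  · simp [iterate_map_one]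
  · rintro ⟨i, j⟩ h hne
    rw [Finset.HasAntidiagonal.mem_antidiagonal] at h
    have hj : j ≠ 0 := by
      rintro rfl
      exact hne (Prod.ext (by simpa using h) rfl)
    simp [Polynomial.coeff_one, hj, iterate_map_zero]
  · intro h
    simp at h

theorem opAt_eq_sum {V : Type*} [AddCommGroup V] [Module F V] (S : V →ₛₗ[(σ : F →+* F)] V) (v : V)
    {P : F[X]} {n : ℕ} (hP : P.degree < n) :
    opAt S v P = ∑ i : Fin n, P.coeff i • S^[i] v := by
  rw [opAt_apply, Polynomial.sum_eq_of_subset (s := Finset.range n) _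
    (fun i => zero_smul F (S^[i] v)), Finset.sum_range]
  intro i hi
  rw [Finset.mem_range]
  exact_mod_cast (Polynomial.le_degree_of_ne_zero (Polynomial.mem_support_iff.1 hi)).trans_lt hP

/-- `m` generates `M` and its annihilator is the left ideal generated by `L`. -/
structure QDiffModule.IsCyclic (M : QDiffModule.{u, v} F σ) (m : M.carrier) (L : F[X]) :
    Prop where
  surjective : ∀ x, ∃ P, opAt M.Sig m P = x
  eq_zero_iff : ∀ P, opAt M.Sig m P = 0 ↔ ∃ W, P = skewMul σ W L

theorem QDiffModule.IsAssociated.exists_isCyclic {M : QDiffModule.{u, v} F σ} {L : F[X]}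
    (h : M.IsAssociated L) : ∃ m, M.IsCyclic m L := by
  obtain ⟨e, he⟩ := h
  have key : ∀ P, e (opAt M.Sig (e.symm ((leftIdeal σ L).mkQ 1)) P) = (leftIdeal σ L).mkQ P := by
    intro P
    have h1 := map_opAt (S := M.Sig) (S' := quotientSig σ L) e.toLinearMap he
      (e.symm ((leftIdeal σ L).mkQ 1)) P
    have h2 := map_opAt (S := sigmaMul σ) (S' := quotientSig σ L) (leftIdeal σ L).mkQ
      (fun _ => rfl) 1 P
    rw [LinearEquiv.coe_coe, e.apply_symm_apply, ← h2] at h1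
    rw [h1]
    exact congrArg _ (skewMul_one P)
  refine ⟨e.symm ((leftIdeal σ L).mkQ 1), fun x => ?_, fun P => ?_⟩
  · obtain ⟨P, hP⟩ := (leftIdeal σ L).mkQ_surjective (e x)
    exact ⟨P, e.injective ((key P).trans hP)⟩
  · rw [← mem_leftIdeal_iff, ← Submodule.Quotient.mk_eq_zero, ← Submodule.mkQ_apply, ← e.map_eq_zero_iff,
      key]

namespace QDiffModule.IsCyclic

variable {M : QDiffModule.{u, v} F σ} {m : M.carrier} {L : F[X]} (h : M.IsCyclic m L)

include h

theorem opAt_self : opAt M.Sig m L = 0 :=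
  (h.eq_zero_iff L).2 ⟨1, by rw [skewMul, opAt_one]⟩

/-- Otherwise the infinite-dimensional space of all operators would embed in M. -/
theorem ne_zero : L ≠ 0 := by
  rintro rfl
  have hinj : Function.Injective (opAt M.Sig m) := by
    rw [injective_iff_map_eq_zero]
    intro P hP
    obtain ⟨W, rfl⟩ := (h.eq_zero_iff P).1 hP
    exact opAt_zero _ _
  exact Polynomial.not_finite (Module.Finite.of_injective _ hinj)

/-- If L = σL₁, injectivity of Σ makes L₁ annihilate m although its degree is too small. The Newton
polygon argument for an edge starting at 0 needs this. -/
theorem coeff_zero_ne_zero : L.coeff 0 ≠ 0 := by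
  intro h0
  set L₁ : F[X] := L.divX.map (σ.symm : F →+* F) with hL₁
  have hL : sigmaMul σ L₁ = L := by
    change Polynomial.X * L₁.map (σ : F →+* F) = L
    rw [hL₁, Polynomial.map_map]
    have h1 : (σ : F →+* F).comp (σ.symm : F →+* F) = RingHom.id F := by
      ext x
      simp
    rw [h1, Polynomial.map_id, mul_comm]
    conv_rhs => rw [← Polynomial.divX_mul_X_add L, h0, Polynomial.C_0, add_zero]
  have h1 : opAt M.Sig m L₁ = 0 := by
    apply M.bijective.injective
    rw [← opAt_sigmaMul, hL, h.opAt_self, map_zero]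
  obtain ⟨W, hW⟩ := (h.eq_zero_iff L₁).1 h1
  have hW0 : W = 0 := by
    refine eq_zero_of_degree_skewMul_lt (σ := σ) (Q := L) ?_
    rw [← hW, hL₁, Polynomial.degree_map]
    exact Polynomial.degree_divX_lt h.ne_zero
  rw [hW0, zero_skewMul] at hW
  rw [hW, map_zero] at hL
  exact h.ne_zero hL.symm

/-- The basis `m, Σ m, …, Σ^{r-1} m`. -/
theorem exists_basis : ∃ b : Module.Basis (Fin L.natDegree) F M.carrier,
    ∀ i, b i = M.Sig^[i] m := by
  have hLd := Polynomial.degree_eq_natDegree h.ne_zero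
  have hli : LinearIndependent F fun i : Fin L.natDegree => M.Sig^[i] m := by
    rw [Fintype.linearIndependent_iff]
    intro g hg
    set P : F[X] := ∑ i : Fin L.natDegree, Polynomial.monomial (i : ℕ) (g i) with hP
    have hPc : ∀ i : Fin L.natDegree, P.coeff i = g i := fun i => by
      simp [hP, Polynomial.finsetSum_coeff, Polynomial.coeff_monomial, Fin.val_inj]
    have hPd : P.degree < L.natDegree := by
      rw [Polynomial.degree_lt_iff_coeff_zero]
      intro k hk
      rw [hP, Polynomial.finsetSum_coeff]
      exact Finset.sum_eq_zero fun i _ =>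
        Polynomial.coeff_monomial_of_ne _ (by have := i.2; omega)
    have hP0 : opAt M.Sig m P = 0 := by
      rw [opAt_eq_sum _ _ hPd, ← hg]
      simp only [hPc]
    obtain ⟨W, hW⟩ := (h.eq_zero_iff P).1 hP0
    have hW0 := eq_zero_of_degree_skewMul_lt (σ := σ) (P := W) (Q := L) (by rwa [← hW, hLd])
    rw [hW0, zero_skewMul] at hW
    intro i
    rw [← hPc, hW, Polynomial.coeff_zero]
  have hsp : ⊤ ≤ Submodule.span F (Set.range fun i : Fin L.natDegree => M.Sig^[i] m) := by
    rintro x -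
    obtain ⟨P, rfl⟩ := h.surjective x
    obtain ⟨W, R, e, hR⟩ := exists_skew_division (σ := σ) L h.ne_zero P
    rw [e, map_add, opAt_skewMul, h.opAt_self, opAt_zero, zero_add, opAt_eq_sum _ _ (hLd ▸ hR)]
    exact sum_mem fun i _ => Submodule.smul_mem _ _ (Submodule.subset_span ⟨i, rfl⟩)
  exact ⟨Module.Basis.mk hli hsp, fun i => Module.Basis.mk_apply _ _ _⟩

end QDiffModule.IsCyclic

end Cyclic

/-! ### Formal completion of modules, bases and cyclic vectors. -/

section Formal

variable {C : Type u} [NormedField C] {q : Cˣ}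

/-- The inclusion of a `q`-difference module into its formal completion. -/
def QDiffModule.toFormal (M : QDiffModule.{u, v} (MeroGerm C) (sigma q)) :
    M.carrier →+ M.formal.carrier :=
  (TensorProduct.mk (MeroGerm C) C⸨X⸩ M.carrier 1).toAddMonoidHom

theorem toFormal_smul (M : QDiffModule.{u, v} (MeroGerm C) (sigma q)) (a : MeroGerm C)
    (x : M.carrier) : M.toFormal (a • x) = (a : C⸨X⸩) • M.toFormal x := by
  change (1 : C⸨X⸩) ⊗ₜ[MeroGerm C] (a • x) = (a : C⸨X⸩) • ((1 : C⸨X⸩) ⊗ₜ[MeroGerm C] x)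
  rw [← TensorProduct.smul_tmul, TensorProduct.smul_tmul', smul_eq_mul, mul_one, Algebra.smul_def,
    mul_one]
  rfl

theorem formal_Sig_toFormal (M : QDiffModule.{u, v} (MeroGerm C) (sigma q)) (x : M.carrier) :
    M.formal.Sig (M.toFormal x) = M.toFormal (M.Sig x) := by
  change (sigmaHat q 1) ⊗ₜ[MeroGerm C] M.Sig x = _
  rw [map_one]
  rfl

theorem toFormal_injective (M : QDiffModule.{u, v} (MeroGerm C) (sigma q)) :
    Function.Injective M.toFormal :=
  Module.Flat.tensorProduct_mk_injective (R := MeroGerm C) (S := C⸨X⸩) M.carrier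

theorem finrank_formal (M : QDiffModule.{u, v} (MeroGerm C) (sigma q)) :
    Module.finrank C⸨X⸩ M.formal.carrier = Module.finrank (MeroGerm C) M.carrier :=
  Module.finrank_baseChange

theorem exists_basis_formal (M : QDiffModule.{u, v} (MeroGerm C) (sigma q)) {ι : Type*}
    (b : Module.Basis ι (MeroGerm C) M.carrier) :
    ∃ b' : Module.Basis ι C⸨X⸩ M.formal.carrier, ∀ i, b' i = M.toFormal (b i) :=
  ⟨b.baseChange C⸨X⸩, fun _ => Module.Basis.baseChange_apply _ _ _⟩

theorem iterate_formal_Sig_toFormal (M : QDiffModule.{u, v} (MeroGerm C) (sigma q)) (i : ℕ)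
    (x : M.carrier) : M.formal.Sig^[i] (M.toFormal x) = M.toFormal (M.Sig^[i] x) :=
  ((Function.Semiconj.iterate_right (f := M.toFormal)
    (ga := M.Sig) (gb := M.formal.Sig) (fun x => (formal_Sig_toFormal M x).symm) i) x).symm

theorem opAt_formal_map (M : QDiffModule.{u, v} (MeroGerm C) (sigma q)) (x : M.carrier)
    (P : (MeroGerm C)[X]) :
    opAt M.formal.Sig (M.toFormal x) (P.map (MeroGerm C).subtype) =
      M.toFormal (opAt M.Sig x P) := by
  induction P using Polynomial.induction_on' with
  | add P Q hP hQ => rw [Polynomial.map_add, map_add, hP, hQ, map_add, map_add]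
  | monomial i a =>
    rw [Polynomial.map_monomial, opAt_monomial, opAt_monomial, iterate_formal_Sig_toFormal,
      toFormal_smul]
    rfl

/-- The basis m, Σm, …, Σ^(r-1)m remains a basis over C((x)), so the remainder of an annihilator on
division by L vanishes. -/
theorem QDiffModule.IsCyclic.formal {M : QDiffModule.{u, v} (MeroGerm C) (sigma q)} {m : M.carrier}
    {L : (MeroGerm C)[X]} (h : M.IsCyclic m L) :
    M.formal.IsCyclic (M.toFormal m) (L.map (MeroGerm C).subtype) := by
  have hL0 : opAt M.formal.Sig (M.toFormal m) (L.map (MeroGerm C).subtype) = 0 := by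
    rw [opAt_formal_map, h.opAt_self, map_zero]
  obtain ⟨b, hb⟩ := h.exists_basis
  obtain ⟨b', hb'⟩ := exists_basis_formal M b
  refine ⟨fun z => ?_, fun P => ⟨fun hP => ?_, ?_⟩⟩
  · refine ⟨∑ i : Fin L.natDegree, Polynomial.monomial (i : ℕ) (b'.repr z i), ?_⟩
    conv_rhs => rw [← b'.sum_repr z]
    rw [map_sum]
    refine Finset.sum_congr rfl fun i _ => ?_
    rw [opAt_monomial, iterate_formal_Sig_toFormal, hb', hb]
  · have hL : L.map (MeroGerm C).subtype ≠ 0 :=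
      (Polynomial.map_ne_zero_iff (MeroGerm C).subtype.injective).2 h.ne_zero
    obtain ⟨W, R, e, hR⟩ := exists_skew_division (σ := sigmaHat q) _ hL P
    refine ⟨W, ?_⟩
    rw [e, map_add, opAt_skewMul, hL0, opAt_zero, zero_add] at hP
    rw [Polynomial.degree_map, Polynomial.degree_eq_natDegree h.ne_zero] at hR
    rw [opAt_eq_sum _ _ hR] at hP
    simp only [iterate_formal_Sig_toFormal, ← hb, ← hb'] at hP
    have h0 := Fintype.linearIndependent_iff.1 b'.linearIndependent (fun i => R.coeff i) hP
    suffices R = 0 by rw [e, this, add_zero]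
    ext k
    rw [Polynomial.coeff_zero]
    rcases lt_or_ge k L.natDegree with hk | hk
    · exact congrArg (HahnSeries.coeff · _) (h0 ⟨k, hk⟩)
    · exact congrArg (HahnSeries.coeff · _) ((Polynomial.degree_lt_iff_coeff_zero _ _).1 hR k hk)
  · rintro ⟨W, rfl⟩
    rw [opAt_skewMul, hL0, opAt_zero]

theorem QDiffModule.Isomorphic.formal {M : QDiffModule.{u, v} (MeroGerm C) (sigma q)}
    {N : QDiffModule.{u, w} (MeroGerm C) (sigma q)} (h : M.Isomorphic N) :
    M.formal.Isomorphic N.formal := by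
  obtain ⟨e, he⟩ := h
  let φ : C⸨X⸩ ⊗[MeroGerm C] M.carrier ≃ₗ[C⸨X⸩] C⸨X⸩ ⊗[MeroGerm C] N.carrier :=
    TensorProduct.AlgebraTensorModule.congr (LinearEquiv.refl _ _) e
  refine ⟨φ, fun z => ?_⟩
  change C⸨X⸩ ⊗[MeroGerm C] M.carrier at z
  induction z using TensorProduct.induction_on with
  | zero => exact (congrArg φ (map_zero M.formal.Sig)).trans ((map_zero φ).trans
      ((congrArg N.formal.Sig (map_zero φ)).trans (map_zero N.formal.Sig)).symm)
  | tmul a x =>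
    change (sigmaHat q a) ⊗ₜ[MeroGerm C] e (M.Sig x) = (sigmaHat q a) ⊗ₜ[MeroGerm C] N.Sig (e x)
    rw [he]
  | add z z' hz hz' =>
    refine (congrArg φ (map_add M.formal.Sig z z')).trans ?_
    refine ((map_add φ _ _).trans ?_).trans (congrArg N.formal.Sig (map_add φ z z')).symm
    refine Eq.trans ?_ (map_add N.formal.Sig _ _).symm
    exact congrArg₂ (· + ·) hz hz'

/-- A formal isomorphism which maps `M` into `N` descends. -/
theorem isomorphic_of_formal {M : QDiffModule.{u, v} (MeroGerm C) (sigma q)}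
    {N : QDiffModule.{u, w} (MeroGerm C) (sigma q)}
    (φ : M.formal.carrier ≃ₗ[C⸨X⸩] N.formal.carrier)
    (hφ : ∀ z, φ (M.formal.Sig z) = N.formal.Sig (φ z))
    (h : ∀ x : M.carrier, ∃ y : N.carrier, φ (M.toFormal x) = N.toFormal y) : M.Isomorphic N := by
  choose f hf using h
  let f' : M.carrier →ₗ[MeroGerm C] N.carrier :=
    { toFun := f
      map_add' := fun x y => toFormal_injective N <| by
        rw [← hf, map_add, map_add, map_add, hf, hf]
      map_smul' := fun a x => toFormal_injective N <| by
        rw [← hf, toFormal_smul, map_smul, hf, RingHom.id_apply, toFormal_smul] }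
  have hinj : Function.Injective f' := fun x y hxy => toFormal_injective M <| φ.injective <| by
    rw [hf, hf]
    exact congrArg _ hxy
  have hdim : Module.finrank (MeroGerm C) M.carrier = Module.finrank (MeroGerm C) N.carrier := by
    rw [← finrank_formal, ← finrank_formal, φ.finrank_eq]
  refine ⟨LinearMap.linearEquivOfInjective f' hinj hdim, fun x => toFormal_injective N ?_⟩
  rw [LinearMap.linearEquivOfInjective_apply, LinearMap.linearEquivOfInjective_apply]
  change N.toFormal (f (M.Sig x)) = N.toFormal (N.Sig (f x))
  rw [← hf, ← formal_Sig_toFormal, ← formal_Sig_toFormal, hφ, hf]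

end Formal

/-! ### From formal to convergent isomorphisms. -/

section Comparison

variable {C : Type u} [NormedField C] {q : Cˣ}

theorem map_convToMero (L : (ConvSeries C)[X]) :
    (L.map convToMero).map (MeroGerm C).subtype =
      (L.map (ConvSeries C).subtype).map (HahnSeries.ofPowerSeries ℤ C) := by
  rw [Polynomial.map_map, Polynomial.map_map]
  rfl

/-- If y solves L' in the rank one module of lam, then LU = WL' makes Uy a solution of L, nonzero
since VU ≡ 1 modulo L'. So lam p^k is a root of the symbol of L for some k, and the admissibility of
L applies to it. -/
theorem symbCompatible_of_isAlmostAdmissibleOp [IsAlgClosed C] (hq_norm : ‖(q : C)‖ = 1)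
    (hq_root : ∀ n : ℕ, 0 < n → q ^ n ≠ 1) (hq_conv : IsConvergent (phi (q : C) {(q : C)}))
    {root : ℕ → Cˣ} (h_root : ∀ n : ℕ, 0 < n → root n ^ n = q) {L L' : (C⟦X⟧)[X]}
    (hL : IsAlmostAdmissibleOp root L) (hL' : IsAlmostAdmissibleOp root L') {U V W W' : C⸨X⸩[X]}
    (hU : skewMul (sigmaHat q) (L.map (HahnSeries.ofPowerSeries ℤ C)) U =
      skewMul (sigmaHat q) W (L'.map (HahnSeries.ofPowerSeries ℤ C)))
    (hV : skewMul (sigmaHat q) V U - 1 =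
      skewMul (sigmaHat q) W' (L'.map (HahnSeries.ofPowerSeries ℤ C))) :
    SymbCompatible root (L.map (HahnSeries.ofPowerSeries ℤ C))
      (L'.map (HahnSeries.ofPowerSeries ℤ C)) := by
  intro d hd m lam c c' hcop hc hc' hk
  have hpd := h_root d (Nat.pos_of_ne_zero hd)
  refine ⟨symbGeom_of_isAlmostAdmissibleOp hq_norm hq_root hq_conv h_root hL hcop hc ?_,
    symbGeom_of_isAlmostAdmissibleOp hq_norm hq_root hq_conv h_root hL' hcop hc' hk⟩
  obtain ⟨y, hy0, hy⟩ := exists_solution (root_pow_ne_one hq_root h_root hd) hc' hk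
  have hy' : ramAct (root d) m lam hd y (L'.map (HahnSeries.ofPowerSeries ℤ C)) = 0 := hy
  refine exists_root_of_opAt_eq_zero hc (y := ramAct (root d) m lam hd y U) (fun h0 => hy0 ?_) ?_
  · have h1 := congrArg (ramAct (root d) m lam hd y) hV
    rw [ramAct_sub, ramAct_skewMul hpd, ramAct_skewMul hpd, h0, hy', ramAct_zero, ramAct_zero,
      zero_sub, neg_eq_zero, ramAct, Polynomial.map_one, opAt_one] at h1
    exact h1
  · have h1 := congrArg (ramAct (root d) m lam hd y) hU
    rwa [ramAct_skewMul hpd, ramAct_skewMul hpd, hy', ramAct_zero] at h1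

theorem isomorphic_of_formal_isomorphic [IsAlgClosed C] (hq_norm : ‖(q : C)‖ = 1)
    (hq_root : ∀ n : ℕ, 0 < n → q ^ n ≠ 1) (hq_conv : IsConvergent (phi (q : C) {(q : C)}))
    {root : ℕ → Cˣ} (h_root : ∀ n : ℕ, 0 < n → root n ^ n = q)
    {M : QDiffModule.{u, v} (MeroGerm C) (sigma q)} {N : QDiffModule.{u, w} (MeroGerm C) (sigma q)}
    (hM : M.IsAlmostAdmissible root) (hN : N.IsAlmostAdmissible root)
    (h : M.formal.Isomorphic N.formal) : M.Isomorphic N := by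
  obtain ⟨L, hL, hML⟩ := hM
  obtain ⟨L', hL', hNL'⟩ := hN
  obtain ⟨m, hm⟩ := hML.exists_isCyclic
  obtain ⟨n, hn⟩ := hNL'.exists_isCyclic
  have hmf := hm.formal
  have hnf := hn.formal
  have hLc : IsConvOp ((L.map convToMero).map (MeroGerm C).subtype) := isConvOp_iff.2 ⟨_, rfl⟩
  have hL'c : IsConvOp ((L'.map convToMero).map (MeroGerm C).subtype) := isConvOp_iff.2 ⟨_, rfl⟩
  have hLne := hmf.ne_zero
  have hL'0 := hnf.coeff_zero_ne_zero
  obtain ⟨φ, hφ⟩ := h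
  have hφS := map_opAt φ.toLinearMap hφ
  have hφS' := map_opAt (S := N.formal.Sig) (S' := M.formal.Sig) φ.symm.toLinearMap fun z => by
    apply φ.injective
    change φ (φ.symm _) = φ (M.formal.Sig (φ.symm z))
    rw [hφ, φ.apply_symm_apply, φ.apply_symm_apply]
  simp only [LinearEquiv.coe_coe] at hφS hφS'
  -- U and V represent the isomorphism and its inverse on cyclic vectors.
  obtain ⟨U, hU⟩ := hnf.surjective (φ (M.toFormal m))
  obtain ⟨V, hV⟩ := hmf.surjective (φ.symm (N.toFormal n))
  obtain ⟨W, hW⟩ := (hnf.eq_zero_iff (skewMul (sigmaHat q)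
    ((L.map convToMero).map (MeroGerm C).subtype) U)).1 (by
    rw [opAt_skewMul, hU, ← hφS, hmf.opAt_self, map_zero])
  obtain ⟨W', hW'⟩ := (hnf.eq_zero_iff (skewMul (sigmaHat q) V U - 1)).1 (by
    rw [map_sub, opAt_skewMul, hU, ← hφS, hV, φ.apply_symm_apply, opAt_one, sub_self])
  have hcomp : SymbCompatible root ((L.map convToMero).map (MeroGerm C).subtype)
      ((L'.map convToMero).map (MeroGerm C).subtype) := by
    simp only [map_convToMero] at hW hW' ⊢
    exact symbCompatible_of_isAlmostAdmissibleOp hq_norm hq_root hq_conv h_root hL hL' hW hW'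
  obtain ⟨W₁, hW₁⟩ := exists_isConvOp_sub_skewMul hq_norm hq_root h_root hLne hLc _ _ rfl hL'c
    hL'0 hcomp U W (fun i => by rw [hW, sub_self, Polynomial.coeff_zero]; exact zero_mem _)
  obtain ⟨H, hH⟩ := isConvOp_iff.1 hW₁
  -- Multiples of L' kill the cyclic vector n, so the convergent H represents the same image as U.
  have hφm : φ (M.toFormal m) = N.toFormal (opAt N.Sig n H) := by
    rw [← opAt_formal_map, hH, map_sub, hU, opAt_skewMul, hnf.opAt_self, opAt_zero, sub_zero]
  refine isomorphic_of_formal φ hφ fun x => ?_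
  obtain ⟨P, rfl⟩ := hm.surjective x
  refine ⟨opAt N.Sig (opAt N.Sig n H) P, ?_⟩
  rw [← opAt_formal_map, ← opAt_formal_map, ← hφm]
  exact hφS _ _

end Comparison

end QDiff

end

theorem mainTheorem7 {C : Type u} [NormedField C] [IsAlgClosed C]
    (q : Cˣ) (hq_norm : ‖(q : C)‖ = 1) (hq_root : ∀ n : ℕ, 0 < n → q ^ n ≠ 1)
    (hq_conv : QDiff.IsConvergent (QDiff.phi (q : C) {(q : C)}))
    (root : ℕ → Cˣ) (h_root : ∀ n : ℕ, 0 < n → root n ^ n = q)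
    (M : QDiff.QDiffModule.{u, v} (QDiff.MeroGerm C) (QDiff.sigma q))
    (N : QDiff.QDiffModule.{u, w} (QDiff.MeroGerm C) (QDiff.sigma q))
    (hM : M.IsAlmostAdmissible root) (hN : N.IsAlmostAdmissible root) :
    M.Isomorphic N ↔ M.formal.Isomorphic N.formal :=
  ⟨fun h => h.formal, QDiff.isomorphic_of_formal_isomorphic hq_norm hq_root hq_conv h_root hM hN⟩
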